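/- **Theorem (High frequency uniqueness).** Let $B\subset\mathbb{R}^2$ be the open unit disc with polar coordinates $(R,\theta)$, unit vectors $e_R,e_\theta$, and let $\nu>0$. Let $M\in L^\infty(B,\mathbb{R}^{16})$ be symmetric ($M_{ijkl}=M_{klij}$) with $M(x)\xi\cdot\xi\ge\nu|\xi|^2$ for a.e. $x\in B$ and all $\xi\in\mathbb{R}^{2\times2}$, where $(M\xi)_{ij}=\sum_{k,l}M_{ijkl}\xi_{kl}$, and put $$E(u)=\int_B M(x)\nabla u\cdot\nabla u\,dx .$$ Let $g\in W^{1,2}(S^1,\mathbb{R}^2)$, $b\in\mathbb{R}^2$, and $$\mathcal{A}^c=\{u\in W^{1,2}(B,\mathbb{R}^2):\ \det\nabla u=1\ \text{a.e.},\ u|_{\partial B}=g+b \text{ in the trace sense}\}.$$ Let $u\in\mathcal{A}^c$ be a stationary point of $E$ with corresponding pressure $\lambda$, i.e. $\lambda:B\to\mathbb{R}$ is weakly differentiable and $$\int_B M\nabla u\cdot\nabla\varphi\,dx=-\int_B\lambda\,\mathrm{cof}\nabla u\cdot\nabla\varphi\,dx\qquad\text{for all }\varphi\in C_c^\infty(B,\mathbb{R}^2).$$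 For $\eta\in L^2(B,\mathbb{R}^2)$ let $\eta^{(j)}$ be its $j$-th Fourier mode in $\theta$: $\eta^{(0)}=\tfrac12A_0(R)$ and $\eta^{(j)}=A_j(R)\cos j\theta+B_j(R)\sin j\theta$ for $j\ge1$, where $A_j(R)=\frac1\pi\int_0^{2\pi}\eta(R,\theta)\cos j\theta\,d\theta$, $B_j(R)=\frac1\pi\int_0^{2\pi}\eta(R,\theta)\sin j\theta\,d\theta$. Natural numbers include $0$, and sums of modes converge in $L^2(B)$. (i) (Purely high modes.) Let $n\in\mathbb{N}$ and suppose that $\big\|\,|R\nabla\lambda|\,\big\|_{L^\infty(B,dx/R)}\le n\nu$, where $|\cdot|$ is the Euclidean length. Then $u$ minimizes $E$ in $$\mathcal{F}_n^c=\Big\{v\in\mathcal{A}^c:\ \eta=v-u\in W_0^{1,2}(B,\mathbb{R}^2),\ \eta=\sum_{j\ge n}\eta^{(j)}\Big\}.$$ If moreover $|R\nabla\lambda|<n\nu$ on a measurable set $U\subset B$ of positive $dx/R$-measure, then $u$ is the unique minimizer of $E$ in $\mathcal{F}_n^c$. (ii) ($0$-mode and high modes.) Let $m\in\mathbb{N}$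 and suppose that $$\max\big\{\|R\,\partial_R\lambda\|_{L^\infty(B,dx/R)},\ \|\partial_\theta\lambda\|_{L^\infty(B,dx/R)}\big\}\le\frac{\sqrt3\,m\nu}{2\sqrt2}$$ (the two functions are the components of $R\nabla\lambda$ along $e_R$ and $e_\theta$). Then $u$ minimizes $E$ in $$\mathcal{F}_{0,m}^c=\Big\{v\in\mathcal{A}^c:\ \eta=v-u\in W_0^{1,2}(B,\mathbb{R}^2),\ \eta=\sum_{j=0\text{ or }j\ge m}\eta^{(j)}\Big\}.$$ If moreover $\max\{|R\,\partial_R\lambda|,|\partial_\theta\lambda|\}<\frac{\sqrt3\,m\nu}{2\sqrt2}$ on a measurable set $U\subset B$ of positive $dx/R$-measure, then $u$ is the unique minimizer of $E$ in $\mathcal{F}_{0,m}^c$. -/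

import Mathlib

open MeasureTheory Filter Topology Set
open scoped ContDiff ENNReal Matrix

/-- The plane with its Euclidean norm. -/
abbrev Plane : Type := EuclideanSpace ℝ (Fin 2)

/-- Real `2 × 2` matrices; a gradient has entries `(∇u) i j = ∂_j u_i`. -/
abbrev Mat2 : Type := Matrix (Fin 2) (Fin 2) ℝ

namespace HFU

noncomputable section

/-- The open unit disc `B`. -/
def disc : Set Plane := Metric.ball 0 1

/-- Lebesgue measure `dx` on `B`. -/
def discMeasure : Measure Plane := volume.restrict disc

/-- The measure `dx / R` on `B`, where `R = |x|`. -/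
def radialMeasure : Measure Plane :=
  discMeasure.withDensity (fun x => ENNReal.ofReal (1 / ‖x‖))

/-! ### Polar coordinates -/

/-- The point with polar coordinates `(R, t)`. -/
def polarPoint (R t : ℝ) : Plane := !₂[R * Real.cos t, R * Real.sin t]

/-- The polar angle of a point (any choice modulo `2π` would do). -/
def polarAngle (x : Plane) : ℝ := Complex.arg ⟨x 0, x 1⟩

/-- The radial unit vector `e_R` at `x ≠ 0`. -/
def eRad (x : Plane) : Plane := ‖x‖⁻¹ • x

/-- The angular unit vector `e_θ` at `x ≠ 0`. -/
def eAng (x : Plane) : Plane := ‖x‖⁻¹ • !₂[-x 1, x 0]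

/-! ### Matrices -/

/-- The Frobenius inner product. -/
def frob (A B : Mat2) : ℝ := ∑ i, ∑ j, A i j * B i j

/-- The cofactor matrix `(adj A)ᵀ`. -/
def cof (A : Mat2) : Mat2 := A.adjugateᵀ

/-- A coefficient tensor in `ℝ^16`. -/
abbrev Tensor4 : Type := Fin 2 → Fin 2 → Fin 2 → Fin 2 → ℝ

/-- The action of a tensor on a matrix, `(T ξ) i j = ∑_{k,l} T i j k l * ξ k l`. -/
def tens (T : Tensor4) (ξ : Mat2) : Mat2 :=
  Matrix.of fun i j => ∑ k, ∑ l, T i j k l * ξ k l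

/-! ### Weak derivatives and Sobolev maps on the disc -/

/-- Smooth functions with compact support in `B`. -/
def IsTest {F : Type*} [NormedAddCommGroup F] [NormedSpace ℝ F] (φ : Plane → F) : Prop :=
  ContDiff ℝ ∞ φ ∧ HasCompactSupport φ ∧ tsupport φ ⊆ disc

/-- The classical partial derivative in the `j`-th coordinate direction. -/
def partialDeriv (j : Fin 2) (φ : Plane → ℝ) (x : Plane) : ℝ :=
  fderiv ℝ φ x (EuclideanSpace.single j 1)

/-- The classical gradient matrix of a plane map. -/
def classicalGrad (φ : Plane → Plane) (x : Plane) : Mat2 :=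
  Matrix.of fun i j => partialDeriv j (fun y => φ y i) x

/-- `g` is a weak `j`-th partial derivative of `w` on `B`. -/
def IsWeakPartial (j : Fin 2) (w g : Plane → ℝ) : Prop :=
  LocallyIntegrableOn w disc ∧ LocallyIntegrableOn g disc ∧
    ∀ φ : Plane → ℝ, IsTest φ →
      ∫ x in disc, w x * partialDeriv j φ x = -∫ x in disc, g x * φ x

open Classical in
/-- The weak `j`-th partial derivative of `w` on `B`, if there is one (it is unique up to a null
set); the zero function otherwise. -/
def weakPartial (j : Fin 2) (w : Plane → ℝ) : Plane → ℝ :=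
  if h : ∃ g, IsWeakPartial j w g then h.choose else 0

theorem isWeakPartial_weakPartial {j : Fin 2} {w : Plane → ℝ} (h : ∃ g, IsWeakPartial j w g) :
    IsWeakPartial j w (weakPartial j w) := by
  rw [weakPartial, dif_pos h]
  exact h.choose_spec

/-- Weak partial derivatives are unique up to null sets. -/
theorem IsWeakPartial.ae_eq {j : Fin 2} {w g g' : Plane → ℝ} (h : IsWeakPartial j w g)
    (h' : IsWeakPartial j w g') : g =ᵐ[discMeasure] g' := by
  have hopen : IsOpen disc := Metric.isOpen_ball
  have key : ∀ᵐ x ∂(volume : Measure Plane), x ∈ disc → (g - g') x = 0 := by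
    refine hopen.ae_eq_zero_of_integral_contDiff_smul_eq_zero (h.2.1.sub h'.2.1) ?_
    intro φ hφ hc hs
    have integ : ∀ f : Plane → ℝ, LocallyIntegrableOn f disc →
        IntegrableOn (fun x => f x * φ x) disc := by
      intro f hf
      have hfK : IntegrableOn f (tsupport φ) := hf.integrableOn_compact_subset hs hc
      have h1 : IntegrableOn (fun x => f x * φ x) (tsupport φ) :=
        hfK.mul_continuousOn hφ.continuous.continuousOn hc
      refine (integrableOn_iff_integrable_of_support_subset ?_ |>.1 h1).integrableOn
      intro x hx
      exact subset_tsupport φ (fun h0 => hx (by simp [h0]))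
    have e1 := h.2.2 φ ⟨hφ, hc, hs⟩
    have e2 := h'.2.2 φ ⟨hφ, hc, hs⟩
    have e3 : ∫ x in disc, (g x * φ x - g' x * φ x) = 0 := by
      rw [integral_sub (integ g h.2.1) (integ g' h'.2.1)]
      linarith
    have e4 : ∫ x, φ x • (g - g') x = ∫ x in disc, (g x * φ x - g' x * φ x) := by
      rw [setIntegral_eq_integral_of_forall_compl_eq_zero]
      · refine integral_congr_ae (Eventually.of_forall fun x => ?_)
        simp only [Pi.sub_apply, smul_eq_mul]
        ring
      · intro x hx
        have : φ x = 0 := image_eq_zero_of_notMem_tsupport (fun h0 => hx (hs h0))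
        simp [this]
    rw [e4, e3]
  have key2 : ∀ᵐ x ∂discMeasure, (g - g') x = 0 := by
    rw [discMeasure, ae_restrict_iff' hopen.measurableSet]
    exact key
  filter_upwards [key2] with x hx
  exact sub_eq_zero.1 hx

/-- The weak gradient of a scalar function, as a vector field. -/
def weakGradScalar (w : Plane → ℝ) (x : Plane) : Plane :=
  !₂[weakPartial 0 w x, weakPartial 1 w x]

/-- The weak gradient matrix of a plane map. -/
def weakGrad (u : Plane → Plane) (x : Plane) : Mat2 :=
  Matrix.of fun i j => weakPartial j (fun y => u y i) x

/-- Membership in `W^{1,2}(B, ℝ²)`. -/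
def MemW12 (u : Plane → Plane) : Prop :=
  ∀ i, MemLp (fun x => u x i) 2 discMeasure ∧
    ∀ j, ∃ g, MemLp g 2 discMeasure ∧ IsWeakPartial j (fun x => u x i) g

/-- Convergence in `W^{1,2}(B, ℝ²)` of a sequence of smooth maps to `u`. -/
def TendstoW12 (w : ℕ → Plane → Plane) (u : Plane → Plane) : Prop :=
  Tendsto (fun k => eLpNorm (fun x => w k x - u x) 2 discMeasure) atTop (𝓝 0) ∧
    ∀ i j, Tendsto
      (fun k => eLpNorm (fun x => classicalGrad (w k) x i j - weakGrad u x i j) 2 discMeasure)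
      atTop (𝓝 0)

/-- Membership in `W_0^{1,2}(B, ℝ²)`, the closure of the test maps in `W^{1,2}`. -/
def MemW012 (η : Plane → Plane) : Prop :=
  MemW12 η ∧ ∃ w : ℕ → Plane → Plane, (∀ k, IsTest (w k)) ∧ TendstoW12 w η

/-- `W^{1,2}` functions on the unit circle, written as `2π`-periodic functions of the angle
(the absolutely continuous representative). -/
def MemW12Circle (g : ℝ → Plane) : Prop :=
  Function.Periodic g (2 * Real.pi) ∧
    ∃ g' : ℝ → Plane, MemLp g' 2 (volume.restrict (Ioc 0 (2 * Real.pi))) ∧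
      ∀ t ∈ Icc 0 (2 * Real.pi), g t = g 0 + ∫ s in (0 : ℝ)..t, g' s

/-- `u` has boundary trace `h` (a function of the angle) on the unit circle: `u` is a
`W^{1,2}` limit of maps that are smooth up to the boundary and whose boundary values converge
to `h` in `L²` of the circle. -/
def HasTrace (u : Plane → Plane) (h : ℝ → Plane) : Prop :=
  ∃ w : ℕ → Plane → Plane, (∀ k, ContDiff ℝ ∞ (w k)) ∧ TendstoW12 w u ∧
    Tendsto (fun k => eLpNorm (fun t => w k (polarPoint 1 t) - h t) 2
      (volume.restrict (Ioc 0 (2 * Real.pi)))) atTop (𝓝 0)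

/-! ### Energy, admissible maps, pressure -/

/-- `M ∈ L^∞(B, ℝ^16)` is symmetric and `ν Id ≤ M(x)` for a.e. `x ∈ B`. -/
structure IsCoefficient (ν : ℝ) (M : Plane → Tensor4) : Prop where
  bounded : ∀ i j k l, MemLp (fun x => M x i j k l) ⊤ discMeasure
  symmetric : ∀ᵐ x ∂discMeasure, ∀ i j k l, M x i j k l = M x k l i j
  elliptic : ∀ᵐ x ∂discMeasure, ∀ ξ : Mat2, ν * frob ξ ξ ≤ frob (tens (M x) ξ) ξ

/-- The energy `E(u) = ∫_B M(x) ∇u · ∇u dx`. -/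
def energy (M : Plane → Tensor4) (u : Plane → Plane) : ℝ :=
  ∫ x in disc, frob (tens (M x) (weakGrad u x)) (weakGrad u x)

/-- The incompressible admissible class `A^c`: maps in `W^{1,2}(B, ℝ²)` with `det ∇u = 1` a.e.
and boundary values `g + b`. -/
def admissible (g : ℝ → Plane) (b : Plane) : Set (Plane → Plane) :=
  {u | MemW12 u ∧ (∀ᵐ x ∂discMeasure, (weakGrad u x).det = 1) ∧ HasTrace u (fun t => g t + b)}

/-- `u` is a stationary point of the energy under the incompressibility constraint with
corresponding pressure `lam`: `lam` is weakly differentiable on `B` and the Euler-Lagrange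
equation `∫ M ∇u · ∇φ = - ∫ lam cof ∇u · ∇φ` holds for all test maps. -/
def IsStationaryWithPressure (M : Plane → Tensor4) (u : Plane → Plane) (lam : Plane → ℝ) : Prop :=
  (∀ j, ∃ g, IsWeakPartial j lam g) ∧
    ∀ φ : Plane → Plane, IsTest φ →
      ∫ x in disc, frob (tens (M x) (weakGrad u x)) (classicalGrad φ x) =
        -∫ x in disc, lam x * frob (cof (weakGrad u x)) (classicalGrad φ x)

/-! ### Fourier modes -/

/-- `A_j(R) = (1/π) ∫_0^{2π} η(R, t) cos(j t) dt`. -/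
def cosCoeff (η : Plane → Plane) (j : ℕ) (R : ℝ) : Plane :=
  (1 / Real.pi) • ∫ t in (0 : ℝ)..(2 * Real.pi), Real.cos (j * t) • η (polarPoint R t)

/-- `B_j(R) = (1/π) ∫_0^{2π} η(R, t) sin(j t) dt`. -/
def sinCoeff (η : Plane → Plane) (j : ℕ) (R : ℝ) : Plane :=
  (1 / Real.pi) • ∫ t in (0 : ℝ)..(2 * Real.pi), Real.sin (j * t) • η (polarPoint R t)

/-- The `j`-th Fourier mode `η^(j)`: `A_0(R)/2` for `j = 0`, and
`A_j(R) cos(jθ) + B_j(R) sin(jθ)` for `j ≥ 1`. -/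
def fourierMode (η : Plane → Plane) (j : ℕ) (x : Plane) : Plane :=
  if j = 0 then (1 / 2 : ℝ) • cosCoeff η 0 ‖x‖
  else Real.cos (j * polarAngle x) • cosCoeff η j ‖x‖ +
    Real.sin (j * polarAngle x) • sinCoeff η j ‖x‖

open Classical in
/-- `η = ∑_{j ∈ S} η^(j)`, as a convergent series in `L²(B, ℝ²)`. -/
def EqSumOfModes (η : Plane → Plane) (S : Set ℕ) : Prop :=
  Tendsto (fun N : ℕ =>
      eLpNorm (fun x => η x - ∑ j ∈ (Finset.range N).filter (· ∈ S), fourierMode η j x)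
        2 discMeasure)
    atTop (𝓝 0)

/-- Competitors `v ∈ A^c` such that `v - u` lies in `W_0^{1,2}` and is the sum of its Fourier
modes with index in `S`. -/
def competitors (g : ℝ → Plane) (b : Plane) (u : Plane → Plane) (S : Set ℕ) :
    Set (Plane → Plane) :=
  {v | v ∈ admissible g b ∧ MemW012 (fun x => v x - u x) ∧ EqSumOfModes (fun x => v x - u x) S}

/-- `F_n^c`: only modes `≥ n`. -/
def highModes (g : ℝ → Plane) (b : Plane) (u : Plane → Plane) (n : ℕ) : Set (Plane → Plane) :=
  competitors g b u {j | n ≤ j}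

/-- `F_{0,m}^c`: the `0`-mode and modes `≥ m`. -/
def zeroAndHighModes (g : ℝ → Plane) (b : Plane) (u : Plane → Plane) (m : ℕ) :
    Set (Plane → Plane) :=
  competitors g b u {j | j = 0 ∨ m ≤ j}

/-- `u` is a minimizer of `M`'s energy in the class `F`. -/
def IsMinimizer (M : Plane → Tensor4) (F : Set (Plane → Plane)) (u : Plane → Plane) : Prop :=
  u ∈ F ∧ ∀ v ∈ F, energy M u ≤ energy M v

/-- `u` is the unique minimizer in `F`, as an element of `W^{1,2}(B, ℝ²)`. -/
def IsUniqueMinimizer (M : Plane → Tensor4) (F : Set (Plane → Plane)) (u : Plane → Plane) : Prop :=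
  IsMinimizer M F u ∧ ∀ v, IsMinimizer M F v → v =ᵐ[discMeasure] u

/-! ### The weighted pressure gradient -/

/-- The vector field `R ∇lam`. -/
def scaledGrad (lam : Plane → ℝ) (x : Plane) : Plane := ‖x‖ • weakGradScalar lam x

/-- The radial component of `R ∇lam`. -/
def scaledGradRad (lam : Plane → ℝ) (x : Plane) : ℝ := inner ℝ (scaledGrad lam x) (eRad x)

/-- The angular component of `R ∇lam`. -/
def scaledGradAng (lam : Plane → ℝ) (x : Plane) : ℝ := inner ℝ (scaledGrad lam x) (eAng x)

/-- The `L^∞(B, ℝ², dx/R)` norm of `R ∇lam`, i.e. the essential supremum of its Euclidean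
length. -/
def supNorm (lam : Plane → ℝ) : ℝ≥0∞ := eLpNorm (scaledGrad lam) ⊤ radialMeasure

/-- The `L^∞(B, ℝ², dx/R)` norm of `R ∇lam` taken as the maximum over its two polar components;
it is at most `supNorm lam`. -/
def polarSupNorm (lam : Plane → ℝ) : ℝ≥0∞ :=
  max (eLpNorm (scaledGradRad lam) ⊤ radialMeasure) (eLpNorm (scaledGradAng lam) ⊤ radialMeasure)

/-- A property holds on a measurable subset of `B` that is nontrivial for `dx/R`. -/
def HoldsOnNontrivialSet (P : Plane → Prop) : Prop :=
  ∃ U : Set Plane, MeasurableSet U ∧ U ⊆ disc ∧ 0 < radialMeasure U ∧ ∀ x ∈ U, P x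

end

end HFU

/-! Write η = v - u. The energy is quadratic, so E(v) = E(u) + ∫ M∇η·∇η + L with L = 2∫ M∇u·∇η.
Ellipticity bounds the quadratic term below by ν(X + V), where X and V are the squared L² norms of
the angular part η_θ/R and the radial part η_R of ∇η. Everything rests on L. Since det ∇u = det ∇v =
1, cof ∇u·∇η = -det ∇η, and the Euler-Lagrange equation tested with η formally gives L = 2∫ λ det
∇η.

The determinant is a null Lagrangian, so integration by parts leaves only ∇λ. Each component is
first split into its mean on circles and an oscillating rest. Two radial functions have vanishing
Jacobian, so the undifferentiated factor can always be taken mean-free on circles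
(`PuncturedWeakGrad.integral_jac`). The integrand is then R∇λ times (η - mean)/R times first
derivatives of η, all scale invariant. Wirtinger's inequality on circles (`wirtinger`) bounds m ‖(η
- mean)/R‖ by √X if the modes strictly between 0 and m are absent.

For purely high modes the circle means vanish and Cauchy-Schwarz gives |L| ≤ ν √X √(X + V), whence
ν(X + V) + L ≥ 0. If the 0-mode is present, the radial derivative of the mean doubles the radial
contribution: |L| ≤ kν √X (√X + 2√V) with k = √3/(2√2), and the gap is at least ν((√V - k√X)² + (1 -
k - k²)X), where 1 - k - k² > 0. In both cases a zero gap forces V = 0, and a map in W_0^{1,2}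
without radial derivative is zero (`nrm_le_nrm_radl`).

The analytic work is to justify the formula for L: det ∇η is only integrable, λ may be unbounded,
and the equation holds for smooth test maps only. The bound on R∇λ makes λ locally bounded away from
the origin, and points have zero capacity in the plane, so η is approximated by test maps vanishing
near 0. The estimate |∫ h det(∇f, ∇φ)| ≤ 3c ‖∇f‖ ‖∇φ‖ (`abs_integral_jac_le`) depends on h only
through c = sup |x||∇h|. It therefore survives a truncation of λ, for which the pairing extends to
∇η, and then the removal of the truncation (`abs_pairing_le`, `tendsto_pairing`). -/

namespace HFU

/-! ### Rotations and polar coordinates -/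

/-- Rotation of the plane by the angle `t`. -/
noncomputable def rot (t : ℝ) : Plane ≃ₗᵢ[ℝ] Plane :=
  (Complex.orthonormalBasisOneI.repr.symm.trans (rotation (Circle.exp t))).trans
    Complex.orthonormalBasisOneI.repr

theorem rot_apply_zero (t : ℝ) (x : Plane) :
    rot t x 0 = Real.cos t * x 0 - Real.sin t * x 1 := by
  simp [rot, Complex.orthonormalBasisOneI_repr_symm_apply, Circle.coe_exp, Complex.exp_mul_I,
    ← Complex.ofReal_cos, ← Complex.ofReal_sin]

theorem rot_apply_one (t : ℝ) (x : Plane) :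
    rot t x 1 = Real.sin t * x 0 + Real.cos t * x 1 := by
  simp [rot, Complex.orthonormalBasisOneI_repr_symm_apply, Circle.coe_exp, Complex.exp_mul_I,
    ← Complex.ofReal_cos, ← Complex.ofReal_sin]
  ring

theorem plane_ext {x y : Plane} (h0 : x 0 = y 0) (h1 : x 1 = y 1) : x = y := by
  ext i; fin_cases i <;> assumption

theorem polarPoint_zero (R t : ℝ) : polarPoint R t 0 = R * Real.cos t := rfl
theorem polarPoint_one (R t : ℝ) : polarPoint R t 1 = R * Real.sin t := rfl

theorem rot_polarPoint (s R t : ℝ) : rot s (polarPoint R t) = polarPoint R (t + s) := by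
  apply plane_ext
  · rw [rot_apply_zero, polarPoint_zero, polarPoint_one, polarPoint_zero, Real.cos_add]; ring
  · rw [rot_apply_one, polarPoint_zero, polarPoint_one, polarPoint_one, Real.sin_add]; ring

theorem norm_sq_eq (x : Plane) : ‖x‖ ^ 2 = x 0 ^ 2 + x 1 ^ 2 := by
  rw [EuclideanSpace.norm_sq_eq, Fin.sum_univ_two]; simp

theorem norm_polarPoint {R : ℝ} (hR : 0 ≤ R) (t : ℝ) : ‖polarPoint R t‖ = R := by
  rw [← sq_eq_sq₀ (norm_nonneg _) hR, norm_sq_eq, polarPoint_zero, polarPoint_one]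
  nlinarith [Real.sin_sq_add_cos_sq t]

/-- At the origin any angle serves, so no case distinction is needed. -/
theorem exists_polarPoint (x : Plane) : ∃ s, x = polarPoint ‖x‖ s := by
  refine ⟨polarAngle x, ?_⟩
  have h : ‖(⟨x 0, x 1⟩ : ℂ)‖ = ‖x‖ := by
    rw [← sq_eq_sq₀ (norm_nonneg _) (norm_nonneg _), norm_sq_eq, Complex.sq_norm,
      Complex.normSq_mk]; ring
  apply plane_ext
  · rw [polarPoint_zero, polarAngle, ← h, Complex.norm_mul_cos_arg]
  · rw [polarPoint_one, polarAngle, ← h, Complex.norm_mul_sin_arg]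

theorem polarAngle_polarPoint {R t : ℝ} (hR : 0 < R) (ht : t ∈ Ioc (-Real.pi) Real.pi) :
    polarAngle (polarPoint R t) = t := by
  have : (⟨polarPoint R t 0, polarPoint R t 1⟩ : ℂ) =
      (R : ℂ) * (Complex.cos t + Complex.sin t * Complex.I) := by
    apply Complex.ext <;>
    simp [polarPoint_zero, polarPoint_one, ← Complex.ofReal_cos, ← Complex.ofReal_sin]
  rw [polarAngle, this, Complex.arg_mul_cos_add_sin_mul_I hR ht]

/-- Integration in polar coordinates, for functions supported anywhere in the plane. -/
theorem lintegral_polar (f : Plane → ℝ≥0∞) (hf : Measurable f) :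
    ∫⁻ x, f x = ∫⁻ R in Ioi (0 : ℝ), ∫⁻ t in Ioc (-Real.pi) Real.pi,
      ENNReal.ofReal R * f (polarPoint R t) := by
  have h1 : ∫⁻ x, f x = ∫⁻ z : ℂ, f (Complex.orthonormalBasisOneI.repr z) :=
    ((Complex.orthonormalBasisOneI.repr.measurePreserving).lintegral_comp hf).symm
  have hm : Measurable fun p : ℝ × ℝ => polarPoint p.1 p.2 := by
    apply Continuous.measurable
    unfold polarPoint
    fun_prop
  have h2 : ∀ p : ℝ × ℝ, Complex.orthonormalBasisOneI.repr (Complex.polarCoord.symm p) =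
      polarPoint p.1 p.2 := by
    intro p
    rw [Complex.polarCoord_symm_apply]
    apply plane_ext <;>
    simp [polarPoint_zero, polarPoint_one, -Complex.ofReal_cos, -Complex.ofReal_sin]
  rw [h1, ← Complex.lintegral_comp_polarCoord_symm]
  simp_rw [h2]
  rw [polarCoord_target]
  rw [Measure.volume_eq_prod, ← Measure.prod_restrict, lintegral_prod]
  · refine lintegral_congr fun R => ?_
    rw [restrict_Ioo_eq_restrict_Ioc]
    rfl
  · exact ((measurable_fst.ennreal_ofReal).smul (hf.comp hm)).aemeasurable

theorem lintegral_disc_polar (f : Plane → ℝ≥0∞) (hf : Measurable f) :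
    ∫⁻ x, f x ∂discMeasure = ∫⁻ R in Ioo (0 : ℝ) 1, ∫⁻ t in Ioc (-Real.pi) Real.pi,
      ENNReal.ofReal R * f (polarPoint R t) := by
  have hd : MeasurableSet disc := Metric.isOpen_ball.measurableSet
  rw [discMeasure, ← lintegral_indicator hd, lintegral_polar _ (hf.indicator hd)]
  have : (Ioo (0 : ℝ) 1) = Iio 1 ∩ Ioi 0 := by ext; simp [and_comm]
  rw [this, ← Measure.restrict_restrict measurableSet_Iio, ← lintegral_indicator measurableSet_Iio]
  refine setLIntegral_congr_fun measurableSet_Ioi fun R hR => ?_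
  have hR' : (0 : ℝ) < R := hR
  by_cases h : R < 1
  · rw [indicator_of_mem (show R ∈ Iio 1 from h)]
    refine lintegral_congr fun t => ?_
    rw [indicator_of_mem]
    rw [disc, mem_ball_zero_iff, norm_polarPoint hR'.le]; exact h
  · rw [indicator_of_notMem (show R ∉ Iio 1 from h)]
    rw [← lintegral_zero (μ := volume.restrict (Ioc (-Real.pi) Real.pi))]
    refine lintegral_congr fun t => ?_
    rw [indicator_of_notMem, mul_zero]
    rw [disc, mem_ball_zero_iff, norm_polarPoint hR'.le]; exact h

end HFU

/-! ### Smoothness and derivatives of circle means -/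

namespace HFU

/-- Differentiation under the integral sign, the domination coming from compactness of a ball times
the interval. Smoothness and the derivative formula are proved together because each new order
applies the claim to the derivative. -/
theorem contDiff_intervalIntegral_nat {F : Type} [NormedAddCommGroup F] [NormedSpace ℝ F]
    [CompleteSpace F] (a b : ℝ) (n : ℕ) (f : Plane × ℝ → F) (hf : ContDiff ℝ ∞ f) :
    ContDiff ℝ n (fun x => ∫ t in a..b, f (x, t)) ∧
      ∀ x, HasFDerivAt (fun x => ∫ t in a..b, f (x, t))
        (∫ t in a..b, (fderiv ℝ f (x, t)).comp (ContinuousLinearMap.inl ℝ Plane ℝ)) x := by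
  -- The derivative takes values in a space of linear maps, so the target space has to vary.
  induction n generalizing F with
  | zero =>
    have hder : ∀ x, HasFDerivAt (fun x => ∫ t in a..b, f (x, t))
        (∫ t in a..b, (fderiv ℝ f (x, t)).comp (ContinuousLinearMap.inl ℝ Plane ℝ)) x := by
      intro x
      have hc : Continuous fun p : Plane × ℝ =>
          (fderiv ℝ f p).comp (ContinuousLinearMap.inl ℝ Plane ℝ) :=
        (hf.continuous_fderiv (by simp)).clm_comp continuous_const
      obtain ⟨C, hC⟩ := ((isCompact_closedBall x 1).prod isCompact_uIcc).exists_bound_of_continuousOn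
        (f := fun p : Plane × ℝ => (fderiv ℝ f p).comp (ContinuousLinearMap.inl ℝ Plane ℝ))
        (s := Metric.closedBall x 1 ×ˢ uIcc a b) hc.continuousOn
      refine intervalIntegral.hasFDerivAt_integral_of_dominated_of_fderiv_le
        (F' := fun x t => (fderiv ℝ f (x, t)).comp (ContinuousLinearMap.inl ℝ Plane ℝ))
        (bound := fun _ => C) (Metric.closedBall_mem_nhds x one_pos) ?_ ?_ ?_ ?_ ?_ ?_
      · exact Eventually.of_forall fun y =>
          (hf.continuous.comp (by fun_prop : Continuous fun t : ℝ => (y, t))).aestronglyMeasurable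
      · exact (hf.continuous.comp (by fun_prop : Continuous fun t : ℝ => (x, t))).intervalIntegrable _ _
      · exact (hc.comp (by fun_prop : Continuous fun t : ℝ => (x, t))).aestronglyMeasurable
      · exact Eventually.of_forall fun t ht y hy => hC (y, t) ⟨hy, uIoc_subset_uIcc ht⟩
      · exact intervalIntegrable_const
      · refine Eventually.of_forall fun t _ y _ => ?_
        have h1 := ((hf.differentiable (by simp)) (y, t)).hasFDerivAt
        exact h1.comp y (hasFDerivAt_prodMk_left y t)
    refine ⟨?_, hder⟩
    rw [Nat.cast_zero, contDiff_zero]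
    exact continuous_iff_continuousAt.2 fun x => (hder x).continuousAt
  | succ n ih =>
    have hder := (ih f hf).2
    refine ⟨?_, hder⟩
    have hf' : ContDiff ℝ ∞ fun p : Plane × ℝ =>
        (fderiv ℝ f p).comp (ContinuousLinearMap.inl ℝ Plane ℝ) :=
      (hf.fderiv_right (by simp)).clm_comp contDiff_const
    rw [Nat.cast_succ, contDiff_succ_iff_fderiv]
    refine ⟨fun x => (hder x).differentiableAt, by simp, ?_⟩
    have : fderiv ℝ (fun x => ∫ t in a..b, f (x, t)) = fun x =>
        ∫ t in a..b, (fderiv ℝ f (x, t)).comp (ContinuousLinearMap.inl ℝ Plane ℝ) :=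
      funext fun x => (hder x).fderiv
    rw [this]
    exact (ih _ hf').1

theorem contDiff_intervalIntegral {F : Type} [NormedAddCommGroup F] [NormedSpace ℝ F]
    [CompleteSpace F] (a b : ℝ) {f : Plane × ℝ → F} (hf : ContDiff ℝ ∞ f) :
    ContDiff ℝ ∞ (fun x => ∫ t in a..b, f (x, t)) :=
  contDiff_infty.2 fun n => (contDiff_intervalIntegral_nat a b n f hf).1

/-- The mean of `f` over the circle through `x` centred at the origin. -/
noncomputable def circleMean (f : Plane → ℝ) (x : Plane) : ℝ :=
  (2 * Real.pi)⁻¹ * ∫ t in (-Real.pi)..Real.pi, f (rot t x)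

theorem polarPoint_periodic (R : ℝ) : Function.Periodic (polarPoint R) (2 * Real.pi) := by
  intro t
  simp [polarPoint]

/-- Rotating x sweeps its circle starting from the angle of x; by periodicity the starting angle is
irrelevant. Thus the mean depends on the norm only. -/
theorem circleMean_eq (f : Plane → ℝ) (x : Plane) :
    circleMean f x =
      (2 * Real.pi)⁻¹ * ∫ t in (-Real.pi)..Real.pi, f (polarPoint ‖x‖ t) := by
  obtain ⟨s, hs⟩ := exists_polarPoint x
  have h1 : ∀ t, f (rot t x) = f (polarPoint ‖x‖ (t + s)) := by
    intro t
    conv_lhs => rw [hs]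
    rw [rot_polarPoint, add_comm]
  have hp : Function.Periodic (fun t => f (polarPoint ‖x‖ t)) (2 * Real.pi) := fun t => by
    simp only [polarPoint_periodic ‖x‖ t]
  simp_rw [circleMean, h1]
  rw [intervalIntegral.integral_comp_add_right (fun t => f (polarPoint ‖x‖ t))]
  have := hp.intervalIntegral_add_eq (-Real.pi + s) (-Real.pi)
  rw [show -Real.pi + s + 2 * Real.pi = Real.pi + s by ring,
    show -Real.pi + 2 * Real.pi = Real.pi by ring] at this
  rw [this]

theorem circleMean_congr_norm (f : Plane → ℝ) {x y : Plane} (h : ‖x‖ = ‖y‖) :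
    circleMean f x = circleMean f y := by
  rw [circleMean_eq, circleMean_eq, h]

theorem contDiff_rot_uncurry : ContDiff ℝ ∞ (fun p : Plane × ℝ => rot p.2 p.1) := by
  rw [contDiff_euclidean]
  intro i
  fin_cases i
  · simp only [Fin.zero_eta, rot_apply_zero]
    fun_prop
  · simp only [Fin.mk_one, rot_apply_one]
    fun_prop

theorem contDiff_circleMean {f : Plane → ℝ} (hf : ContDiff ℝ ∞ f) :
    ContDiff ℝ ∞ (circleMean f) :=
  contDiff_const.mul (contDiff_intervalIntegral _ _ (hf.comp contDiff_rot_uncurry))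

theorem fderiv_circleMean {f : Plane → ℝ} (hf : ContDiff ℝ ∞ f) (x v : Plane) :
    fderiv ℝ (circleMean f) x v =
      (2 * Real.pi)⁻¹ * ∫ t in (-Real.pi)..Real.pi, fderiv ℝ f (rot t x) (rot t v) := by
  have hg : ContDiff ℝ ∞ (fun p : Plane × ℝ => f (rot p.2 p.1)) := hf.comp contDiff_rot_uncurry
  obtain ⟨L, hL⟩ : ∃ L : ℝ → Plane →L[ℝ] ℝ, L = fun t =>
      (fderiv ℝ (fun p : Plane × ℝ => f (rot p.2 p.1)) (x, t)).comp
        (ContinuousLinearMap.inl ℝ Plane ℝ) := ⟨_, rfl⟩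
  have h := ((contDiff_intervalIntegral_nat (-Real.pi) Real.pi 0 _ hg).2 x).const_mul
    ((2 * Real.pi)⁻¹)
  rw [← hL] at h
  have h' : fderiv ℝ (circleMean f) x = (2 * Real.pi)⁻¹ • ∫ t in (-Real.pi)..Real.pi, L t :=
    h.fderiv
  have hc : Continuous L := by
    rw [hL]
    exact ((hg.continuous_fderiv (by simp)).comp (by fun_prop)).clm_comp continuous_const
  have hv : (∫ t in (-Real.pi)..Real.pi, L t) v = ∫ t in (-Real.pi)..Real.pi, L t v :=
    ContinuousLinearMap.intervalIntegral_apply (hc.intervalIntegrable _ _) v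
  rw [h', smul_apply, smul_eq_mul, hv]
  congr 1
  refine intervalIntegral.integral_congr fun t _ => ?_
  have hr : HasFDerivAt (fun y => rot t y) ((rot t).toContinuousLinearEquiv : Plane →L[ℝ] Plane) x :=
    ((rot t).toContinuousLinearEquiv : Plane →L[ℝ] Plane).hasFDerivAt
  have hi : HasFDerivAt (fun y : Plane => (y, t)) (ContinuousLinearMap.inl ℝ Plane ℝ) x :=
    hasFDerivAt_prodMk_left x t
  obtain ⟨q, hq⟩ : ∃ q : Plane × ℝ → ℝ, q = fun p => f (rot p.2 p.1) := ⟨_, rfl⟩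
  rw [← hq] at hL hg
  have hqd : HasFDerivAt q (fderiv ℝ q (x, t)) (x, t) :=
    ((hg.differentiable (by simp)) (x, t)).hasFDerivAt
  have hfd : HasFDerivAt f (fderiv ℝ f (rot t x)) (rot t x) :=
    ((hf.differentiable (by simp)) (rot t x)).hasFDerivAt
  have e1 : HasFDerivAt (fun y : Plane => q (y, t))
      ((fderiv ℝ q (x, t)).comp (ContinuousLinearMap.inl ℝ Plane ℝ)) x := hqd.comp x hi
  have e2 : HasFDerivAt (fun y => f (rot t y))
      ((fderiv ℝ f (rot t x)).comp ((rot t).toContinuousLinearEquiv : Plane →L[ℝ] Plane)) x :=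
    hfd.comp x hr
  have e3 : (fun y : Plane => q (y, t)) = fun y => f (rot t y) := by rw [hq]
  rw [e3] at e1
  have := DFunLike.congr_fun (e1.unique e2) v
  rw [hL]
  exact this

/-- The radial derivative commutes with circle means. -/
theorem fderiv_circleMean_self {f : Plane → ℝ} (hf : ContDiff ℝ ∞ f) (x : Plane) :
    fderiv ℝ (circleMean f) x x = circleMean (fun y => fderiv ℝ f y y) x := by
  rw [fderiv_circleMean hf, circleMean]

theorem rot_hasDerivAt_zero (x : Plane) : HasDerivAt (fun s => rot s x) (!₂[-x 1, x 0]) 0 := by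
  have h : (fun s => rot s x) = fun s => Real.cos s • x + Real.sin s • !₂[-x 1, x 0] := by
    funext s
    apply plane_ext
    · rw [rot_apply_zero]; simp; ring
    · rw [rot_apply_one]; simp; ring
  rw [h]
  have := ((Real.hasDerivAt_cos 0).smul_const x).fun_add
    ((Real.hasDerivAt_sin 0).smul_const (!₂[-x 1, x 0] : Plane))
  simpa using this

theorem rot_zero (x : Plane) : rot 0 x = x := by
  apply plane_ext
  · simp [rot_apply_zero]
  · simp [rot_apply_one]

/-- A circle mean is constant along the orbit of a rotation, and the given vector is the velocity of
that orbit. -/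
theorem fderiv_circleMean_perp {f : Plane → ℝ} (hf : ContDiff ℝ ∞ f) (x : Plane) :
    fderiv ℝ (circleMean f) x (!₂[-x 1, x 0]) = 0 := by
  have h1 : HasFDerivAt (circleMean f) (fderiv ℝ (circleMean f) x) (rot 0 x) := by
    rw [rot_zero]
    exact (((contDiff_circleMean hf).differentiable (by simp)) x).hasFDerivAt
  have h2 := h1.comp_hasDerivAt 0 (rot_hasDerivAt_zero x)
  have h3 : (circleMean f ∘ fun s => rot s x) = fun _ => circleMean f x := by
    funext s
    exact circleMean_congr_norm f ((rot s).norm_map x)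
  rw [h3] at h2
  exact h2.unique (hasDerivAt_const _ _)

end HFU

/-! ### Integration on circles and circle coefficients of L² functions -/

namespace HFU

/-- Lebesgue measure on a full turn of angles. -/
noncomputable abbrev angleMeasure : Measure ℝ := volume.restrict (Ioc (-Real.pi) Real.pi)

/-- Lebesgue measure on the radii of the disc. -/
noncomputable abbrev radiusMeasure : Measure ℝ := volume.restrict (Ioo 0 1)

instance : IsFiniteMeasure discMeasure := by
  unfold discMeasure disc
  exact ⟨by simp⟩

theorem sq_eLpNorm {α E : Type*} [MeasurableSpace α] [NormedAddCommGroup E] (f : α → E)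
    (μ : Measure α) : eLpNorm f 2 μ ^ 2 = ∫⁻ x, ‖f x‖ₑ ^ 2 ∂μ := by
  have := eLpNorm_nnreal_pow_eq_lintegral (μ := μ) (f := f) (p := 2) (by norm_num)
  simpa using this

theorem measurable_polarPoint : Measurable fun p : ℝ × ℝ => polarPoint p.1 p.2 := by
  apply Continuous.measurable
  unfold polarPoint
  fun_prop

/-- By the polar formula a null set has zero weighted measure on circles, and the weight R is
positive. -/
theorem ae_polar {p : Plane → Prop} (h : ∀ᵐ x ∂discMeasure, p x) :
    ∀ᵐ R ∂radiusMeasure, ∀ᵐ t ∂angleMeasure, p (polarPoint R t) := by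
  obtain ⟨s, hs, hsm, hs0⟩ := exists_measurable_superset_of_null (ae_iff.1 h)
  have h1 := lintegral_disc_polar (s.indicator 1) (measurable_one.indicator hsm)
  rw [lintegral_indicator_one hsm, hs0] at h1
  have hm : Measurable fun q : ℝ × ℝ => ENNReal.ofReal q.1 * s.indicator 1 (polarPoint q.1 q.2) :=
    measurable_fst.ennreal_ofReal.mul ((measurable_one.indicator hsm).comp measurable_polarPoint)
  have h2 := (lintegral_eq_zero_iff (hm.lintegral_prod_right' (ν := angleMeasure))).1 h1.symm
  filter_upwards [h2, ae_restrict_mem measurableSet_Ioo] with R hR hR0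
  have h3 := (lintegral_eq_zero_iff (hm.comp (measurable_prodMk_left (x := R)))).1 hR
  filter_upwards [h3] with t ht
  by_contra hp
  have : polarPoint R t ∈ s := hs hp
  simp [this] at ht
  exact absurd hR0.1 (not_lt.2 ht)

theorem lintegral_disc_polar' {f : Plane → ℝ≥0∞} (hf : AEMeasurable f discMeasure) :
    ∫⁻ x, f x ∂discMeasure = ∫⁻ R, ENNReal.ofReal R * ∫⁻ t, f (polarPoint R t) ∂angleMeasure
      ∂radiusMeasure := by
  rw [lintegral_congr_ae hf.ae_eq_mk, lintegral_disc_polar _ hf.measurable_mk]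
  refine lintegral_congr_ae ?_
  filter_upwards [ae_polar hf.ae_eq_mk] with R hR
  rw [lintegral_const_mul]
  · congr 1
    exact lintegral_congr_ae (by filter_upwards [hR] with t ht using ht.symm)
  · exact hf.measurable_mk.comp (measurable_polarPoint.comp measurable_prodMk_left)

theorem measure_angleMeasure : angleMeasure univ = ENNReal.ofReal (2 * Real.pi) := by
  rw [Measure.restrict_apply_univ, Real.volume_Ioc]; ring_nf

theorem lintegral_disc_radial {g : ℝ → ℝ≥0∞} (hg : Measurable g) :
    ∫⁻ x, g ‖x‖ ∂discMeasure =
      ENNReal.ofReal (2 * Real.pi) * ∫⁻ R, ENNReal.ofReal R * g R ∂radiusMeasure := by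
  rw [lintegral_disc_polar' (f := fun x => g ‖x‖) (hg.comp measurable_norm).aemeasurable,
    ← lintegral_const_mul' _ _ ENNReal.ofReal_ne_top]
  refine setLIntegral_congr_fun measurableSet_Ioo fun R hR => ?_
  simp only [norm_polarPoint hR.1.le, lintegral_const, measure_angleMeasure]
  ring

/-- The converse transfer: a null set of radii sweeps out a null subset of the disc. -/
theorem ae_radial {q : ℝ → Prop} (h : ∀ᵐ R ∂radiusMeasure, q R) : ∀ᵐ x ∂discMeasure, q ‖x‖ := by
  obtain ⟨s, hs, hsm, hs0⟩ := exists_measurable_superset_of_null (ae_iff.1 h)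
  have h1 := lintegral_disc_radial (g := s.indicator 1) (measurable_one.indicator hsm)
  have h2 : ∫⁻ R, ENNReal.ofReal R * s.indicator 1 R ∂radiusMeasure = 0 := by
    refine (lintegral_eq_zero_iff
      (measurable_id.ennreal_ofReal.mul (measurable_one.indicator hsm))).2 ?_
    filter_upwards [measure_eq_zero_iff_ae_notMem.1 hs0] with R hR
    simp [hR]
  rw [h2, mul_zero] at h1
  replace h1 := (lintegral_eq_zero_iff ((measurable_one.indicator hsm).comp measurable_norm)).1 h1
  filter_upwards [h1] with x hx
  by_contra hq
  have : ‖x‖ ∈ s := hs hq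
  simp [this] at hx

theorem ae_memLp_slice {f : Plane → ℝ} (hf : MemLp f 2 discMeasure) :
    ∀ᵐ R ∂radiusMeasure, MemLp (fun t => f (polarPoint R t)) 2 angleMeasure := by
  obtain ⟨f', hf', hff'⟩ := hf.1
  have h1 : ∫⁻ x, ‖f' x‖ₑ ^ 2 ∂discMeasure < ⊤ := by
    rw [← sq_eLpNorm, ← eLpNorm_congr_ae hff']
    exact ENNReal.pow_lt_top hf.2
  have hm : Measurable fun x => ‖f' x‖ₑ ^ 2 := hf'.measurable.enorm.pow_const 2
  rw [lintegral_disc_polar' hm.aemeasurable] at h1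
  have h2 := ae_lt_top (measurable_id.ennreal_ofReal.mul
    ((hm.comp measurable_polarPoint).lintegral_prod_right' (ν := angleMeasure))) h1.ne
  filter_upwards [h2, ae_polar hff', ae_restrict_mem measurableSet_Ioo] with R hR hRe hR0
  refine MemLp.ae_eq (f := fun t => f' (polarPoint R t)) ?_ ?_
  · filter_upwards [hRe] with t ht using ht.symm
  · refine ⟨(hf'.comp_measurable
      (measurable_polarPoint.comp measurable_prodMk_left)).aestronglyMeasurable, ?_⟩
    by_contra htop
    rw [not_lt, top_le_iff] at htop
    have := sq_eLpNorm (fun t => f' (polarPoint R t)) angleMeasure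
    rw [htop] at this
    simp only [Function.comp_apply, ← this, Pi.mul_apply] at hR
    simp [ENNReal.mul_top, hR0.1] at hR

/-- The integral of `f` against the kernel `k` along the circle of radius `R`. -/
noncomputable def sliceCoeff (k : ℝ → ℝ) (f : Plane → ℝ) (R : ℝ) : ℝ :=
  ∫ t, k t * f (polarPoint R t) ∂angleMeasure

theorem enorm_integral_mul_sq_le {k φ : ℝ → ℝ} (hk : ∀ t, |k t| ≤ 1)
    (hφ : AEStronglyMeasurable φ angleMeasure) :
    ‖∫ t, k t * φ t ∂angleMeasure‖ₑ ^ 2 ≤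
      ENNReal.ofReal (2 * Real.pi) * ∫⁻ t, ‖φ t‖ₑ ^ 2 ∂angleMeasure := by
  have h1 : ‖∫ t, k t * φ t ∂angleMeasure‖ₑ ≤ eLpNorm φ 1 angleMeasure := by
    rw [eLpNorm_one_eq_lintegral_enorm]
    refine (enorm_integral_le_lintegral_enorm _).trans (lintegral_mono fun t => ?_)
    rw [enorm_mul]
    refine mul_le_of_le_one_left zero_le ?_
    rw [Real.enorm_eq_ofReal_abs]
    exact ENNReal.ofReal_le_one.2 (hk t)
  have h2 := eLpNorm_le_eLpNorm_mul_rpow_measure_univ (μ := angleMeasure) (f := φ)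
    (p := 1) (q := 2) (by norm_num) hφ
  rw [measure_angleMeasure] at h2
  calc _ ≤ (eLpNorm φ 2 angleMeasure * ENNReal.ofReal (2 * Real.pi) ^
        (1 / (1 : ℝ≥0∞).toReal - 1 / (2 : ℝ≥0∞).toReal)) ^ 2 := by gcongr; exact h1.trans h2
    _ = _ := by
      rw [mul_pow, sq_eLpNorm, mul_comm, ← ENNReal.rpow_natCast, ← ENNReal.rpow_mul]
      norm_num

/-- Cauchy-Schwarz on each circle, integrated in R: taking a coefficient is continuous from L²(B) to
L²(R dR). This is what lets relations between coefficients pass to limits. -/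
theorem lintegral_sliceCoeff_le {k : ℝ → ℝ} (hk : ∀ t, |k t| ≤ 1) {f : Plane → ℝ}
    (hf : AEStronglyMeasurable f discMeasure) :
    ∫⁻ R, ENNReal.ofReal R * ‖sliceCoeff k f R‖ₑ ^ 2 ∂radiusMeasure ≤
      ENNReal.ofReal (2 * Real.pi) * eLpNorm f 2 discMeasure ^ 2 := by
  rw [sq_eLpNorm, lintegral_disc_polar' (hf.enorm.pow_const 2),
    ← lintegral_const_mul' _ _ ENNReal.ofReal_ne_top]
  obtain ⟨f', hf', hff'⟩ := hf
  refine lintegral_mono_ae ?_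
  filter_upwards [ae_polar hff'] with R hR
  have : AEStronglyMeasurable (fun t => f (polarPoint R t)) angleMeasure :=
    ⟨fun t => f' (polarPoint R t),
      hf'.comp_measurable (measurable_polarPoint.comp measurable_prodMk_left), hR⟩
  calc _ ≤ _ := mul_le_mul_right (enorm_integral_mul_sq_le hk this) _
    _ = _ := by ring

theorem measurable_sliceCoeff {k : ℝ → ℝ} (hk : Measurable k) {f : Plane → ℝ} (hf : Measurable f) :
    Measurable (sliceCoeff k f) := by
  have : StronglyMeasurable fun p : ℝ × ℝ => k p.2 * f (polarPoint p.1 p.2) :=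
    ((hk.comp measurable_snd).mul (hf.comp measurable_polarPoint)).stronglyMeasurable
  exact (this.integral_prod_right' (ν := angleMeasure)).measurable

theorem sliceCoeff_congr {f f' : Plane → ℝ} (h : f =ᵐ[discMeasure] f') :
    ∀ᵐ R ∂radiusMeasure, ∀ k, sliceCoeff k f R = sliceCoeff k f' R := by
  filter_upwards [ae_polar h] with R hR k
  refine integral_congr_ae ?_
  filter_upwards [hR] with t ht
  rw [ht]

theorem sliceCoeff_sub {k : ℝ → ℝ} (hkm : Measurable k) (hk : ∀ t, |k t| ≤ 1) {f g : Plane → ℝ}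
    (hf : MemLp f 2 discMeasure) (hg : MemLp g 2 discMeasure) :
    ∀ᵐ R ∂radiusMeasure, sliceCoeff k (fun x => f x - g x) R = sliceCoeff k f R - sliceCoeff k g R := by
  filter_upwards [ae_memLp_slice hf, ae_memLp_slice hg] with R h1 h2
  have hi : ∀ φ : ℝ → ℝ, MemLp φ 2 angleMeasure → Integrable (fun t => k t * φ t) angleMeasure := by
    intro φ hφ
    exact (hφ.integrable (by norm_num)).bdd_mul (c := 1) hkm.aestronglyMeasurable
      (Eventually.of_forall hk)
  rw [sliceCoeff, sliceCoeff, sliceCoeff, ← integral_sub (hi _ h1) (hi _ h2)]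
  simp only [mul_sub]

theorem ae_radius_eq_zero_of_le {D : ℝ → ℝ} {c : ℕ → ℝ≥0∞}
    (h : ∀ N, ∫⁻ R, ENNReal.ofReal R * ‖D R‖ₑ ^ 2 ∂radiusMeasure ≤ c N)
    (hc : Tendsto c atTop (𝓝 0)) (hD : AEMeasurable D radiusMeasure) :
    ∀ᵐ R ∂radiusMeasure, D R = 0 := by
  have h0 : ∫⁻ R, ENNReal.ofReal R * ‖D R‖ₑ ^ 2 ∂radiusMeasure = 0 :=
    le_antisymm (ge_of_tendsto' hc h) zero_le
  replace h0 := (lintegral_eq_zero_iff' (measurable_id.ennreal_ofReal.aemeasurable.mul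
    (hD.enorm.pow_const 2))).1 h0
  filter_upwards [h0, ae_restrict_mem measurableSet_Ioo] with R hR hR0
  simpa [hR0.1.not_ge] using hR

theorem aemeasurable_sliceCoeff {k : ℝ → ℝ} (hk : Measurable k) {f : Plane → ℝ}
    (hf : AEStronglyMeasurable f discMeasure) :
    AEMeasurable (sliceCoeff k f) radiusMeasure := by
  obtain ⟨f', hf', hff'⟩ := hf
  exact ⟨_, measurable_sliceCoeff hk hf'.measurable, by
    filter_upwards [sliceCoeff_congr hff'] with R hR using hR k⟩

/-- Linear relations between circle coefficients pass to limits in `L²`. -/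
theorem sliceCoeff_relation_of_tendsto {k l : ℝ → ℝ} (hkm : Measurable k) (hk : ∀ t, |k t| ≤ 1)
    (hlm : Measurable l) (hl : ∀ t, |l t| ≤ 1) (c : ℝ) {F f : Plane → ℝ} {Fs fs : ℕ → Plane → ℝ}
    (hF : MemLp F 2 discMeasure) (hf : MemLp f 2 discMeasure)
    (hFs : ∀ n, MemLp (Fs n) 2 discMeasure) (hfs : ∀ n, MemLp (fs n) 2 discMeasure)
    (hFt : Tendsto (fun n => eLpNorm (fun x => F x - Fs n x) 2 discMeasure) atTop (𝓝 0))
    (hft : Tendsto (fun n => eLpNorm (fun x => f x - fs n x) 2 discMeasure) atTop (𝓝 0))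
    (h : ∀ n, ∀ᵐ R ∂radiusMeasure, sliceCoeff k (Fs n) R = c * sliceCoeff l (fs n) R) :
    ∀ᵐ R ∂radiusMeasure, sliceCoeff k F R = c * sliceCoeff l f R := by
  have key : ∀ᵐ R ∂radiusMeasure, sliceCoeff k F R - c * sliceCoeff l f R = 0 := by
    -- The relation is exact for the approximants, so the defect of the limit equals the defect of
    -- the differences F - Fs n and f - fs n. Then (a - b)² ≤ 2(a² + b²) bounds it.
    refine ae_radius_eq_zero_of_le (c := fun n =>
      2 * (ENNReal.ofReal (2 * Real.pi) * eLpNorm (fun x => F x - Fs n x) 2 discMeasure ^ 2 +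
        ‖c‖ₑ ^ 2 * (ENNReal.ofReal (2 * Real.pi) *
          eLpNorm (fun x => f x - fs n x) 2 discMeasure ^ 2))) (fun n => ?_) ?_ ?_
    · have m1 : AEMeasurable (fun R => ENNReal.ofReal R *
          ‖sliceCoeff k (fun x => F x - Fs n x) R‖ₑ ^ 2) radiusMeasure :=
        measurable_id.ennreal_ofReal.aemeasurable.mul
          ((aemeasurable_sliceCoeff hkm (hF.1.sub (hFs n).1)).enorm.pow_const 2)
      calc _ ≤ ∫⁻ R, 2 * (ENNReal.ofReal R * ‖sliceCoeff k (fun x => F x - Fs n x) R‖ₑ ^ 2 +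
            ‖c‖ₑ ^ 2 * (ENNReal.ofReal R * ‖sliceCoeff l (fun x => f x - fs n x) R‖ₑ ^ 2))
            ∂radiusMeasure := by
            refine lintegral_mono_ae ?_
            filter_upwards [sliceCoeff_sub hkm hk hF (hFs n), sliceCoeff_sub hlm hl hf (hfs n),
              h n] with R h1 h2 h3
            have : sliceCoeff k F R - c * sliceCoeff l f R =
                sliceCoeff k (fun x => F x - Fs n x) R -
                  c * sliceCoeff l (fun x => f x - fs n x) R := by
              rw [h1, h2, h3]; ring
            rw [this]
            have h4 : ‖sliceCoeff k (fun x => F x - Fs n x) R -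
                c * sliceCoeff l (fun x => f x - fs n x) R‖ₑ ^ 2 ≤
                2 * (‖sliceCoeff k (fun x => F x - Fs n x) R‖ₑ ^ 2 +
                  ‖c‖ₑ ^ 2 * ‖sliceCoeff l (fun x => f x - fs n x) R‖ₑ ^ 2) := by
              rw [← mul_pow, ← enorm_mul]
              generalize sliceCoeff k (fun x => F x - Fs n x) R = a
              generalize c * sliceCoeff l (fun x => f x - fs n x) R = b
              simp only [Real.enorm_eq_ofReal_abs]
              rw [← ENNReal.ofReal_pow (abs_nonneg _), ← ENNReal.ofReal_pow (abs_nonneg _),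
                ← ENNReal.ofReal_pow (abs_nonneg _), ← ENNReal.ofReal_add (by positivity)
                (by positivity), ← ENNReal.ofReal_ofNat 2, ← ENNReal.ofReal_mul (by norm_num)]
              refine ENNReal.ofReal_le_ofReal ?_
              simp only [sq_abs]
              nlinarith [sq_nonneg (a + b)]
            calc _ ≤ ENNReal.ofReal R * _ := mul_le_mul_right h4 _
              _ = _ := by ring
        _ ≤ _ := by
            rw [lintegral_const_mul' _ _ (by norm_num), lintegral_add_left' m1,
              lintegral_const_mul' _ _ (by simp)]
            gcongr
            · exact lintegral_sliceCoeff_le hk (hF.1.sub (hFs n).1)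
            · exact lintegral_sliceCoeff_le hl (hf.1.sub (hfs n).1)
    · have t1 := ENNReal.Tendsto.const_mul (a := ENNReal.ofReal (2 * Real.pi))
        (ENNReal.Tendsto.pow (n := 2) hFt) (Or.inr ENNReal.ofReal_ne_top)
      have t2 := ENNReal.Tendsto.const_mul (a := ENNReal.ofReal (2 * Real.pi))
        (ENNReal.Tendsto.pow (n := 2) hft) (Or.inr ENNReal.ofReal_ne_top)
      have t3 := ENNReal.Tendsto.const_mul (a := ‖c‖ₑ ^ 2) t2 (Or.inr (by simp))
      have t4 := ENNReal.Tendsto.const_mul (a := 2) (t1.add t3) (Or.inr (by norm_num))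
      simpa using t4
    · exact (aemeasurable_sliceCoeff hkm hF.1).sub
        ((aemeasurable_sliceCoeff hlm hf.1).const_mul c)
  filter_upwards [key] with R hR
  linarith

end HFU

/-! ### Parseval and Wirtinger on circles -/

namespace HFU

theorem integral_cos_int_mul {n : ℤ} (hn : n ≠ 0) :
    ∫ t in (-Real.pi)..Real.pi, Real.cos (n * t) = 0 := by
  have h : (n : ℝ) ≠ 0 := by exact_mod_cast hn
  rw [intervalIntegral.integral_comp_mul_left (fun t => Real.cos t) h]
  simp [Real.sin_int_mul_pi]

theorem integral_sin_int_mul (n : ℤ) :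
    ∫ t in (-Real.pi)..Real.pi, Real.sin (n * t) = 0 := by
  by_cases hn : n = 0
  · simp [hn]
  have h : (n : ℝ) ≠ 0 := by exact_mod_cast hn
  rw [intervalIntegral.integral_comp_mul_left (fun t => Real.sin t) h]
  simp

theorem integral_angleMeasure (f : ℝ → ℝ) :
    ∫ t, f t ∂angleMeasure = ∫ t in (-Real.pi)..Real.pi, f t :=
  (intervalIntegral.integral_of_le (by linarith [Real.pi_pos])).symm

theorem neg_pi_lt_pi : -Real.pi < Real.pi := by linarith [Real.pi_pos]

theorem integrable_trig_mul {k φ : ℝ → ℝ} (hk : Continuous k) (hk1 : ∀ t, |k t| ≤ 1)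
    (hφ : MemLp φ 2 angleMeasure) : Integrable (fun t => k t * φ t) angleMeasure :=
  (hφ.integrable (by norm_num)).bdd_mul (c := 1) hk.aestronglyMeasurable (Eventually.of_forall hk1)

/-- For a real function the cosine and sine integrals are, up to sign, the real and imaginary parts
of the complex coefficient. -/
theorem sq_norm_fourierCoeffOn {φ : ℝ → ℝ} (hφ : MemLp φ 2 angleMeasure) (n : ℤ) :
    ‖fourierCoeffOn neg_pi_lt_pi (fun t => (φ t : ℂ)) n‖ ^ 2 = ((2 * Real.pi)⁻¹) ^ 2 *
      ((∫ t, Real.cos (n * t) * φ t ∂angleMeasure) ^ 2 +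
        (∫ t, Real.sin (n * t) * φ t ∂angleMeasure) ^ 2) := by
  have hpi := Real.pi_pos
  have hc := integrable_trig_mul (k := fun t => Real.cos (n * t)) (by fun_prop)
    (fun t => Real.abs_cos_le_one _) hφ
  have hs := integrable_trig_mul (k := fun t => Real.sin (n * t)) (by fun_prop)
    (fun t => Real.abs_sin_le_one _) hφ
  rw [fourierCoeffOn_eq_integral, intervalIntegral.integral_of_le neg_pi_lt_pi.le]
  have e : ∀ t : ℝ, fourier (-n) (t : AddCircle (Real.pi - -Real.pi)) • (φ t : ℂ) =
      ((Real.cos (n * t) * φ t : ℝ) : ℂ) - ((Real.sin (n * t) * φ t : ℝ) : ℂ) * Complex.I := by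
    intro t
    rw [fourier_coe_apply]
    have : 2 * (Real.pi : ℂ) * Complex.I * ((-n : ℤ) : ℂ) * (t : ℂ) /
        ((Real.pi - -Real.pi : ℝ) : ℂ) = ((-(n * t) : ℝ) : ℂ) * Complex.I := by
      have : (Real.pi : ℂ) ≠ 0 := by exact_mod_cast hpi.ne'
      push_cast
      field_simp
      ring
    rw [this, Complex.exp_mul_I, ← Complex.ofReal_cos, ← Complex.ofReal_sin, Real.cos_neg,
      Real.sin_neg, smul_eq_mul]
    push_cast
    ring
  simp_rw [e]
  rw [integral_sub hc.ofReal (hs.ofReal.mul_const _), integral_mul_const, integral_complex_ofReal,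
    integral_complex_ofReal, norm_smul, mul_pow, Complex.sq_norm, Complex.normSq_apply]
  have e2 : ‖1 / (Real.pi - -Real.pi)‖ = (2 * Real.pi)⁻¹ := by
    rw [Real.norm_of_nonneg (by rw [sub_neg_eq_add]; positivity), one_div]; ring_nf
  rw [e2]
  simp
  ring

/-- A Wirtinger inequality for functions whose low Fourier modes vanish, in terms of the Fourier
coefficients of a generalized derivative. -/
theorem wirtinger_slice {φ Φ : ℝ → ℝ} (hφ : MemLp φ 2 angleMeasure) (hΦ : MemLp Φ 2 angleMeasure)
    (hc : ∀ n : ℤ, ∫ t, Real.cos (n * t) * Φ t ∂angleMeasure =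
      n * ∫ t, Real.sin (n * t) * φ t ∂angleMeasure)
    (hs : ∀ n : ℤ, ∫ t, Real.sin (n * t) * Φ t ∂angleMeasure =
      -n * ∫ t, Real.cos (n * t) * φ t ∂angleMeasure) (m : ℕ)
    (hm : ∀ n : ℤ, |n| < m → ∫ t, Real.cos (n * t) * φ t ∂angleMeasure = 0 ∧
      ∫ t, Real.sin (n * t) * φ t ∂angleMeasure = 0) :
    (m : ℝ) ^ 2 * ∫ t, φ t ^ 2 ∂angleMeasure ≤ ∫ t, Φ t ^ 2 ∂angleMeasure := by
  have h1 := hasSum_sq_fourierCoeffOn neg_pi_lt_pi hφ.ofReal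
  have h2 := hasSum_sq_fourierCoeffOn neg_pi_lt_pi hΦ.ofReal
  -- Parseval on both sides reduces the claim to single frequencies: the coefficient of Φ at n has
  -- n² times the squared size of that of φ, and n² ≥ m² wherever the latter can be nonzero.
  have h3 := hasSum_le (fun n => ?_) (h1.mul_left ((m : ℝ) ^ 2)) h2
  · rw [← intervalIntegral.integral_of_le neg_pi_lt_pi.le,
      ← intervalIntegral.integral_of_le neg_pi_lt_pi.le]
    simp only [smul_eq_mul, RCLike.norm_ofReal, sq_abs] at h3
    have hp : 0 < (Real.pi - -Real.pi)⁻¹ := inv_pos.2 (by linarith [Real.pi_pos])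
    rw [mul_left_comm] at h3
    exact le_of_mul_le_mul_left h3 hp
  · have e1 := sq_norm_fourierCoeffOn hφ n
    have e2 := sq_norm_fourierCoeffOn hΦ n
    simp only [Complex.coe_algebraMap] at *
    rw [e1, e2, hc, hs]
    by_cases hn : |n| < m
    · rw [(hm n hn).1, (hm n hn).2]; simp
    · have hn' : (m : ℝ) ^ 2 ≤ (n : ℝ) ^ 2 := by
        rw [← sq_abs (n : ℝ)]
        have : (m : ℝ) ≤ |(n : ℝ)| := by exact_mod_cast not_lt.1 hn
        gcongr
      generalize ∫ t, Real.cos (n * t) * φ t ∂angleMeasure = A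
      generalize ∫ t, Real.sin (n * t) * φ t ∂angleMeasure = B
      have : 0 ≤ ((2 * Real.pi)⁻¹) ^ 2 * (A ^ 2 + B ^ 2) := by positivity
      nlinarith [mul_le_mul_of_nonneg_right hn' this]

theorem circleMean_eq_sliceCoeff (f : Plane → ℝ) (x : Plane) :
    circleMean f x = (2 * Real.pi)⁻¹ * sliceCoeff 1 f ‖x‖ := by
  rw [circleMean_eq, sliceCoeff, integral_angleMeasure]
  simp

theorem aestronglyMeasurable_circleMean {f : Plane → ℝ} (hf : AEStronglyMeasurable f discMeasure) :
    AEStronglyMeasurable (circleMean f) discMeasure := by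
  obtain ⟨f', hf', hff'⟩ := hf
  refine ⟨fun x => (2 * Real.pi)⁻¹ * sliceCoeff 1 f' ‖x‖, ?_, ?_⟩
  · exact (((measurable_sliceCoeff measurable_one hf'.measurable).comp measurable_norm).const_mul
      _).stronglyMeasurable
  · filter_upwards [ae_radial (sliceCoeff_congr hff')] with x hx
    rw [circleMean_eq_sliceCoeff, hx]

/-- Averaging over circles is the orthogonal projection of L²(B) onto radial functions, hence a
contraction. -/
theorem eLpNorm_circleMean_le {f : Plane → ℝ} (hf : AEStronglyMeasurable f discMeasure) :
    eLpNorm (circleMean f) 2 discMeasure ≤ eLpNorm f 2 discMeasure := by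
  obtain ⟨f', hf', hff'⟩ := hf
  have e1 : circleMean f =ᵐ[discMeasure] fun x => (2 * Real.pi)⁻¹ * sliceCoeff 1 f' ‖x‖ := by
    filter_upwards [ae_radial (sliceCoeff_congr hff')] with x hx
    rw [circleMean_eq_sliceCoeff, hx]
  rw [eLpNorm_congr_ae e1, eLpNorm_congr_ae hff',
    ← ENNReal.pow_le_pow_left_iff (n := 2) (by norm_num), sq_eLpNorm]
  simp_rw [enorm_mul, mul_pow]
  rw [lintegral_const_mul' _ _ (ENNReal.pow_ne_top enorm_ne_top), lintegral_disc_radial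
    ((measurable_sliceCoeff measurable_one hf'.measurable).enorm.pow_const 2)]
  have h := lintegral_sliceCoeff_le (k := 1) (by simp) hf'.aestronglyMeasurable (f := f')
  have hpi : 0 < 2 * Real.pi := by positivity
  calc _ ≤ ‖(2 * Real.pi)⁻¹‖ₑ ^ 2 * (ENNReal.ofReal (2 * Real.pi) * (ENNReal.ofReal (2 * Real.pi) *
        eLpNorm f' 2 discMeasure ^ 2)) := by gcongr
    _ = (‖(2 * Real.pi)⁻¹‖ₑ * ENNReal.ofReal (2 * Real.pi)) ^ 2 * eLpNorm f' 2 discMeasure ^ 2 := by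
      ring
    _ = _ := by
      rw [Real.enorm_eq_ofReal (by positivity), ← ENNReal.ofReal_mul (by positivity),
        inv_mul_cancel₀ hpi.ne']
      simp

theorem memLp_circleMean {f : Plane → ℝ} (hf : MemLp f 2 discMeasure) :
    MemLp (circleMean f) 2 discMeasure :=
  ⟨aestronglyMeasurable_circleMean hf.1, (eLpNorm_circleMean_le hf.1).trans_lt hf.2⟩

/-- `F` has, on almost every circle, the Fourier coefficients of the angular derivative of `f`. -/
def IsAngularDeriv (f F : Plane → ℝ) : Prop :=
  ∀ᵐ R ∂radiusMeasure, ∀ n : ℤ,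
    sliceCoeff (fun t => Real.cos (n * t)) F R = n * sliceCoeff (fun t => Real.sin (n * t)) f R ∧
    sliceCoeff (fun t => Real.sin (n * t)) F R = -n * sliceCoeff (fun t => Real.cos (n * t)) f R

/-- Almost all circle coefficients of `f` with index `0 < |n| < m` vanish. -/
def LowModesVanish (f : Plane → ℝ) (m : ℕ) : Prop :=
  ∀ᵐ R ∂radiusMeasure, ∀ n : ℤ, n ≠ 0 → |n| < m →
    sliceCoeff (fun t => Real.cos (n * t)) f R = 0 ∧ sliceCoeff (fun t => Real.sin (n * t)) f R = 0

/-- The slice inequality is applied on almost every circle to f minus its mean, which has no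
frequency 0, and integrated with weight R⁻² against R dR. With m = 1 the condition on modes is empty
and this is a Hardy inequality for the mean-free part. -/
theorem wirtinger {f F : Plane → ℝ} (hf : MemLp f 2 discMeasure) (hF : MemLp F 2 discMeasure)
    (h : IsAngularDeriv f F) (m : ℕ) (hm : LowModesVanish f m) :
    (m : ℝ≥0∞) * eLpNorm (fun x => (f x - circleMean f x) / ‖x‖) 2 discMeasure ≤
      eLpNorm (fun x => F x / ‖x‖) 2 discMeasure := by
  rw [← ENNReal.pow_le_pow_left_iff (n := 2) (by norm_num), mul_pow, sq_eLpNorm, sq_eLpNorm,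
    lintegral_disc_polar' (f := fun x => ‖(f x - circleMean f x) / ‖x‖‖ₑ ^ 2)
    (((hf.1.sub (aestronglyMeasurable_circleMean hf.1)).mul
      (measurable_norm.inv.aestronglyMeasurable)).enorm.pow_const 2),
    lintegral_disc_polar' (f := fun x => ‖F x / ‖x‖‖ₑ ^ 2)
    ((hF.1.mul (measurable_norm.inv.aestronglyMeasurable)).enorm.pow_const 2),
    ← lintegral_const_mul' _ _ (by simp)]
  refine lintegral_mono_ae ?_
  filter_upwards [h, hm, ae_memLp_slice hf, ae_memLp_slice hF, ae_restrict_mem measurableSet_Ioo]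
    with R h1 h2 hfR hFR hR
  rw [mul_left_comm]
  refine mul_le_mul_right ?_ _
  set c := (2 * Real.pi)⁻¹ * sliceCoeff 1 f R with hcdef
  have hpi := Real.pi_pos
  have hc : ∀ t, circleMean f (polarPoint R t) = c := fun t => by
    rw [circleMean_eq_sliceCoeff, norm_polarPoint hR.1.le]
  set φ : ℝ → ℝ := fun t => f (polarPoint R t) - c with hφdef
  have hφ : MemLp φ 2 angleMeasure := hfR.sub (memLp_const c)
  have hcos : ∀ n : ℤ, n ≠ 0 → ∫ t, Real.cos (n * t) * φ t ∂angleMeasure =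
      sliceCoeff (fun t => Real.cos (n * t)) f R := by
    intro n hn
    simp_rw [hφdef, mul_sub]
    rw [integral_sub (integrable_trig_mul (by fun_prop) (fun t => Real.abs_cos_le_one _) hfR)
      (integrable_trig_mul (by fun_prop) (fun t => Real.abs_cos_le_one _) (memLp_const c)),
      integral_mul_const, integral_angleMeasure (fun t => Real.cos (n * t)),
      integral_cos_int_mul hn, zero_mul, sub_zero, sliceCoeff]
  have hsin : ∀ n : ℤ, ∫ t, Real.sin (n * t) * φ t ∂angleMeasure =
      sliceCoeff (fun t => Real.sin (n * t)) f R := by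
    intro n
    simp_rw [hφdef, mul_sub]
    rw [integral_sub (integrable_trig_mul (by fun_prop) (fun t => Real.abs_sin_le_one _) hfR)
      (integrable_trig_mul (by fun_prop) (fun t => Real.abs_sin_le_one _) (memLp_const c)),
      integral_mul_const, integral_angleMeasure (fun t => Real.sin (n * t)),
      integral_sin_int_mul n, zero_mul, sub_zero, sliceCoeff]
  have hmean : ∫ t, φ t ∂angleMeasure = 0 := by
    simp_rw [hφdef]
    rw [integral_sub (hfR.integrable (by norm_num)) (integrable_const c), integral_const, hcdef,
      sliceCoeff, Measure.real, measure_angleMeasure, ENNReal.toReal_ofReal (by positivity)]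
    simp only [Pi.one_apply, one_mul, smul_eq_mul]
    field_simp
    ring
  have key := wirtinger_slice hφ hFR (fun n => ?_) (fun n => ?_) m (fun n hn => ?_)
  -- On a fixed circle the factor 1/R is constant and comes out of the integral.
  · have e : ∀ (ψ : ℝ → ℝ), MemLp ψ 2 angleMeasure →
        ∫⁻ t, ‖ψ t / R‖ₑ ^ 2 ∂angleMeasure =
          ENNReal.ofReal ((R⁻¹) ^ 2 * ∫ t, ψ t ^ 2 ∂angleMeasure) := by
      intro ψ hψ
      rw [← integral_const_mul, ofReal_integral_eq_lintegral_ofReal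
        (hψ.integrable_sq.const_mul _) (Eventually.of_forall fun t => by positivity)]
      refine lintegral_congr fun t => ?_
      rw [Real.enorm_eq_ofReal_abs, ← ENNReal.ofReal_pow (abs_nonneg _), sq_abs]
      congr 1
      ring
    simp only [hc, norm_polarPoint hR.1.le]
    rw [e φ hφ, e _ hFR]
    rw [← ENNReal.ofReal_natCast, ← ENNReal.ofReal_pow (by positivity),
      ← ENNReal.ofReal_mul (by positivity), mul_left_comm]
    exact ENNReal.ofReal_le_ofReal (mul_le_mul_of_nonneg_left key (by positivity))
  · rw [hsin]; exact (h1 n).1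
  · by_cases hn : n = 0
    · have := (h1 n).2
      subst hn
      simp
    · rw [hcos n hn]; exact (h1 n).2
  · by_cases hn0 : n = 0
    · subst hn0
      simpa using hmean
    · rw [hcos n hn0, hsin n]
      exact h2 n hn0 hn

end HFU

/-! ### The L² norm, limits of smooth functions in H¹, polar components of gradients -/

namespace HFU

theorem ae_mem_disc : ∀ᵐ x ∂discMeasure, ‖x‖ < 1 := by
  filter_upwards [ae_restrict_mem (s := disc) Metric.isOpen_ball.measurableSet] with x hx
  simpa [disc] using hx

theorem ae_ne_zero : ∀ᵐ x ∂discMeasure, x ≠ 0 := by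
  rw [discMeasure]
  exact ae_restrict_of_ae (Measure.ae_ne _ _)

theorem memLp_of_continuous {f : Plane → ℝ} (hf : Continuous f) (p : ℝ≥0∞) :
    MemLp f p discMeasure := by
  obtain ⟨C, hC⟩ := (isCompact_closedBall (0 : Plane) 1).exists_bound_of_continuousOn
    hf.continuousOn
  refine MemLp.of_bound hf.aestronglyMeasurable C ?_
  filter_upwards [ae_mem_disc] with x hx
  exact hC x (by simpa using hx.le)

/-- The norm of `L²(B)`. -/
noncomputable def nrm (f : Plane → ℝ) : ℝ := (eLpNorm f 2 discMeasure).toReal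

theorem nrm_nonneg (f : Plane → ℝ) : 0 ≤ nrm f := ENNReal.toReal_nonneg

theorem ofReal_nrm {f : Plane → ℝ} (hf : MemLp f 2 discMeasure) :
    ENNReal.ofReal (nrm f) = eLpNorm f 2 discMeasure := ENNReal.ofReal_toReal hf.2.ne

theorem sq_nrm {f : Plane → ℝ} (hf : MemLp f 2 discMeasure) :
    nrm f ^ 2 = ∫ x, f x ^ 2 ∂discMeasure := by
  rw [nrm, ← ENNReal.toReal_pow, sq_eLpNorm,
    integral_eq_lintegral_of_nonneg_ae (Eventually.of_forall fun x => sq_nonneg _)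
    (hf.1.pow 2)]
  congr 1
  refine lintegral_congr fun x => ?_
  rw [Real.enorm_eq_ofReal_abs, ← ENNReal.ofReal_pow (abs_nonneg _), sq_abs]

theorem nrm_congr {f g : Plane → ℝ} (h : f =ᵐ[discMeasure] g) : nrm f = nrm g := by
  rw [nrm, nrm, eLpNorm_congr_ae h]

theorem nrm_add_le {f g : Plane → ℝ} (hf : MemLp f 2 discMeasure) (hg : MemLp g 2 discMeasure) :
    nrm (fun x => f x + g x) ≤ nrm f + nrm g := by
  rw [nrm, nrm, nrm, ← ENNReal.toReal_add hf.2.ne hg.2.ne]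
  exact ENNReal.toReal_mono (ENNReal.add_ne_top.2 ⟨hf.2.ne, hg.2.ne⟩)
    (eLpNorm_add_le hf.1 hg.1 (by norm_num))

theorem nrm_neg (f : Plane → ℝ) : nrm (fun x => -f x) = nrm f := by
  rw [nrm, nrm]
  congr 1
  exact eLpNorm_neg f 2 discMeasure

theorem nrm_sub_le {f g : Plane → ℝ} (hf : MemLp f 2 discMeasure) (hg : MemLp g 2 discMeasure) :
    nrm (fun x => f x - g x) ≤ nrm f + nrm g := by
  have := nrm_add_le hf hg.neg
  simp only [Pi.neg_apply, ← sub_eq_add_neg] at this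
  rwa [show nrm (-g) = nrm g from nrm_neg g] at this

theorem nrm_mono {f g : Plane → ℝ} (hg : MemLp g 2 discMeasure)
    (h : ∀ᵐ x ∂discMeasure, |f x| ≤ |g x|) : nrm f ≤ nrm g :=
  ENNReal.toReal_mono hg.2.ne (eLpNorm_mono_ae h)

theorem integrable_mul_of_memLp {f g : Plane → ℝ} (hf : MemLp f 2 discMeasure)
    (hg : MemLp g 2 discMeasure) : Integrable (fun x => f x * g x) discMeasure :=
  hf.integrable_mul hg

theorem integral_abs_mul_le {f g : Plane → ℝ} (hf : MemLp f 2 discMeasure)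
    (hg : MemLp g 2 discMeasure) :
    ∫ x, |f x| * |g x| ∂discMeasure ≤ nrm f * nrm g := by
  have h := integral_mul_norm_le_Lp_mul_Lq (μ := discMeasure) (f := f) (g := g) (p := 2) (q := 2)
    Real.HolderConjugate.two_two (by simpa using hf) (by simpa using hg)
  simp only [Real.norm_eq_abs] at h
  refine h.trans (le_of_eq ?_)
  have e : ∀ u : Plane → ℝ, MemLp u 2 discMeasure →
      (∫ a, |u a| ^ (2 : ℝ) ∂discMeasure) ^ (1 / (2 : ℝ)) = nrm u := by
    intro u hu
    rw [← Real.sqrt_eq_rpow, ← Real.sqrt_sq (nrm_nonneg u), sq_nrm hu]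
    simp
  rw [e f hf, e g hg]

theorem abs_integral_le_of_abs_le {F f g : Plane → ℝ} {C : ℝ} (hC : 0 ≤ C)
    (hf : MemLp f 2 discMeasure) (hg : MemLp g 2 discMeasure)
    (h : ∀ᵐ x ∂discMeasure, |F x| ≤ C * (|f x| * |g x|)) :
    |∫ x, F x ∂discMeasure| ≤ C * (nrm f * nrm g) := by
  have hi : Integrable (fun x => C * (|f x| * |g x|)) discMeasure :=
    (integrable_mul_of_memLp hf.abs hg.abs).const_mul C
  calc |∫ x, F x ∂discMeasure| ≤ ∫ x, C * (|f x| * |g x|) ∂discMeasure :=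
        norm_integral_le_of_norm_le (f := F) hi h
    _ = C * ∫ x, |f x| * |g x| ∂discMeasure := integral_const_mul _ _
    _ ≤ _ := mul_le_mul_of_nonneg_left (integral_abs_mul_le hf hg) hC

/-- Convergence in `L²(B)`. -/
def TendstoL2 (w : ℕ → Plane → ℝ) (f : Plane → ℝ) : Prop :=
  Tendsto (fun k => eLpNorm (fun x => w k x - f x) 2 discMeasure) atTop (𝓝 0)

theorem TendstoL2.nrm_sub {w : ℕ → Plane → ℝ} {f : Plane → ℝ} (h : TendstoL2 w f) :
    Tendsto (fun k => nrm (fun x => w k x - f x)) atTop (𝓝 0) := by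
  have := (ENNReal.tendsto_toReal (a := 0) (by simp)).comp h
  simpa [nrm, Function.comp_def] using this

theorem tendstoL2_of_nrm {w : ℕ → Plane → ℝ} {f : Plane → ℝ}
    (hw : ∀ k, MemLp (w k) 2 discMeasure) (hf : MemLp f 2 discMeasure)
    (h : Tendsto (fun k => nrm (fun x => w k x - f x)) atTop (𝓝 0)) : TendstoL2 w f := by
  have h2 := ENNReal.tendsto_ofReal h
  rw [ENNReal.ofReal_zero] at h2
  exact h2.congr fun k => ofReal_nrm ((hw k).sub hf)

theorem TendstoL2.integral_mul {w : ℕ → Plane → ℝ} {f a : Plane → ℝ}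
    (hw : ∀ k, MemLp (w k) 2 discMeasure) (hf : MemLp f 2 discMeasure)
    (ha : MemLp a 2 discMeasure) (h : TendstoL2 w f) :
    Tendsto (fun k => ∫ x, a x * w k x ∂discMeasure) atTop (𝓝 (∫ x, a x * f x ∂discMeasure)) := by
  rw [tendsto_iff_dist_tendsto_zero]
  have h1 := (h.nrm_sub.const_mul (nrm a))
  rw [mul_zero] at h1
  refine squeeze_zero (fun _ => dist_nonneg) (fun k => ?_) h1
  rw [Real.dist_eq, ← integral_sub (integrable_mul_of_memLp ha (hw k))
    (integrable_mul_of_memLp ha hf)]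
  have := abs_integral_le_of_abs_le (F := fun x => a x * w k x - a x * f x) (C := 1) zero_le_one ha
    ((hw k).sub hf) (Eventually.of_forall fun x => by
      rw [← mul_sub, abs_mul, one_mul, Pi.sub_apply])
  rwa [one_mul] at this

theorem TendstoL2.nrm {w : ℕ → Plane → ℝ} {f : Plane → ℝ}
    (hw : ∀ k, MemLp (w k) 2 discMeasure) (hf : MemLp f 2 discMeasure) (h : TendstoL2 w f) :
    Tendsto (fun k => nrm (w k)) atTop (𝓝 (nrm f)) := by
  rw [tendsto_iff_dist_tendsto_zero]
  refine squeeze_zero (fun _ => dist_nonneg) (fun k => ?_) h.nrm_sub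
  rw [Real.dist_eq, abs_le]
  constructor
  · have := nrm_sub_le (hw k) ((hw k).sub hf)
    simp only [Pi.sub_apply, sub_sub_cancel] at this
    change HFU.nrm f ≤ HFU.nrm (w k) + HFU.nrm (fun x => w k x - f x) at this
    linarith
  · have := nrm_add_le ((hw k).sub hf) hf
    simp only [Pi.sub_apply, sub_add_cancel] at this
    change HFU.nrm (w k) ≤ HFU.nrm (fun x => w k x - f x) + HFU.nrm f at this
    linarith

theorem TendstoL2.add {w v : ℕ → Plane → ℝ} {f g : Plane → ℝ} (h : TendstoL2 w f)
    (h' : TendstoL2 v g) (hw : ∀ k, AEStronglyMeasurable (w k) discMeasure)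
    (hv : ∀ k, AEStronglyMeasurable (v k) discMeasure) (hf : AEStronglyMeasurable f discMeasure)
    (hg : AEStronglyMeasurable g discMeasure) :
    TendstoL2 (fun k x => w k x + v k x) (fun x => f x + g x) := by
  have h0 := Tendsto.add h h'
  rw [add_zero] at h0
  refine tendsto_of_tendsto_of_tendsto_of_le_of_le tendsto_const_nhds h0 (fun _ => zero_le)
    fun k => ?_
  have e : (fun x => w k x + v k x - (f x + g x)) =
    (fun x => w k x - f x) + fun x => v k x - g x := by
    funext x; simp only [Pi.add_apply]; ring
  show eLpNorm (fun x => w k x + v k x - (f x + g x)) 2 discMeasure ≤ _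
  rw [e]
  exact eLpNorm_add_le ((hw k).sub hf) ((hv k).sub hg) (by norm_num)

theorem TendstoL2.bdd_mul {w : ℕ → Plane → ℝ} {f a : Plane → ℝ} {C : ℝ} (h : TendstoL2 w f)
    (ha : ∀ᵐ x ∂discMeasure, |a x| ≤ C) :
    TendstoL2 (fun k x => a x * w k x) (fun x => a x * f x) := by
  have h0 := ENNReal.Tendsto.const_mul (a := ENNReal.ofReal C) h (Or.inr ENNReal.ofReal_ne_top)
  rw [mul_zero] at h0
  refine tendsto_of_tendsto_of_tendsto_of_le_of_le tendsto_const_nhds h0 (fun _ => zero_le)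
    fun k => eLpNorm_le_mul_eLpNorm_of_ae_le_mul ?_ 2
  filter_upwards [ha] with x hx
  rw [← mul_sub, norm_mul]
  exact mul_le_mul_of_nonneg_right hx (norm_nonneg _)

/-- Smooth functions `w k` converge to `f` in `L²(B)`, and their gradients converge to `g`. -/
structure IsH1Limit (w : ℕ → Plane → ℝ) (f : Plane → ℝ) (g : Fin 2 → Plane → ℝ) : Prop where
  smooth : ∀ k, ContDiff ℝ ∞ (w k)
  memLp : MemLp f 2 discMeasure
  memLp_grad : ∀ j, MemLp (g j) 2 discMeasure
  tendsto : TendstoL2 w f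
  tendsto_grad : ∀ j, TendstoL2 (fun k => partialDeriv j (w k)) (g j)

theorem contDiff_partialDeriv {f : Plane → ℝ} (hf : ContDiff ℝ ∞ f) (j : Fin 2) :
    ContDiff ℝ ∞ (partialDeriv j f) :=
  (hf.fderiv_right (m := ∞) (by simp)).clm_apply contDiff_const

theorem partialDeriv_add {f g : Plane → ℝ} (hf : ContDiff ℝ ∞ f) (hg : ContDiff ℝ ∞ g)
    (j : Fin 2) (x : Plane) :
    partialDeriv j (fun y => f y + g y) x = partialDeriv j f x + partialDeriv j g x := by
  rw [partialDeriv, fderiv_fun_add (hf.differentiable (by simp) x) (hg.differentiable (by simp) x)]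
  rfl

theorem partialDeriv_sub {f g : Plane → ℝ} (hf : ContDiff ℝ ∞ f) (hg : ContDiff ℝ ∞ g)
    (j : Fin 2) (x : Plane) :
    partialDeriv j (fun y => f y - g y) x = partialDeriv j f x - partialDeriv j g x := by
  rw [partialDeriv, fderiv_fun_sub (hf.differentiable (by simp) x) (hg.differentiable (by simp) x)]
  rfl

theorem partialDeriv_mul {f g : Plane → ℝ} (hf : ContDiff ℝ ∞ f) (hg : ContDiff ℝ ∞ g)
    (j : Fin 2) (x : Plane) : partialDeriv j (fun y => f y * g y) x =
      f x * partialDeriv j g x + g x * partialDeriv j f x := by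
  rw [partialDeriv, fderiv_fun_mul (hf.differentiable (by simp) x) (hg.differentiable (by simp) x)]
  rfl

theorem partialDeriv_const_mul {f : Plane → ℝ} (hf : ContDiff ℝ ∞ f) (c : ℝ)
    (j : Fin 2) (x : Plane) : partialDeriv j (fun y => c * f y) x = c * partialDeriv j f x := by
  rw [partialDeriv, fderiv_const_mul (hf.differentiable (by simp) x)]
  rfl

theorem partialDeriv_comm {f : Plane → ℝ} (hf : ContDiff ℝ ∞ f) (i j : Fin 2) (x : Plane) :
    partialDeriv i (partialDeriv j f) x = partialDeriv j (partialDeriv i f) x := by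
  have hs : IsSymmSndFDerivAt ℝ f x :=
    (hf.contDiffAt).isSymmSndFDerivAt (by
      rw [minSmoothness_of_isRCLikeNormedField]
      exact WithTop.coe_le_coe.2 le_top)
  have e : ∀ i j : Fin 2, partialDeriv i (partialDeriv j f) x =
      fderiv ℝ (fderiv ℝ f) x (EuclideanSpace.single i 1) (EuclideanSpace.single j 1) := by
    intro i j
    have hd : DifferentiableAt ℝ (fderiv ℝ f) x :=
      (hf.fderiv_right (m := ∞) (by simp)).differentiable (by simp) x
    have := (hd.hasFDerivAt.clm_apply
      (hasFDerivAt_const (EuclideanSpace.single j (1 : ℝ)) x)).fderiv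
    rw [partialDeriv]
    change fderiv ℝ (fun y => fderiv ℝ f y (EuclideanSpace.single j 1)) x _ = _
    rw [this]
    simp
  rw [e, e, hs]

theorem fderiv_eq_partialDeriv (f : Plane → ℝ) (x v : Plane) :
    fderiv ℝ f x v = v 0 * partialDeriv 0 f x + v 1 * partialDeriv 1 f x := by
  have : v = v 0 • EuclideanSpace.single (0 : Fin 2) (1 : ℝ) +
      v 1 • EuclideanSpace.single (1 : Fin 2) (1 : ℝ) := by
    apply plane_ext <;> simp
  conv_lhs => rw [this]
  simp [partialDeriv]

theorem IsH1Limit.const {f : Plane → ℝ} (hf : ContDiff ℝ ∞ f) :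
    IsH1Limit (fun _ => f) f (fun j => partialDeriv j f) where
  smooth _ := hf
  memLp := memLp_of_continuous hf.continuous 2
  memLp_grad j := memLp_of_continuous (contDiff_partialDeriv hf j).continuous 2
  tendsto := by simp [TendstoL2]
  tendsto_grad j := by simp [TendstoL2]

theorem IsH1Limit.add {w w' : ℕ → Plane → ℝ} {f f' : Plane → ℝ} {g g' : Fin 2 → Plane → ℝ}
    (h : IsH1Limit w f g) (h' : IsH1Limit w' f' g') :
    IsH1Limit (fun k x => w k x + w' k x) (fun x => f x + f' x) (fun j x => g j x + g' j x) where
  smooth k := (h.smooth k).add (h'.smooth k)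
  memLp := h.memLp.add h'.memLp
  memLp_grad j := (h.memLp_grad j).add (h'.memLp_grad j)
  tendsto := h.tendsto.add h'.tendsto (fun k => (h.smooth k).continuous.aestronglyMeasurable)
    (fun k => (h'.smooth k).continuous.aestronglyMeasurable) h.memLp.1 h'.memLp.1
  tendsto_grad j := by
    have := (h.tendsto_grad j).add (h'.tendsto_grad j)
      (fun k => (contDiff_partialDeriv (h.smooth k) j).continuous.aestronglyMeasurable)
      (fun k => (contDiff_partialDeriv (h'.smooth k) j).continuous.aestronglyMeasurable)
      (h.memLp_grad j).1 (h'.memLp_grad j).1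
    convert this using 3 with k x
    exact partialDeriv_add (h.smooth k) (h'.smooth k) j _

theorem IsH1Limit.const_mul {w : ℕ → Plane → ℝ} {f : Plane → ℝ} {g : Fin 2 → Plane → ℝ}
    (h : IsH1Limit w f g) (c : ℝ) :
    IsH1Limit (fun k x => c * w k x) (fun x => c * f x) (fun j x => c * g j x) where
  smooth k := contDiff_const.mul (h.smooth k)
  memLp := h.memLp.const_mul c
  memLp_grad j := (h.memLp_grad j).const_mul c
  tendsto := h.tendsto.bdd_mul (a := fun _ => c) (C := |c|) (by simp)
  tendsto_grad j := by
    have := (h.tendsto_grad j).bdd_mul (a := fun _ => c) (C := |c|) (by simp)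
    convert this using 3 with k x
    exact partialDeriv_const_mul (h.smooth k) c j _

theorem IsH1Limit.sub {w w' : ℕ → Plane → ℝ} {f f' : Plane → ℝ} {g g' : Fin 2 → Plane → ℝ}
    (h : IsH1Limit w f g) (h' : IsH1Limit w' f' g') :
    IsH1Limit (fun k x => w k x - w' k x) (fun x => f x - f' x) (fun j x => g j x - g' j x) := by
  have := h.add (h'.const_mul (-1))
  simpa only [neg_one_mul, ← sub_eq_add_neg] using this

/-- `R` times the angular component of the vector field `g`. -/
def ang (g : Fin 2 → Plane → ℝ) (x : Plane) : ℝ := x 0 * g 1 x - x 1 * g 0 x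

/-- `R` times the radial component of the vector field `g`. -/
def radl (g : Fin 2 → Plane → ℝ) (x : Plane) : ℝ := x 0 * g 0 x + x 1 * g 1 x

theorem abs_coord_le (x : Plane) (j : Fin 2) : |x j| ≤ ‖x‖ := by
  have := EuclideanSpace.norm_sq_eq x
  rw [Fin.sum_univ_two] at this
  simp only [Real.norm_eq_abs, sq_abs] at this
  refine abs_le_of_sq_le_sq ?_ (norm_nonneg _)
  fin_cases j
  · simp; nlinarith [sq_nonneg (x 1)]
  · simp; nlinarith [sq_nonneg (x 0)]

theorem ae_abs_coord_le (j : Fin 2) : ∀ᵐ x ∂discMeasure, |x j| ≤ 1 := by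
  filter_upwards [ae_mem_disc] with x hx using (abs_coord_le x j).trans hx.le

theorem continuous_coord (j : Fin 2) : Continuous fun x : Plane => x j := by fun_prop

theorem memLp_coord_mul {f : Plane → ℝ} (hf : MemLp f 2 discMeasure) (j : Fin 2) :
    MemLp (fun x => x j * f x) 2 discMeasure := by
  refine hf.of_le ((continuous_coord j).aestronglyMeasurable.mul hf.1) ?_
  filter_upwards [ae_abs_coord_le j] with x hx
  rw [norm_mul]
  exact mul_le_of_le_one_left (norm_nonneg _) hx

theorem memLp_ang {g : Fin 2 → Plane → ℝ} (hg : ∀ j, MemLp (g j) 2 discMeasure) :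
    MemLp (ang g) 2 discMeasure := (memLp_coord_mul (hg 1) 0).sub (memLp_coord_mul (hg 0) 1)

theorem memLp_radl {g : Fin 2 → Plane → ℝ} (hg : ∀ j, MemLp (g j) 2 discMeasure) :
    MemLp (radl g) 2 discMeasure := (memLp_coord_mul (hg 0) 0).add (memLp_coord_mul (hg 1) 1)

theorem tendstoL2_ang {w : ℕ → Plane → ℝ} {f : Plane → ℝ} {g : Fin 2 → Plane → ℝ}
    (h : IsH1Limit w f g) :
    TendstoL2 (fun k => ang fun j => partialDeriv j (w k)) (ang g) := by
  have hm : ∀ j k, AEStronglyMeasurable (partialDeriv j (w k)) discMeasure := fun j k =>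
    (contDiff_partialDeriv (h.smooth k) j).continuous.aestronglyMeasurable
  have h1 := (h.tendsto_grad 1).bdd_mul (ae_abs_coord_le 0)
  have h2 := (h.tendsto_grad 0).bdd_mul (a := fun x => -x 1) (C := 1)
    (by simpa using ae_abs_coord_le 1)
  have := h1.add h2 (fun k => (continuous_coord 0).aestronglyMeasurable.mul (hm 1 k))
    (fun k => (continuous_coord 1).neg.aestronglyMeasurable.mul (hm 0 k))
    ((continuous_coord 0).aestronglyMeasurable.mul (h.memLp_grad 1).1)
    ((continuous_coord 1).neg.aestronglyMeasurable.mul (h.memLp_grad 0).1)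
  simp only [neg_mul, ← sub_eq_add_neg] at this
  exact this

theorem tendstoL2_radl {w : ℕ → Plane → ℝ} {f : Plane → ℝ} {g : Fin 2 → Plane → ℝ}
    (h : IsH1Limit w f g) :
    TendstoL2 (fun k => radl fun j => partialDeriv j (w k)) (radl g) := by
  have hm : ∀ j k, AEStronglyMeasurable (partialDeriv j (w k)) discMeasure := fun j k =>
    (contDiff_partialDeriv (h.smooth k) j).continuous.aestronglyMeasurable
  exact ((h.tendsto_grad 0).bdd_mul (ae_abs_coord_le 0)).add
    ((h.tendsto_grad 1).bdd_mul (ae_abs_coord_le 1))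
    (fun k => (continuous_coord 0).aestronglyMeasurable.mul (hm 0 k))
    (fun k => (continuous_coord 1).aestronglyMeasurable.mul (hm 1 k))
    ((continuous_coord 0).aestronglyMeasurable.mul (h.memLp_grad 0).1)
    ((continuous_coord 1).aestronglyMeasurable.mul (h.memLp_grad 1).1)

theorem hasDerivAt_comp_polarPoint {f : Plane → ℝ} (hf : ContDiff ℝ ∞ f) (R t : ℝ) :
    HasDerivAt (fun s => f (polarPoint R s)) (ang (fun j => partialDeriv j f) (polarPoint R t)) t := by
  have hp : HasDerivAt (fun s => polarPoint R s) (!₂[-polarPoint R t 1, polarPoint R t 0]) t := by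
    have h : (fun s => polarPoint R s) =
        fun s => Real.cos s • (!₂[R, 0] : Plane) + Real.sin s • (!₂[0, R] : Plane) := by
      funext s
      apply plane_ext
      · simp [polarPoint_zero, mul_comm]
      · simp [polarPoint_one, mul_comm]
    rw [h]
    have := ((Real.hasDerivAt_cos t).smul_const (!₂[R, 0] : Plane)).fun_add
      ((Real.hasDerivAt_sin t).smul_const (!₂[0, R] : Plane))
    refine this.congr_deriv ?_
    apply plane_ext
    · simp [polarPoint_one, mul_comm]
    · simp [polarPoint_zero, mul_comm]
  have := (hf.differentiable (by simp) (polarPoint R t)).hasFDerivAt.comp_hasDerivAt t hp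
  refine this.congr_deriv ?_
  rw [fderiv_eq_partialDeriv, ang]
  simp
  ring

theorem continuous_polarPoint (R : ℝ) : Continuous (polarPoint R) := by
  unfold polarPoint; fun_prop

/-- Integration by parts over a full turn, with boundary terms cancelling by periodicity. -/
theorem isAngularDeriv_smooth {f : Plane → ℝ} (hf : ContDiff ℝ ∞ f) (R : ℝ) (n : ℤ) :
    sliceCoeff (fun t => Real.cos (n * t)) (ang fun j => partialDeriv j f) R =
      n * sliceCoeff (fun t => Real.sin (n * t)) f R ∧
    sliceCoeff (fun t => Real.sin (n * t)) (ang fun j => partialDeriv j f) R =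
      -n * sliceCoeff (fun t => Real.cos (n * t)) f R := by
  have hc : Continuous fun t => ang (fun j => partialDeriv j f) (polarPoint R t) := by
    unfold ang
    have h0 := (contDiff_partialDeriv hf 0).continuous
    have h1 := (contDiff_partialDeriv hf 1).continuous
    have h2 := continuous_polarPoint R
    exact (((continuous_coord 0).comp h2).mul (h1.comp h2)).sub
      (((continuous_coord 1).comp h2).mul (h0.comp h2))
  have hper : polarPoint R Real.pi = polarPoint R (-Real.pi) := by
    have := polarPoint_periodic R (-Real.pi)
    rw [← this]; congr 1; ring
  have hlin : ∀ t : ℝ, HasDerivAt (fun s : ℝ => (n : ℝ) * s) n t := fun t => by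
    simpa using (hasDerivAt_id t).const_mul (n : ℝ)
  constructor
  · rw [sliceCoeff, sliceCoeff, integral_angleMeasure, integral_angleMeasure]
    rw [intervalIntegral.integral_mul_deriv_eq_deriv_mul
      (u' := fun t => -Real.sin (n * t) * n)
      (fun t _ => (hlin t).cos) (fun t _ => hasDerivAt_comp_polarPoint hf R t)
      (Continuous.intervalIntegrable (by fun_prop) _ _) (hc.intervalIntegrable _ _), hper]
    simp only [mul_neg, Real.cos_neg, sub_self, zero_sub, neg_mul]
    rw [intervalIntegral.integral_neg, neg_neg, ← intervalIntegral.integral_const_mul]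
    refine intervalIntegral.integral_congr fun t _ => ?_
    ring
  · rw [sliceCoeff, sliceCoeff, integral_angleMeasure, integral_angleMeasure]
    rw [intervalIntegral.integral_mul_deriv_eq_deriv_mul
      (u' := fun t => Real.cos (n * t) * n)
      (fun t _ => (hlin t).sin) (fun t _ => hasDerivAt_comp_polarPoint hf R t)
      (Continuous.intervalIntegrable (by fun_prop) _ _) (hc.intervalIntegrable _ _), hper]
    simp only [mul_neg, Real.sin_neg, Real.sin_int_mul_pi, neg_mul, zero_mul, neg_zero, sub_self,
      zero_sub]
    rw [← intervalIntegral.integral_const_mul]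
    congr 1
    refine intervalIntegral.integral_congr fun t _ => ?_
    ring

theorem TendstoL2.symm {w : ℕ → Plane → ℝ} {f : Plane → ℝ} (h : TendstoL2 w f) :
    Tendsto (fun k => eLpNorm (fun x => f x - w k x) 2 discMeasure) atTop (𝓝 0) := by
  refine h.congr fun k => ?_
  rw [← eLpNorm_neg]
  congr 1
  funext x
  simp

/-- Only the circle coefficients of the angular derivative are needed, so no representative of f
that is absolutely continuous on circles has to be chosen. -/
theorem IsH1Limit.isAngularDeriv {w : ℕ → Plane → ℝ} {f : Plane → ℝ} {g : Fin 2 → Plane → ℝ}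
    (h : IsH1Limit w f g) : IsAngularDeriv f (ang g) := by
  have hw : ∀ k, MemLp (w k) 2 discMeasure := fun k =>
    memLp_of_continuous (h.smooth k).continuous 2
  have hg : ∀ k, MemLp (ang fun j => partialDeriv j (w k)) 2 discMeasure := fun k =>
    memLp_ang fun j => memLp_of_continuous (contDiff_partialDeriv (h.smooth k) j).continuous 2
  rw [IsAngularDeriv, ae_all_iff]
  intro n
  have hc : Measurable fun t : ℝ => Real.cos (n * t) := by fun_prop
  have hs : Measurable fun t : ℝ => Real.sin (n * t) := by fun_prop
  filter_upwards [sliceCoeff_relation_of_tendsto hc (fun t => Real.abs_cos_le_one _) hs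
      (fun t => Real.abs_sin_le_one _) n (memLp_ang h.memLp_grad) h.memLp hg hw
      (tendstoL2_ang h).symm h.tendsto.symm
      (fun k => Eventually.of_forall fun R => (isAngularDeriv_smooth (h.smooth k) R n).1),
    sliceCoeff_relation_of_tendsto hs (fun t => Real.abs_sin_le_one _) hc
      (fun t => Real.abs_cos_le_one _) (-n) (memLp_ang h.memLp_grad) h.memLp hg hw
      (tendstoL2_ang h).symm h.tendsto.symm
      (fun k => Eventually.of_forall fun R => (isAngularDeriv_smooth (h.smooth k) R n).2)]
    with R h1 h2
  exact ⟨h1, h2⟩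

theorem abs_ang_div_le (g : Fin 2 → Plane → ℝ) (x : Plane) :
    |ang g x / ‖x‖| ≤ |g 0 x| + |g 1 x| := by
  rw [abs_div, abs_norm]
  refine div_le_of_le_mul₀ (norm_nonneg _) (by positivity) ?_
  rw [ang]
  calc |x 0 * g 1 x - x 1 * g 0 x| ≤ |x 0 * g 1 x| + |x 1 * g 0 x| := abs_sub _ _
    _ ≤ _ := by
      rw [abs_mul, abs_mul]
      nlinarith [abs_coord_le x 0, abs_coord_le x 1, abs_nonneg (g 0 x), abs_nonneg (g 1 x)]

theorem abs_radl_div_le (g : Fin 2 → Plane → ℝ) (x : Plane) :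
    |radl g x / ‖x‖| ≤ |g 0 x| + |g 1 x| := by
  rw [abs_div, abs_norm]
  refine div_le_of_le_mul₀ (norm_nonneg _) (by positivity) ?_
  rw [radl]
  calc |x 0 * g 0 x + x 1 * g 1 x| ≤ |x 0 * g 0 x| + |x 1 * g 1 x| := abs_add_le _ _
    _ ≤ _ := by
      rw [abs_mul, abs_mul]
      nlinarith [abs_coord_le x 0, abs_coord_le x 1, abs_nonneg (g 0 x), abs_nonneg (g 1 x)]

theorem aestronglyMeasurable_div_norm {f : Plane → ℝ} (hf : AEStronglyMeasurable f discMeasure) :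
    AEStronglyMeasurable (fun x => f x / ‖x‖) discMeasure :=
  hf.mul measurable_norm.inv.aestronglyMeasurable

theorem memLp_ang_div {g : Fin 2 → Plane → ℝ} (hg : ∀ j, MemLp (g j) 2 discMeasure) :
    MemLp (fun x => ang g x / ‖x‖) 2 discMeasure :=
  ((hg 0).abs.add (hg 1).abs).mono' (aestronglyMeasurable_div_norm (memLp_ang hg).1)
    (Eventually.of_forall (abs_ang_div_le g))

theorem memLp_radl_div {g : Fin 2 → Plane → ℝ} (hg : ∀ j, MemLp (g j) 2 discMeasure) :
    MemLp (fun x => radl g x / ‖x‖) 2 discMeasure :=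
  ((hg 0).abs.add (hg 1).abs).mono' (aestronglyMeasurable_div_norm (memLp_radl hg).1)
    (Eventually.of_forall (abs_radl_div_le g))

/-- The oscillating part of `f` on circles, divided by the radius. -/
noncomputable def osc (f : Plane → ℝ) (x : Plane) : ℝ := (f x - circleMean f x) / ‖x‖

theorem lowModesVanish_one (f : Plane → ℝ) : LowModesVanish f 1 := by
  refine Eventually.of_forall fun R n hn hn1 => absurd ?_ hn
  simpa [Int.abs_lt_one_iff] using hn1

/-- The division by |x| is harmless because the mean has been removed: Wirtinger with m = 1. -/
theorem IsH1Limit.memLp_osc {w : ℕ → Plane → ℝ} {f : Plane → ℝ} {g : Fin 2 → Plane → ℝ}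
    (h : IsH1Limit w f g) : MemLp (osc f) 2 discMeasure := by
  refine ⟨aestronglyMeasurable_div_norm (h.memLp.1.sub (aestronglyMeasurable_circleMean h.memLp.1)),
    ?_⟩
  have := wirtinger h.memLp (memLp_ang h.memLp_grad) h.isAngularDeriv 1 (lowModesVanish_one f)
  rw [Nat.cast_one, one_mul] at this
  exact this.trans_lt (memLp_ang_div h.memLp_grad).2

theorem IsH1Limit.wirtinger {w : ℕ → Plane → ℝ} {f : Plane → ℝ} {g : Fin 2 → Plane → ℝ}
    (h : IsH1Limit w f g) {m : ℕ} (hm : LowModesVanish f m) :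
    m * nrm (osc f) ≤ nrm (fun x => ang g x / ‖x‖) := by
  have := HFU.wirtinger h.memLp (memLp_ang h.memLp_grad) h.isAngularDeriv m hm
  have h2 := ENNReal.toReal_mono (memLp_ang_div h.memLp_grad).2.ne this
  rwa [ENNReal.toReal_mul, ENNReal.toReal_natCast] at h2

theorem IsH1Limit.nrm_osc_le {w : ℕ → Plane → ℝ} {f : Plane → ℝ} {g : Fin 2 → Plane → ℝ}
    (h : IsH1Limit w f g) : nrm (osc f) ≤ nrm (g 0) + nrm (g 1) := by
  have h1 := h.wirtinger (lowModesVanish_one f)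
  rw [Nat.cast_one, one_mul] at h1
  refine h1.trans ?_
  have a0 := (h.memLp_grad 0).abs
  have a1 := (h.memLp_grad 1).abs
  have h2 : nrm (fun x => ang g x / ‖x‖) ≤ nrm (fun x => |g 0 x| + |g 1 x|) :=
    nrm_mono (a0.add a1) (Eventually.of_forall fun x => by
      rw [abs_of_nonneg (a := |g 0 x| + |g 1 x|) (by positivity)]; exact abs_ang_div_le g x)
  refine h2.trans ((nrm_add_le a0 a1).trans (le_of_eq ?_))
  simp only [nrm]
  rw [eLpNorm_congr_norm_ae (f := |g 0|) (g := g 0) (by simp),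
    eLpNorm_congr_norm_ae (f := |g 1|) (g := g 1) (by simp)]

end HFU

/-! ### The Jacobian form on the punctured disc -/

namespace HFU

/-- The closed annulus with radii `a` and `b`. -/
def annulus (a b : ℝ) : Set Plane := {x | a ≤ ‖x‖ ∧ ‖x‖ ≤ b}

theorem isClosed_annulus (a b : ℝ) : IsClosed (annulus a b) :=
  (isClosed_le continuous_const continuous_norm).inter (isClosed_le continuous_norm continuous_const)

theorem isCompact_annulus (a b : ℝ) : IsCompact (annulus a b) :=
  (isCompact_closedBall (0 : Plane) b).of_isClosed_subset (isClosed_annulus a b)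
    fun x hx => by simpa using hx.2

/-- Smooth functions supported in a closed annulus inside the punctured disc. -/
def IsPuncturedTest (φ : Plane → ℝ) : Prop :=
  ContDiff ℝ ∞ φ ∧ ∃ a b : ℝ, 0 < a ∧ b < 1 ∧ ∀ x, x ∉ annulus a b → φ x = 0

theorem tsupport_subset_annulus {φ : Plane → ℝ} {a b : ℝ} (h : ∀ x, x ∉ annulus a b → φ x = 0) :
    tsupport φ ⊆ annulus a b :=
  closure_minimal (fun x hx => by by_contra hn; exact hx (h x hn)) (isClosed_annulus a b)

theorem annulus_subset {a b a' b' : ℝ} (ha : a' ≤ a) (hb : b ≤ b') :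
    annulus a b ⊆ annulus a' b' := fun _ hx => ⟨ha.trans hx.1, hx.2.trans hb⟩

theorem IsPuncturedTest.isTest {φ : Plane → ℝ} (h : IsPuncturedTest φ) : IsTest φ := by
  obtain ⟨hs, a, b, ha, hb, h0⟩ := h
  refine ⟨hs, (isCompact_annulus a b).of_isClosed_subset (isClosed_tsupport φ)
    (tsupport_subset_annulus h0), (tsupport_subset_annulus h0).trans fun x hx => ?_⟩
  rw [disc, mem_ball_zero_iff]
  exact hx.2.trans_lt hb

theorem partialDeriv_eq_zero {φ : Plane → ℝ} {a b : ℝ} (h : ∀ x, x ∉ annulus a b → φ x = 0)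
    (j : Fin 2) (x : Plane) (hx : x ∉ annulus a b) : partialDeriv j φ x = 0 := by
  have h1 : x ∉ tsupport φ := fun hn => hx (tsupport_subset_annulus h hn)
  have h2 : fderiv ℝ φ x = 0 := by
    by_contra hn
    exact h1 (support_fderiv_subset ℝ hn)
  rw [partialDeriv, h2]
  rfl

theorem IsPuncturedTest.partialDeriv {φ : Plane → ℝ} (h : IsPuncturedTest φ) (j : Fin 2) :
    IsPuncturedTest (partialDeriv j φ) := by
  obtain ⟨hs, a, b, ha, hb, h0⟩ := h
  exact ⟨contDiff_partialDeriv hs j, a, b, ha, hb, partialDeriv_eq_zero h0 j⟩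

theorem IsPuncturedTest.smooth_mul {φ f : Plane → ℝ} (h : IsPuncturedTest φ)
    (hf : ContDiff ℝ ∞ f) : IsPuncturedTest (fun x => f x * φ x) := by
  obtain ⟨hs, a, b, ha, hb, h0⟩ := h
  exact ⟨hf.mul hs, a, b, ha, hb, fun x hx => by simp only [h0 x hx, mul_zero]⟩

theorem IsPuncturedTest.sub {φ ψ : Plane → ℝ} (h : IsPuncturedTest φ) (h' : IsPuncturedTest ψ) :
    IsPuncturedTest (fun x => φ x - ψ x) := by
  obtain ⟨hs, a, b, ha, hb, h0⟩ := h
  obtain ⟨hs', a', b', ha', hb', h0'⟩ := h'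
  refine ⟨hs.sub hs', min a a', max b b', lt_min ha ha', max_lt hb hb', fun x hx => ?_⟩
  simp only [h0 x fun hn => hx (annulus_subset (min_le_left _ _) (le_max_left _ _) hn),
    h0' x fun hn => hx (annulus_subset (min_le_right _ _) (le_max_right _ _) hn), sub_zero]

theorem IsPuncturedTest.circleMean {φ : Plane → ℝ} (h : IsPuncturedTest φ) :
    IsPuncturedTest (circleMean φ) := by
  obtain ⟨hs, a, b, ha, hb, h0⟩ := h
  refine ⟨contDiff_circleMean hs, a, b, ha, hb, fun x hx => ?_⟩
  have : ∀ t, φ (rot t x) = 0 := fun t => h0 _ fun hn => hx (by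
    simpa [annulus, (rot t).norm_map] using hn)
  simp [HFU.circleMean, this]

/-- Functions that are essentially bounded on closed annuli inside the punctured disc. -/
structure LocBdd (h : Plane → ℝ) : Prop where
  meas : AEStronglyMeasurable h discMeasure
  bdd : ∀ a b : ℝ, 0 < a → b < 1 → ∃ C, ∀ᵐ x ∂discMeasure, x ∈ annulus a b → |h x| ≤ C

theorem LocBdd.memLp_mul {h : Plane → ℝ} (hh : LocBdd h) {a b : ℝ} (ha : 0 < a) (hb : b < 1)
    {ψ : Plane → ℝ} {q : ℝ≥0∞} (hψ : MemLp ψ q discMeasure) (h0 : ∀ x, x ∉ annulus a b → ψ x = 0) :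
    MemLp (fun x => h x * ψ x) q discMeasure := by
  obtain ⟨C, hC⟩ := hh.bdd a b ha hb
  refine hψ.of_le_mul (c := C) (hh.meas.mul hψ.1) ?_
  filter_upwards [hC] with x hx
  by_cases hxa : x ∈ annulus a b
  · rw [norm_mul]
    exact mul_le_mul_of_nonneg_right (hx hxa) (norm_nonneg _)
  · simp [h0 x hxa]

theorem LocBdd.integrable_mul_test {h φ : Plane → ℝ} (hh : LocBdd h) (hφ : IsPuncturedTest φ) :
    Integrable (fun x => h x * φ x) discMeasure := by
  obtain ⟨hs, a, b, ha, hb, h0⟩ := hφ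
  exact memLp_one_iff_integrable.1 (hh.memLp_mul ha hb (memLp_of_continuous hs.continuous 1) h0)

/-- `h` is locally bounded in the punctured disc with weak gradient `p` there, and `|x| |p| ≤ c`. -/
structure PuncturedWeakGrad (h : Plane → ℝ) (p : Fin 2 → Plane → ℝ) (c : ℝ) : Prop where
  locBdd : LocBdd h
  measurable_grad : ∀ j, AEStronglyMeasurable (p j) discMeasure
  bound : ∀ᵐ x ∂discMeasure, ∀ j, |p j x| * ‖x‖ ≤ c
  ibp : ∀ φ : Plane → ℝ, IsPuncturedTest φ → ∀ j,
    ∫ x, h x * partialDeriv j φ x ∂discMeasure = -∫ x, p j x * φ x ∂discMeasure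

theorem PuncturedWeakGrad.nonneg {h : Plane → ℝ} {p : Fin 2 → Plane → ℝ} {c : ℝ}
    (hp : PuncturedWeakGrad h p c) : 0 ≤ c := by
  have hne : NeZero discMeasure := ⟨fun h0 => by
    have : discMeasure univ = 0 := by simp [h0]
    rw [discMeasure, Measure.restrict_apply_univ] at this
    exact (Metric.measure_ball_pos volume (0 : Plane) one_pos).ne' this⟩
  obtain ⟨x, hx⟩ := hp.bound.exists
  exact (by positivity : 0 ≤ |p 0 x| * ‖x‖).trans (hx 0)

theorem PuncturedWeakGrad.locBdd_grad {h : Plane → ℝ} {p : Fin 2 → Plane → ℝ} {c : ℝ}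
    (hp : PuncturedWeakGrad h p c) (j : Fin 2) : LocBdd (p j) where
  meas := hp.measurable_grad j
  bdd a b ha hb := ⟨c / a, by
    filter_upwards [hp.bound] with x hx hxa
    rw [le_div_iff₀ ha]
    exact (mul_le_mul_of_nonneg_left hxa.1 (abs_nonneg _)).trans (hx j)⟩

/-- The Jacobian determinant of the pair `(f, φ)`. -/
noncomputable def jac (f φ : Plane → ℝ) (x : Plane) : ℝ :=
  partialDeriv 0 f x * partialDeriv 1 φ x - partialDeriv 1 f x * partialDeriv 0 φ x

/-- The cross product of the vector field `p` with the gradient of `f`. -/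
noncomputable def crossGrad (p : Fin 2 → Plane → ℝ) (f : Plane → ℝ) (x : Plane) : ℝ :=
  p 0 x * partialDeriv 1 f x - p 1 x * partialDeriv 0 f x

variable {h : Plane → ℝ} {p : Fin 2 → Plane → ℝ} {c : ℝ}

/-- The Jacobian is the divergence of (f ∂₁φ, -f ∂₀φ), the mixed second derivatives of φ cancelling.
All test functions vanish near the origin, where h need not be bounded. -/
theorem PuncturedWeakGrad.integral_jac_left (hp : PuncturedWeakGrad h p c) {f φ : Plane → ℝ}
    (hf : ContDiff ℝ ∞ f) (hφ : IsPuncturedTest φ) :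
    ∫ x, h x * jac f φ x ∂discMeasure = -∫ x, f x * crossGrad p φ x ∂discMeasure := by
  have t1 := (hφ.partialDeriv 1).smooth_mul hf
  have t0 := (hφ.partialDeriv 0).smooth_mul hf
  have e1 := hp.ibp _ t1 0
  have e0 := hp.ibp _ t0 1
  have i1 := hp.locBdd.integrable_mul_test (t1.partialDeriv 0)
  have i0 := hp.locBdd.integrable_mul_test (t0.partialDeriv 1)
  have j1 := (hp.locBdd_grad 0).integrable_mul_test t1
  have j0 := (hp.locBdd_grad 1).integrable_mul_test t0
  calc _ = ∫ x, (h x * partialDeriv 0 (fun x => f x * partialDeriv 1 φ x) x -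
        h x * partialDeriv 1 (fun x => f x * partialDeriv 0 φ x) x) ∂discMeasure := by
        refine integral_congr_ae (Eventually.of_forall fun x => ?_)
        simp only [jac]
        rw [partialDeriv_mul hf (contDiff_partialDeriv hφ.1 1),
          partialDeriv_mul hf (contDiff_partialDeriv hφ.1 0), partialDeriv_comm hφ.1 0 1]
        ring
    _ = -∫ x, (p 0 x * (f x * partialDeriv 1 φ x) - p 1 x * (f x * partialDeriv 0 φ x))
          ∂discMeasure := by
        rw [integral_sub i1 i0, integral_sub j1 j0, e1, e0]; ring
    _ = _ := by
        congr 1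
        refine integral_congr_ae (Eventually.of_forall fun x => ?_)
        simp only [crossGrad]
        ring

/-- The same with φ as undifferentiated factor; f needs no support condition. -/
theorem PuncturedWeakGrad.integral_jac_right (hp : PuncturedWeakGrad h p c) {f φ : Plane → ℝ}
    (hf : ContDiff ℝ ∞ f) (hφ : IsPuncturedTest φ) :
    ∫ x, h x * jac f φ x ∂discMeasure = ∫ x, φ x * crossGrad p f x ∂discMeasure := by
  have t1 : IsPuncturedTest (fun x => φ x * partialDeriv 1 f x) := by
    simpa only [mul_comm] using hφ.smooth_mul (contDiff_partialDeriv hf 1)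
  have t0 : IsPuncturedTest (fun x => φ x * partialDeriv 0 f x) := by
    simpa only [mul_comm] using hφ.smooth_mul (contDiff_partialDeriv hf 0)
  have e1 := hp.ibp _ t1 0
  have e0 := hp.ibp _ t0 1
  have i1 := hp.locBdd.integrable_mul_test (t1.partialDeriv 0)
  have i0 := hp.locBdd.integrable_mul_test (t0.partialDeriv 1)
  have j1 := (hp.locBdd_grad 0).integrable_mul_test t1
  have j0 := (hp.locBdd_grad 1).integrable_mul_test t0
  calc _ = ∫ x, (h x * partialDeriv 1 (fun x => φ x * partialDeriv 0 f x) x -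
        h x * partialDeriv 0 (fun x => φ x * partialDeriv 1 f x) x) ∂discMeasure := by
        refine integral_congr_ae (Eventually.of_forall fun x => ?_)
        simp only [jac]
        rw [partialDeriv_mul hφ.1 (contDiff_partialDeriv hf 1),
          partialDeriv_mul hφ.1 (contDiff_partialDeriv hf 0), partialDeriv_comm hf 0 1]
        ring
    _ = ∫ x, (p 0 x * (φ x * partialDeriv 1 f x) - p 1 x * (φ x * partialDeriv 0 f x))
          ∂discMeasure := by
        rw [integral_sub i0 i1, integral_sub j1 j0, e1, e0]; ring
    _ = _ := by
        refine integral_congr_ae (Eventually.of_forall fun x => ?_)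
        simp only [crossGrad]
        ring

theorem ang_circleMean {f : Plane → ℝ} (hf : ContDiff ℝ ∞ f) (x : Plane) :
    ang (fun j => partialDeriv j (circleMean f)) x = 0 := by
  have := fderiv_circleMean_perp hf x
  rw [fderiv_eq_partialDeriv] at this
  simp only [Matrix.cons_val_zero, Matrix.cons_val_one] at this
  rw [ang]
  linarith

theorem radl_circleMean {f : Plane → ℝ} (hf : ContDiff ℝ ∞ f) :
    radl (fun j => partialDeriv j (circleMean f)) =
      circleMean (radl fun j => partialDeriv j f) := by
  funext x
  have := fderiv_circleMean_self hf x
  simp only [fderiv_eq_partialDeriv] at this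
  exact this

theorem norm_sq_mul_cross (a b : Fin 2 → Plane → ℝ) (x : Plane) :
    ‖x‖ ^ 2 * (a 0 x * b 1 x - a 1 x * b 0 x) = radl a x * ang b x - ang a x * radl b x := by
  rw [norm_sq_eq, radl, ang, radl, ang]
  ring

/-- Both gradients are radial, hence parallel. -/
theorem jac_circleMean_circleMean {f φ : Plane → ℝ} (hf : ContDiff ℝ ∞ f) (hφ : IsPuncturedTest φ)
    (x : Plane) : jac (circleMean f) (circleMean φ) x = 0 := by
  -- The polar identity is empty at the origin; there the test function vanishes identically nearby.
  by_cases hx : x = 0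
  · obtain ⟨_, a, b, ha, hb, h0⟩ := hφ.circleMean
    have hx0 : x ∉ annulus a b := fun hn => by
      have := hn.1
      rw [hx, norm_zero] at this
      linarith
    rw [jac, partialDeriv_eq_zero h0 0 x hx0, partialDeriv_eq_zero h0 1 x hx0]
    ring
  · have := norm_sq_mul_cross (fun j => partialDeriv j (circleMean f))
      (fun j => partialDeriv j (circleMean φ)) x
    rw [ang_circleMean hf, ang_circleMean hφ.1] at this
    have hx2 : ‖x‖ ^ 2 ≠ 0 := by simpa using hx
    simpa [hx, jac] using this

theorem jac_sub_left {f g φ : Plane → ℝ} (hf : ContDiff ℝ ∞ f) (hg : ContDiff ℝ ∞ g) (x : Plane) :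
    jac (fun y => f y - g y) φ x = jac f φ x - jac g φ x := by
  simp only [jac, partialDeriv_sub hf hg]; ring

theorem jac_sub_right {f φ ψ : Plane → ℝ} (hφ : ContDiff ℝ ∞ φ) (hψ : ContDiff ℝ ∞ ψ) (x : Plane) :
    jac f (fun y => φ y - ψ y) x = jac f φ x - jac f ψ x := by
  simp only [jac, partialDeriv_sub hφ hψ]; ring

theorem IsPuncturedTest.jac {f φ : Plane → ℝ} (hf : ContDiff ℝ ∞ f) (hφ : IsPuncturedTest φ) :
    IsPuncturedTest (jac f φ) :=
  ((hφ.partialDeriv 1).smooth_mul (contDiff_partialDeriv hf 0)).sub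
    ((hφ.partialDeriv 0).smooth_mul (contDiff_partialDeriv hf 1))

/-- The null Lagrangian `∫ h det(∇f, ∇φ)` in terms of the gradient of `h`, with all undifferentiated
factors free of their circle means. -/
theorem PuncturedWeakGrad.integral_jac (hp : PuncturedWeakGrad h p c) {f φ : Plane → ℝ}
    (hf : ContDiff ℝ ∞ f) (hφ : IsPuncturedTest φ) :
    ∫ x, h x * jac f φ x ∂discMeasure =
      -∫ x, (f x - circleMean f x) * crossGrad p φ x ∂discMeasure +
        ∫ x, (φ x - circleMean φ x) * crossGrad p (circleMean f) x ∂discMeasure := by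
  have hf0 := contDiff_circleMean hf
  have hφ0 := hφ.circleMean
  -- With bars for circle means, jac(f, φ) = jac(f - f̄, φ) + jac(f̄, φ - φ̄), since jac(f̄, φ̄) =
  -- 0; each summand is integrated by parts so that its mean-free factor loses the derivative.
  rw [← hp.integral_jac_left (hf.sub hf0) hφ, ← hp.integral_jac_right hf0 (hφ.sub hφ0),
    ← integral_add]
  · refine integral_congr_ae (Eventually.of_forall fun x => ?_)
    simp only
    rw [jac_sub_left hf hf0, jac_sub_right hφ.1 hφ0.1, jac_circleMean_circleMean hf hφ]
    ring
  · exact hp.locBdd.integrable_mul_test (IsPuncturedTest.jac (hf.sub hf0) hφ)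
  · exact hp.locBdd.integrable_mul_test (IsPuncturedTest.jac hf0 (hφ.sub hφ0))

theorem circleMean_div_norm (f : Plane → ℝ) (x : Plane) :
    circleMean (fun y => f y / ‖y‖) x = circleMean f x / ‖x‖ := by
  simp only [circleMean, (rot _).norm_map]
  rw [intervalIntegral.integral_div, mul_div_assoc]

/-- The gradient of a circle mean is purely radial, and its radial component is the mean of the
radial derivative. -/
theorem abs_partialDeriv_circleMean_le {f : Plane → ℝ} (hf : ContDiff ℝ ∞ f) {x : Plane}
    (hx : x ≠ 0) (j : Fin 2) : |partialDeriv j (circleMean f) x| ≤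
      |circleMean (fun y => radl (fun j => partialDeriv j f) y / ‖y‖) x| := by
  rw [circleMean_div_norm, ← radl_circleMean hf]
  have h1 := ang_circleMean hf x
  have hx' : 0 < ‖x‖ := norm_pos_iff.2 hx
  rw [abs_div, abs_norm, le_div_iff₀ hx', ← abs_norm x, ← abs_mul, ← sq_le_sq]
  have : (‖x‖ ^ 2) * (partialDeriv 0 (circleMean f) x ^ 2 + partialDeriv 1 (circleMean f) x ^ 2) =
      radl (fun j => partialDeriv j (circleMean f)) x ^ 2 +
        ang (fun j => partialDeriv j (circleMean f)) x ^ 2 := by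
    rw [norm_sq_eq, radl, ang]; ring
  rw [h1] at this
  fin_cases j
  · simp only [Fin.zero_eta, mul_pow]
    nlinarith [mul_nonneg (sq_nonneg ‖x‖) (sq_nonneg (partialDeriv 1 (circleMean f) x))]
  · simp only [Fin.mk_one, mul_pow]
    nlinarith [mul_nonneg (sq_nonneg ‖x‖) (sq_nonneg (partialDeriv 0 (circleMean f) x))]

theorem nrm_circleMean_le {f : Plane → ℝ} (hf : MemLp f 2 discMeasure) :
    nrm (circleMean f) ≤ nrm f :=
  ENNReal.toReal_mono hf.2.ne (eLpNorm_circleMean_le hf.1)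

theorem nrm_partialDeriv_circleMean_le {f : Plane → ℝ} (hf : ContDiff ℝ ∞ f) (j : Fin 2) :
    nrm (partialDeriv j (circleMean f)) ≤ nrm (fun x => radl (fun j => partialDeriv j f) x / ‖x‖) := by
  have hm : MemLp (fun x => radl (fun j => partialDeriv j f) x / ‖x‖) 2 discMeasure :=
    memLp_radl_div fun j => memLp_of_continuous (contDiff_partialDeriv hf j).continuous 2
  refine (nrm_mono (memLp_circleMean hm) ?_).trans (nrm_circleMean_le hm)
  filter_upwards [ae_ne_zero] with x hx
  exact abs_partialDeriv_circleMean_le hf hx j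

theorem nrm_abs (f : Plane → ℝ) : nrm (fun x => |f x|) = nrm f := by
  rw [nrm, nrm, eLpNorm_congr_norm_ae (f := fun x => |f x|) (g := f) (by simp)]

theorem nrm_radl_div_le {g : Fin 2 → Plane → ℝ} (hg : ∀ j, MemLp (g j) 2 discMeasure) :
    nrm (fun x => radl g x / ‖x‖) ≤ nrm (g 0) + nrm (g 1) := by
  have a0 : MemLp (fun x => |g 0 x|) 2 discMeasure := (hg 0).abs
  have a1 : MemLp (fun x => |g 1 x|) 2 discMeasure := (hg 1).abs
  have h2 : nrm (fun x => radl g x / ‖x‖) ≤ nrm (fun x => |g 0 x| + |g 1 x|) :=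
    nrm_mono (a0.add a1) (Eventually.of_forall fun x => by
      rw [abs_of_nonneg (a := |g 0 x| + |g 1 x|) (by positivity)]; exact abs_radl_div_le g x)
  refine h2.trans ((nrm_add_le a0 a1).trans (le_of_eq ?_))
  rw [nrm_abs, nrm_abs]

/-- The size of the gradient of `f` in `L²(B)`. -/
noncomputable def gradSize (g : Fin 2 → Plane → ℝ) : ℝ := nrm (g 0) + nrm (g 1)

/-- The factor |x| freed by dividing the oscillation by |x| is spent on the gradient p, of which
only |x||p| is controlled. -/
theorem PuncturedWeakGrad.abs_integral_osc_le (hp : PuncturedWeakGrad h p c) {f φ : Plane → ℝ}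
    (hf : MemLp (osc f) 2 discMeasure) (hφ : ContDiff ℝ ∞ φ) :
    |∫ x, (f x - circleMean f x) * crossGrad p φ x ∂discMeasure| ≤
      c * (nrm (osc f) * gradSize fun j => partialDeriv j φ) := by
  have a0 : MemLp (fun x => |partialDeriv 0 φ x|) 2 discMeasure :=
    (memLp_of_continuous (contDiff_partialDeriv hφ 0).continuous 2).abs
  have a1 : MemLp (fun x => |partialDeriv 1 φ x|) 2 discMeasure :=
    (memLp_of_continuous (contDiff_partialDeriv hφ 1).continuous 2).abs
  refine (abs_integral_le_of_abs_le (g := fun x => |partialDeriv 0 φ x| + |partialDeriv 1 φ x|)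
    hp.nonneg hf (a0.add a1) ?_).trans ?_
  · filter_upwards [hp.bound, ae_ne_zero] with x hx hx0
    have hx' : 0 < ‖x‖ := norm_pos_iff.2 hx0
    have e : f x - circleMean f x = osc f x * ‖x‖ := by rw [osc, div_mul_cancel₀ _ hx'.ne']
    rw [e, abs_of_nonneg (a := |partialDeriv 0 φ x| + |partialDeriv 1 φ x|) (by positivity),
      mul_assoc, abs_mul, mul_left_comm]
    refine mul_le_mul_of_nonneg_left ?_ (abs_nonneg _)
    rw [crossGrad, abs_mul, abs_norm]
    calc ‖x‖ * |p 0 x * partialDeriv 1 φ x - p 1 x * partialDeriv 0 φ x|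
        ≤ ‖x‖ * (|p 0 x * partialDeriv 1 φ x| + |p 1 x * partialDeriv 0 φ x|) :=
          mul_le_mul_of_nonneg_left (abs_sub _ _) hx'.le
      _ = (|p 0 x| * ‖x‖) * |partialDeriv 1 φ x| + (|p 1 x| * ‖x‖) * |partialDeriv 0 φ x| := by
          rw [abs_mul, abs_mul]; ring
      _ ≤ c * |partialDeriv 1 φ x| + c * |partialDeriv 0 φ x| :=
          add_le_add (mul_le_mul_of_nonneg_right (hx 0) (abs_nonneg _))
            (mul_le_mul_of_nonneg_right (hx 1) (abs_nonneg _))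
      _ = _ := by ring
  · refine mul_le_mul_of_nonneg_left (mul_le_mul_of_nonneg_left ?_ (nrm_nonneg _)) hp.nonneg
    refine (nrm_add_le a0 a1).trans (le_of_eq ?_)
    rw [nrm_abs, nrm_abs, gradSize]

/-- The central estimate: h enters only through its weighted gradient bound c, never through its
size. The constant is 1 + 2, from the two summands of `integral_jac`. -/
theorem PuncturedWeakGrad.abs_integral_jac_le (hp : PuncturedWeakGrad h p c) {f φ : Plane → ℝ}
    (hf : ContDiff ℝ ∞ f) (hφ : IsPuncturedTest φ) :
    |∫ x, h x * jac f φ x ∂discMeasure| ≤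
      3 * c * ((gradSize fun j => partialDeriv j f) * gradSize fun j => partialDeriv j φ) := by
  have hf1 := IsH1Limit.const hf
  have hφ1 := IsH1Limit.const hφ.1
  have hc := hp.nonneg
  rw [hp.integral_jac hf hφ]
  have b1 := hp.abs_integral_osc_le hf1.memLp_osc hφ.1
  have b2 := hp.abs_integral_osc_le hφ1.memLp_osc (contDiff_circleMean hf)
  have w1 := hf1.nrm_osc_le
  have w2 := hφ1.nrm_osc_le
  -- Each of the two partial derivatives of the mean is bounded by the norm of the whole radial
  -- derivative, hence the factor 2.
  have g0 : (gradSize fun j => partialDeriv j (circleMean f)) ≤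
      2 * gradSize fun j => partialDeriv j f := by
    have := nrm_radl_div_le hf1.memLp_grad
    have h0 := nrm_partialDeriv_circleMean_le hf 0
    have h1 := nrm_partialDeriv_circleMean_le hf 1
    simp only [gradSize] at *
    linarith
  have p0 : 0 ≤ gradSize fun j => partialDeriv j f := add_nonneg (nrm_nonneg _) (nrm_nonneg _)
  have p1 : 0 ≤ gradSize fun j => partialDeriv j φ := add_nonneg (nrm_nonneg _) (nrm_nonneg _)
  have p2 := nrm_nonneg (osc φ)
  have p3 : 0 ≤ gradSize fun j => partialDeriv j (circleMean f) :=
    add_nonneg (nrm_nonneg _) (nrm_nonneg _)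
  change nrm (osc f) ≤ gradSize fun j => partialDeriv j f at w1
  change nrm (osc φ) ≤ gradSize fun j => partialDeriv j φ at w2
  generalize (gradSize fun j => partialDeriv j f) = G at *
  generalize (gradSize fun j => partialDeriv j φ) = H at *
  have c1 : c * (nrm (osc f) * H) ≤ c * (G * H) := by gcongr
  have c2 : c * (nrm (osc φ) * gradSize fun j => partialDeriv j (circleMean f)) ≤
      c * (H * (2 * G)) := by gcongr
  calc _ ≤ _ := abs_add_le _ _
    _ ≤ c * (G * H) + c * (H * (2 * G)) := by
      rw [abs_neg]; exact add_le_add (b1.trans c1) (b2.trans c2)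
    _ = _ := by ring

/-- The bilinear form `∫ h det(g, ∇φ)`. -/
noncomputable def jacForm (h : Plane → ℝ) (g : Fin 2 → Plane → ℝ) (φ : Plane → ℝ) : ℝ :=
  ∫ x, h x * (g 0 x * partialDeriv 1 φ x - g 1 x * partialDeriv 0 φ x) ∂discMeasure

theorem LocBdd.memLp_mul_partialDeriv (hh : LocBdd h) {φ : Plane → ℝ} (hφ : IsPuncturedTest φ)
    (j : Fin 2) : MemLp (fun x => h x * partialDeriv j φ x) 2 discMeasure := by
  obtain ⟨hs, a, b, ha, hb, h0⟩ := hφ.partialDeriv j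
  exact hh.memLp_mul ha hb (memLp_of_continuous hs.continuous 2) h0

theorem jacForm_eq (hh : LocBdd h) {g : Fin 2 → Plane → ℝ} (hg : ∀ j, MemLp (g j) 2 discMeasure)
    {φ : Plane → ℝ} (hφ : IsPuncturedTest φ) :
    jacForm h g φ = ∫ x, (h x * partialDeriv 1 φ x) * g 0 x ∂discMeasure -
      ∫ x, (h x * partialDeriv 0 φ x) * g 1 x ∂discMeasure := by
  rw [← integral_sub (integrable_mul_of_memLp (hh.memLp_mul_partialDeriv hφ 1) (hg 0))
    (integrable_mul_of_memLp (hh.memLp_mul_partialDeriv hφ 0) (hg 1)), jacForm]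
  refine integral_congr_ae (Eventually.of_forall fun x => ?_)
  ring

/-- For a fixed punctured test function, h ∇φ lies in L² because h is bounded on the annulus
carrying φ; L² convergence of the gradients then suffices. -/
theorem tendsto_jacForm (hh : LocBdd h) {w : ℕ → Plane → ℝ} {f : Plane → ℝ}
    {g : Fin 2 → Plane → ℝ} (hw : IsH1Limit w f g) {φ : Plane → ℝ} (hφ : IsPuncturedTest φ) :
    Tendsto (fun k => ∫ x, h x * jac (w k) φ x ∂discMeasure) atTop (𝓝 (jacForm h g φ)) := by
  have hm : ∀ j k, MemLp (partialDeriv j (w k)) 2 discMeasure := fun j k =>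
    memLp_of_continuous (contDiff_partialDeriv (hw.smooth k) j).continuous 2
  rw [jacForm_eq hh hw.memLp_grad hφ]
  have e : ∀ k, ∫ x, h x * jac (w k) φ x ∂discMeasure =
      jacForm h (fun j => partialDeriv j (w k)) φ := fun k => rfl
  simp_rw [e, fun k => jacForm_eq hh (fun j => hm j k) hφ]
  exact ((hw.tendsto_grad 0).integral_mul (hm 0) (hw.memLp_grad 0)
    (hh.memLp_mul_partialDeriv hφ 1)).sub ((hw.tendsto_grad 1).integral_mul (hm 1)
    (hw.memLp_grad 1) (hh.memLp_mul_partialDeriv hφ 0))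

theorem PuncturedWeakGrad.abs_jacForm_le (hp : PuncturedWeakGrad h p c) {w : ℕ → Plane → ℝ}
    {f : Plane → ℝ} {g : Fin 2 → Plane → ℝ} (hw : IsH1Limit w f g) {φ : Plane → ℝ}
    (hφ : IsPuncturedTest φ) :
    |jacForm h g φ| ≤ 3 * c * (gradSize g * gradSize fun j => partialDeriv j φ) := by
  have hm : ∀ j k, MemLp (partialDeriv j (w k)) 2 discMeasure := fun j k =>
    memLp_of_continuous (contDiff_partialDeriv (hw.smooth k) j).continuous 2
  have t1 := (tendsto_jacForm hp.locBdd hw hφ).abs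
  have t2 := (((((hw.tendsto_grad 0).nrm (hm 0) (hw.memLp_grad 0)).add
    ((hw.tendsto_grad 1).nrm (hm 1) (hw.memLp_grad 1))).mul_const
    (gradSize fun j => partialDeriv j φ)).const_mul (3 * c))
  exact le_of_tendsto_of_tendsto' t1 t2 fun k => hp.abs_integral_jac_le (hw.smooth k) hφ

end HFU

/-! ### Integration by parts and mollification on annuli -/

namespace HFU

theorem continuous_isTest_integrable {φ f : Plane → ℝ} (hφ : IsTest φ) (hf : Continuous f) :
    Integrable (fun x => f x * φ x) :=
  (hf.mul hφ.1.continuous).integrable_of_hasCompactSupport hφ.2.1.mul_left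

theorem integral_discMeasure_eq {f : Plane → ℝ} (h : ∀ x, x ∉ disc → f x = 0) :
    ∫ x, f x ∂discMeasure = ∫ x, f x :=
  setIntegral_eq_integral_of_forall_compl_eq_zero h

theorem IsTest.eq_zero {φ : Plane → ℝ} (hφ : IsTest φ) {x : Plane} (hx : x ∉ disc) : φ x = 0 :=
  image_eq_zero_of_notMem_tsupport fun h => hx (hφ.2.2 h)

theorem IsTest.pderiv {φ : Plane → ℝ} (hφ : IsTest φ) (j : Fin 2) :
    IsTest (partialDeriv j φ) := by
  have h : tsupport (partialDeriv j φ) ⊆ tsupport φ :=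
    tsupport_fderiv_apply_subset ℝ _
  exact ⟨contDiff_partialDeriv hφ.1 j, hφ.2.1.of_isClosed_subset (isClosed_tsupport _) h,
    h.trans hφ.2.2⟩

theorem integral_mul_partialDeriv {f φ : Plane → ℝ} (hf : ContDiff ℝ ∞ f) (hφ : IsTest φ)
    (j : Fin 2) : ∫ x, f x * partialDeriv j φ x ∂discMeasure =
      -∫ x, partialDeriv j f x * φ x ∂discMeasure := by
  rw [integral_discMeasure_eq fun x hx => by rw [(hφ.pderiv j).eq_zero hx, mul_zero],
    integral_discMeasure_eq fun x hx => by rw [hφ.eq_zero hx, mul_zero]]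
  exact integral_mul_fderiv_eq_neg_fderiv_mul_of_integrable
    (continuous_isTest_integrable hφ (contDiff_partialDeriv hf j).continuous)
    (continuous_isTest_integrable (hφ.pderiv j) hf.continuous)
    (continuous_isTest_integrable hφ hf.continuous)
    (fun x _ => hf.differentiable (by simp) x) (fun x _ => hφ.1.differentiable (by simp) x)

/-- A sequence of bump functions shrinking to the origin. -/
noncomputable def bump (δ : ℝ) (hδ : 0 < δ) (n : ℕ) : ContDiffBump (0 : Plane) where
  -- The ratio of the radii stays equal to 2, a bound needed for almost everywhere convergence of
  -- the mollifications.
  rIn := δ / (2 * (n + 1))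
  rOut := δ / (n + 1)
  rIn_pos := by positivity
  rIn_lt_rOut := by
    rw [div_lt_div_iff₀ (by positivity) (by positivity)]
    nlinarith [mul_pos hδ (by positivity : (0 : ℝ) < n + 1)]

-- The function is cut off to a larger annulus and mollified with kernels too narrow to notice the
-- cut. Differentiating the kernel and integrating by parts then gives the mollification of p, so
-- the sup bound of p on the larger annulus bounds all gradients uniformly.
open ContinuousLinearMap in
theorem exists_mollification {h : Plane → ℝ} {p : Fin 2 → Plane → ℝ}
    (hh : LocallyIntegrableOn h disc) (hp : ∀ j, LocBdd (p j))
    (ibp : ∀ φ : Plane → ℝ, IsPuncturedTest φ → ∀ j,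
      ∫ x, h x * partialDeriv j φ x ∂discMeasure = -∫ x, p j x * φ x ∂discMeasure)
    {a b : ℝ} (ha : 0 < a) (hb : b < 1) :
    ∃ hs : ℕ → Plane → ℝ, (∀ n, ContDiff ℝ ∞ (hs n)) ∧
      (∀ᵐ x ∂discMeasure, x ∈ annulus a b → Tendsto (fun n => hs n x) atTop (𝓝 (h x))) ∧
      (∀ j, ∀ᵐ x ∂discMeasure, x ∈ annulus a b →
        Tendsto (fun n => partialDeriv j (hs n) x) atTop (𝓝 (p j x))) ∧
      ∃ L, ∀ n j, ∀ x ∈ annulus a b, |partialDeriv j (hs n) x| ≤ L := by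
  -- The δ-neighbourhood of the annulus must stay within radii a/2 and (1 + b)/2, still inside the
  -- punctured disc.
  obtain ⟨δ, hδ, hδa, hδb⟩ : ∃ δ > 0, δ ≤ a / 2 ∧ δ ≤ (1 - b) / 2 :=
    ⟨min (a / 2) ((1 - b) / 2), lt_min (by linarith) (by linarith), min_le_left _ _,
      min_le_right _ _⟩
  set K : Set Plane := annulus (a / 2) ((1 + b) / 2) with hK
  have hKd : K ⊆ disc := fun x hx => by
    rw [disc, mem_ball_zero_iff]; exact hx.2.trans_lt (by linarith)
  have hKm : MeasurableSet K := (isClosed_annulus _ _).measurableSet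
  have hKc : IsCompact K := isCompact_annulus _ _
  have hnear : ∀ x ∈ annulus a b, ∀ y, ‖x - y‖ ≤ δ → y ∈ K := fun x hx y hy => by
    have h1 := norm_sub_norm_le x y
    have h2 := norm_sub_norm_le y x
    rw [norm_sub_rev] at h2
    exact ⟨by linarith [hx.1], by linarith [hx.2]⟩
  choose C hC using fun j => (hp j).bdd (a / 2) ((1 + b) / 2) (by linarith) (by linarith)
  have hpb : ∀ j, ∀ᵐ x, |K.indicator (p j) x| ≤ max (C j) 0 := fun j => by
    have h1 := (ae_restrict_iff' (s := disc) Metric.isOpen_ball.measurableSet).1 (hC j)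
    filter_upwards [h1] with x hx
    by_cases hxK : x ∈ K
    · rw [indicator_of_mem hxK]; exact (hx (hKd hxK) hxK).trans (le_max_left _ _)
    · rw [indicator_of_notMem hxK, abs_zero]; exact le_max_right _ _
  have hHi : Integrable (K.indicator h) := by
    rw [integrable_indicator_iff hKm]
    exact hh.integrableOn_compact_subset hKd hKc
  have hpK : ∀ j, AEStronglyMeasurable (K.indicator (p j)) := fun j => by
    rw [aestronglyMeasurable_indicator_iff hKm]
    have := (hp j).meas.mono_measure (Measure.restrict_mono hKd le_rfl :
      volume.restrict K ≤ discMeasure)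
    exact this
  have hPi : ∀ j, Integrable (K.indicator (p j)) := fun j => by
    rw [integrable_indicator_iff hKm]
    refine IntegrableOn.of_bound hKc.measure_lt_top
      ((aestronglyMeasurable_indicator_iff hKm).1 (hpK j)) (max (C j) 0) ?_
    · rw [ae_restrict_iff' hKm]
      filter_upwards [hpb j] with x hx hxK
      rwa [indicator_of_mem hxK] at hx
  set ρ : ℕ → ContDiffBump (0 : Plane) := bump δ hδ with hρ
  have hρout : ∀ n, (ρ n).rOut ≤ δ := fun n => by
    change δ / (n + 1) ≤ δ
    exact div_le_self hδ.le (by linarith [n.cast_nonneg (α := ℝ)])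
  have hρt : Tendsto (fun n => (ρ n).rOut) atTop (𝓝 0) := by
    have := (tendsto_one_div_add_atTop_nhds_zero_nat (𝕜 := ℝ)).const_mul δ
    rw [mul_zero] at this
    refine this.congr fun n => ?_
    change δ * (1 / (n + 1)) = δ / (n + 1)
    ring
  have hρK : ∀ᶠ n in atTop, (ρ n).rOut ≤ 2 * (ρ n).rIn := Eventually.of_forall fun n => by
    change δ / (n + 1) ≤ 2 * (δ / (2 * (n + 1)))
    apply le_of_eq
    field_simp
  have hρs : ∀ n, ContDiff ℝ ∞ ((ρ n).normed volume) := fun n => (ρ n).contDiff_normed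
  set hs : ℕ → Plane → ℝ := fun n =>
    MeasureTheory.convolution ((ρ n).normed volume) (K.indicator h) (lsmul ℝ ℝ) volume with hhs
  have hder : ∀ n j, ∀ x ∈ annulus a b, partialDeriv j (hs n) x =
      MeasureTheory.convolution ((ρ n).normed volume) (K.indicator (p j)) (lsmul ℝ ℝ) volume x := by
    intro n j x hx
    have h1 := ((ρ n).hasCompactSupport_normed (μ := volume)).hasFDerivAt_convolution_left
      (lsmul ℝ ℝ) ((hρs n).of_le (by simp)) hHi.locallyIntegrable x
    have h2 : partialDeriv j (hs n) x =
        ∫ y, partialDeriv j ((ρ n).normed volume) (x - y) * K.indicator h y := by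
      rw [partialDeriv, h1.fderiv, convolution_eq_swap]
      have h3 := (((ρ n).hasCompactSupport_normed (μ := volume)).fderiv ℝ).convolutionExists_left
        ((lsmul ℝ ℝ).precompL Plane) ((hρs n).continuous_fderiv (by simp))
        hHi.locallyIntegrable x
      rw [ContinuousLinearMap.integral_apply h3.integrable_swap]
      rfl
    have hx0 : ∀ y ∉ K, partialDeriv j ((ρ n).normed volume) (x - y) = 0 := fun y hy => by
      have h0 : x - y ∉ tsupport ((ρ n).normed volume) := fun hn => hy (hnear x hx y (by
        rw [(ρ n).tsupport_normed_eq] at hn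
        simpa using (mem_closedBall_zero_iff.1 hn).trans (hρout n)))
      have h5 : fderiv ℝ ((ρ n).normed volume) (x - y) = 0 := by
        by_contra hn
        exact h0 (support_fderiv_subset ℝ hn)
      rw [partialDeriv, h5]
      rfl
    have hx1 : ∀ y ∉ K, (ρ n).normed volume (x - y) = 0 := fun y hy =>
      image_eq_zero_of_notMem_tsupport fun hn => hy (hnear x hx y (by
        rw [(ρ n).tsupport_normed_eq] at hn
        simpa using (mem_closedBall_zero_iff.1 hn).trans (hρout n)))
    have htest : IsPuncturedTest fun y => (ρ n).normed volume (x - y) :=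
      ⟨(hρs n).comp (contDiff_const.sub contDiff_id), a / 2, (1 + b) / 2, by linarith, by linarith,
        hx1⟩
    have hd : ∀ y, partialDeriv j (fun y => (ρ n).normed volume (x - y)) y =
        -partialDeriv j ((ρ n).normed volume) (x - y) := fun y => by
      have h5 : HasFDerivAt (fun y => (ρ n).normed volume (x - y))
          ((fderiv ℝ ((ρ n).normed volume) (x - y)).comp (-ContinuousLinearMap.id ℝ Plane)) y :=
        ((hρs n).differentiable (by simp) (x - y)).hasFDerivAt.comp y
          ((hasFDerivAt_id y).const_sub x)
      rw [partialDeriv, h5.fderiv]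
      simp [partialDeriv]
    -- For x in the inner annulus the reflected kernel y ↦ ρ(x - y) is itself an admissible
    -- punctured test function.
    have h4 := ibp _ htest j
    rw [integral_discMeasure_eq fun y hy => ?_, integral_discMeasure_eq fun y hy => ?_] at h4
    · rw [h2, convolution_eq_swap]
      trans -∫ y, h y * partialDeriv j (fun y => (ρ n).normed volume (x - y)) y
      · rw [← integral_neg]
        refine integral_congr_ae (Eventually.of_forall fun y => ?_)
        simp only [hd]
        by_cases hy : y ∈ K
        · rw [indicator_of_mem hy]; ring
        · rw [hx0 y hy]; ring
      · rw [h4, neg_neg]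
        refine integral_congr_ae (Eventually.of_forall fun y => ?_)
        simp only [lsmul_apply, smul_eq_mul]
        by_cases hy : y ∈ K
        · rw [indicator_of_mem hy]; ring
        · rw [hx1 y hy]; ring
    · rw [hx1 y fun hn => hy (hKd hn), mul_zero]
    · rw [hd, hx0 y fun hn => hy (hKd hn)]; ring
  refine ⟨hs, fun n => ?_, ?_, fun j => ?_, max (max (C 0) 0) (max (C 1) 0), fun n j x hx => ?_⟩
  · exact ((ρ n).hasCompactSupport_normed).contDiff_convolution_left _ (hρs n)
      hHi.locallyIntegrable
  · have := ContDiffBump.ae_convolution_tendsto_right_of_locallyIntegrable hρt hρK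
      hHi.locallyIntegrable
    filter_upwards [ae_restrict_of_ae this] with x hx hxa
    rw [indicator_of_mem (hnear x hxa x (by simp [hδ.le]))] at hx
    exact hx
  · have := ContDiffBump.ae_convolution_tendsto_right_of_locallyIntegrable hρt hρK
      (hPi j).locallyIntegrable
    filter_upwards [ae_restrict_of_ae this] with x hx hxa
    rw [indicator_of_mem (hnear x hxa x (by simp [hδ.le]))] at hx
    refine hx.congr fun n => ?_
    exact (hder n j x hxa).symm
  · rw [hder n j x hx, convolution_eq_swap]
    have hC' : max (C j) 0 ≤ max (max (C 0) 0) (max (C 1) 0) := by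
      fin_cases j
      · exact le_max_left _ _
      · exact le_max_right _ _
    refine le_trans ?_ hC'
    have h1 : Integrable fun y => (ρ n).normed volume (x - y) :=
      ((ρ n).integrable_normed (μ := volume)).comp_sub_left x
    have h2 := norm_integral_le_of_norm_le (h1.mul_const (max (C j) 0))
      (f := fun y => (ρ n).normed volume (x - y) • K.indicator (p j) y) (by
      filter_upwards [hpb j] with y hy
      rw [norm_smul, Real.norm_of_nonneg ((ρ n).nonneg_normed _)]
      exact mul_le_mul_of_nonneg_left hy ((ρ n).nonneg_normed _))
    rw [integral_mul_const, integral_sub_left_eq_self (fun y => (ρ n).normed volume y),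
      (ρ n).integral_normed, one_mul] at h2
    exact h2

end HFU

/-! ### Local boundedness of the pressure and its truncation -/

namespace HFU

theorem abs_fderiv_le {f : Plane → ℝ} {L : ℝ} {x : Plane} (h : ∀ j, |partialDeriv j f x| ≤ L)
    (v : Plane) : |fderiv ℝ f x v| ≤ 2 * L * ‖v‖ := by
  rw [fderiv_eq_partialDeriv]
  refine (abs_add_le _ _).trans ?_
  rw [abs_mul, abs_mul]
  have h0 := mul_le_mul (abs_coord_le v 0) (h 0) (abs_nonneg _) (norm_nonneg _)
  have h1 := mul_le_mul (abs_coord_le v 1) (h 1) (abs_nonneg _) (norm_nonneg _)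
  linarith

/-- An annulus is not convex, so the two points are joined by an arc of a circle, with angle at most
2π, followed by a radial segment of length at most 1. The derivative along either piece is at most
2L. -/
theorem abs_sub_le_of_partialDeriv_le {f : Plane → ℝ} (hf : ContDiff ℝ ∞ f) {a b L : ℝ}
    (ha : 0 < a) (hb : b < 1) (hL : ∀ j, ∀ x ∈ annulus a b, |partialDeriv j f x| ≤ L)
    {x y : Plane} (hx : x ∈ annulus a b) (hy : y ∈ annulus a b) :
    |f x - f y| ≤ 2 * L * (2 * Real.pi + 1) := by
  have hpi := Real.pi_pos
  have hL0 : 0 ≤ L := (abs_nonneg _).trans (hL 0 x hx)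
  have hrep : ∀ z : Plane, z = polarPoint ‖z‖ (polarAngle z) ∧ |polarAngle z| ≤ Real.pi := by
    intro z
    refine ⟨?_, Complex.abs_arg_le_pi _⟩
    have h : ‖(⟨z 0, z 1⟩ : ℂ)‖ = ‖z‖ := by
      rw [← sq_eq_sq₀ (norm_nonneg _) (norm_nonneg _), norm_sq_eq, Complex.sq_norm,
        Complex.normSq_mk]; ring
    apply plane_ext
    · rw [polarPoint_zero, polarAngle, ← h, Complex.norm_mul_cos_arg]
    · rw [polarPoint_one, polarAngle, ← h, Complex.norm_mul_sin_arg]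
  obtain ⟨hxr, hxa⟩ := hrep x
  obtain ⟨hyr, hya⟩ := hrep y
  set s := polarAngle x
  set t := polarAngle y
  have hmem : ∀ R ∈ Icc a b, ∀ r, polarPoint R r ∈ annulus a b := fun R hR r => by
    simpa [annulus, norm_polarPoint (ha.le.trans hR.1)] using hR
  have hxR : ‖x‖ ∈ Icc a b := hx
  have hyR : ‖y‖ ∈ Icc a b := hy
  have h1 : |f (polarPoint ‖x‖ s) - f (polarPoint ‖x‖ t)| ≤ 2 * L * (2 * Real.pi) := by
    have := Convex.norm_image_sub_le_of_norm_hasDerivWithin_le (s := univ) (C := 2 * L)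
      (fun r _ => (hasDerivAt_comp_polarPoint hf ‖x‖ r).hasDerivWithinAt) (fun r _ => ?_)
      convex_univ (mem_univ t) (mem_univ s)
    · refine this.trans (mul_le_mul_of_nonneg_left ?_ (by positivity))
      rw [Real.norm_eq_abs]
      exact (abs_sub _ _).trans (by linarith)
    · rw [Real.norm_eq_abs, ang]
      have hz := hmem _ hxR r
      have hz1 : ‖polarPoint ‖x‖ r‖ ≤ 1 := hz.2.trans hb.le
      refine (abs_sub _ _).trans ?_
      rw [abs_mul, abs_mul]
      have c0 := mul_le_mul ((abs_coord_le _ 0).trans hz1) (hL 1 _ hz) (abs_nonneg _) zero_le_one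
      have c1 := mul_le_mul ((abs_coord_le _ 1).trans hz1) (hL 0 _ hz) (abs_nonneg _) zero_le_one
      linarith
  have h2 : |f (polarPoint ‖x‖ t) - f (polarPoint ‖y‖ t)| ≤ 2 * L * 1 := by
    have hd : ∀ R, HasDerivAt (fun R => f (polarPoint R t)) (fderiv ℝ f (polarPoint R t)
        (polarPoint 1 t)) R := by
      intro R
      have hp : HasDerivAt (fun R => polarPoint R t) (polarPoint 1 t) R := by
        have h : (fun R => polarPoint R t) = fun R => R • polarPoint 1 t := by
          funext R
          apply plane_ext
          · simp [polarPoint_zero]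
          · simp [polarPoint_one]
        rw [h]
        simpa using (hasDerivAt_id R).smul_const (polarPoint 1 t)
      exact (hf.differentiable (by simp) (polarPoint R t)).hasFDerivAt.comp_hasDerivAt R hp
    have := Convex.norm_image_sub_le_of_norm_hasDerivWithin_le (s := Icc a b) (C := 2 * L)
      (fun r _ => (hd r).hasDerivWithinAt) (fun r hr => ?_) (convex_Icc a b) hyR hxR
    · refine this.trans (mul_le_mul_of_nonneg_left ?_ (by positivity))
      rw [Real.norm_eq_abs, abs_le]
      constructor <;> linarith [hxR.1, hxR.2, hyR.1, hyR.2]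
    · have := abs_fderiv_le (fun j => hL j _ (hmem r hr t)) (polarPoint 1 t)
      rwa [norm_polarPoint zero_le_one, mul_one] at this
  have h3 : |f x - f y| ≤ |f (polarPoint ‖x‖ s) - f (polarPoint ‖x‖ t)| +
      |f (polarPoint ‖x‖ t) - f (polarPoint ‖y‖ t)| := by
    rw [← hxr, ← hyr]
    exact abs_sub_le _ _ _
  linarith

/-- Weakly differentiable functions with `|x| |∇h|` bounded are locally bounded in the punctured
disc. -/
theorem puncturedWeakGrad_of_isWeakPartial {lam : Plane → ℝ} {q : Fin 2 → Plane → ℝ} {c : ℝ}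
    (h : ∀ j, IsWeakPartial j lam (q j)) (hc : ∀ᵐ x ∂discMeasure, ∀ j, |q j x| * ‖x‖ ≤ c) :
    PuncturedWeakGrad lam q c := by
  have hqm : ∀ j, AEStronglyMeasurable (q j) discMeasure := fun j =>
    (h j).2.1.aestronglyMeasurable
  have hq : ∀ j, LocBdd (q j) := fun j =>
    ⟨hqm j, fun a b ha hb => ⟨c / a, by
      filter_upwards [hc] with x hx hxa
      rw [le_div_iff₀ ha]
      exact (mul_le_mul_of_nonneg_left hxa.1 (abs_nonneg _)).trans (hx j)⟩⟩
  have ibp : ∀ φ : Plane → ℝ, IsPuncturedTest φ → ∀ j,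
      ∫ x, lam x * partialDeriv j φ x ∂discMeasure = -∫ x, q j x * φ x ∂discMeasure :=
    fun φ hφ j => (h j).2.2 φ hφ.isTest
  refine ⟨⟨(h 0).1.aestronglyMeasurable, fun a b ha hb => ?_⟩, hqm, hc, ibp⟩
  obtain ⟨hs, hsm, hst, -, L, hL⟩ := exists_mollification (h 0).1 hq ibp ha hb
  -- One reference point of convergence suffices: the oscillation bound is uniform in the
  -- mollification parameter, so it bounds lam - lam y almost everywhere on the annulus.
  by_cases hex : ∃ y ∈ annulus a b, Tendsto (fun n => hs n y) atTop (𝓝 (lam y))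
  · obtain ⟨y, hy, hyt⟩ := hex
    refine ⟨|lam y| + 2 * L * (2 * Real.pi + 1), ?_⟩
    filter_upwards [hst] with x hx hxa
    have h1 := le_of_tendsto ((hx hxa).sub hyt).abs (Eventually.of_forall fun n =>
      abs_sub_le_of_partialDeriv_le (hsm n) ha hb (hL n) hxa hy)
    have h2 := abs_sub_abs_le_abs_sub (lam x) (lam y)
    linarith
  -- Convergence holds almost everywhere on the annulus; if it holds nowhere there, the annulus is
  -- null and the bound is vacuous.
  · refine ⟨0, ?_⟩
    filter_upwards [hst] with x hx hxa
    exact absurd ⟨x, hxa, hx hxa⟩ hex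

/-- Chain rule for bounded smooth functions with derivative at most one. -/
theorem PuncturedWeakGrad.comp {h : Plane → ℝ} {p : Fin 2 → Plane → ℝ} {c : ℝ}
    (hp : PuncturedWeakGrad h p c) (hloc : LocallyIntegrableOn h disc) {ψ : ℝ → ℝ}
    (hψ : ContDiff ℝ ∞ ψ) {B : ℝ} (hB : ∀ s, |ψ s| ≤ B) (hd : ∀ s, |deriv ψ s| ≤ 1) :
    PuncturedWeakGrad (fun x => ψ (h x)) (fun j x => deriv ψ (h x) * p j x) c := by
  have hψ' : Continuous (deriv ψ) := hψ.continuous_deriv (by simp)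
  refine ⟨⟨hψ.continuous.comp_aestronglyMeasurable hp.locBdd.meas, fun a b _ _ =>
    ⟨B, Eventually.of_forall fun x _ => hB _⟩⟩, fun j =>
    (hψ'.comp_aestronglyMeasurable hp.locBdd.meas).mul (hp.measurable_grad j), ?_, ?_⟩
  · filter_upwards [hp.bound] with x hx j
    refine le_trans ?_ (hx j)
    rw [abs_mul]
    exact mul_le_mul_of_nonneg_right (mul_le_of_le_one_left (abs_nonneg _) (hd _)) (norm_nonneg _)
  · intro φ hφ j
    obtain ⟨hφs, a, b, ha, hb, h0⟩ := hφ
    have hφ : IsPuncturedTest φ := ⟨hφs, a, b, ha, hb, h0⟩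
    obtain ⟨hs, hsm, hst, hsd, L, hL⟩ := exists_mollification hloc hp.locBdd_grad hp.ibp ha hb
    have hd0 := partialDeriv_eq_zero h0 j
    -- The classical chain rule for the mollifications; both sides then converge by dominated
    -- convergence, the gradients being uniformly bounded on the annulus that carries φ.
    have e : ∀ n, ∫ x, ψ (hs n x) * partialDeriv j φ x ∂discMeasure =
        -∫ x, deriv ψ (hs n x) * partialDeriv j (hs n) x * φ x ∂discMeasure := by
      intro n
      refine (integral_mul_partialDeriv (hψ.comp (hsm n)) hφ.isTest j).trans ?_
      congr 1
      refine integral_congr_ae (Eventually.of_forall fun x => ?_)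
      have h1 := (hψ.differentiable (by simp) (hs n x)).hasDerivAt.comp_hasFDerivAt x
        ((hsm n).differentiable (by simp) x).hasFDerivAt
      simp only
      congr 1
      rw [partialDeriv]
      rw [h1.fderiv]
      rfl
    have t1 : Tendsto (fun n => ∫ x, ψ (hs n x) * partialDeriv j φ x ∂discMeasure) atTop
        (𝓝 (∫ x, ψ (h x) * partialDeriv j φ x ∂discMeasure)) := by
      refine tendsto_integral_of_dominated_convergence (fun x => B * |partialDeriv j φ x|)
        (fun n => (hψ.comp (hsm n)).continuous.aestronglyMeasurable.mul
          (contDiff_partialDeriv hφs j).continuous.aestronglyMeasurable) ?_ (fun n => ?_) ?_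
      · exact (memLp_one_iff_integrable.1
          (memLp_of_continuous (contDiff_partialDeriv hφs j).continuous 1)).abs.const_mul B
      · refine Eventually.of_forall fun x => ?_
        rw [norm_mul]
        exact mul_le_mul_of_nonneg_right (hB _) (abs_nonneg _)
      · filter_upwards [hst] with x hx
        by_cases hxa : x ∈ annulus a b
        · exact ((hψ.continuous.tendsto _).comp (hx hxa)).mul_const _
        · simp [hd0 x hxa]
    have t2 : Tendsto (fun n => ∫ x, deriv ψ (hs n x) * partialDeriv j (hs n) x * φ x ∂discMeasure)
        atTop (𝓝 (∫ x, deriv ψ (h x) * p j x * φ x ∂discMeasure)) := by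
      refine tendsto_integral_of_dominated_convergence (fun x => L * |φ x|)
        (fun n => ((hψ'.comp (hsm n).continuous).aestronglyMeasurable.mul
          (contDiff_partialDeriv (hsm n) j).continuous.aestronglyMeasurable).mul
          hφs.continuous.aestronglyMeasurable) ?_ (fun n => ?_) ?_
      · exact (memLp_one_iff_integrable.1
          (memLp_of_continuous hφs.continuous 1)).abs.const_mul L
      · refine Eventually.of_forall fun x => ?_
        by_cases hxa : x ∈ annulus a b
        · rw [norm_mul, norm_mul]
          exact mul_le_mul_of_nonneg_right ((mul_le_of_le_one_left (norm_nonneg _) (hd _)).trans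
            (hL n j x hxa)) (abs_nonneg _)
        · simp [h0 x hxa]
      · filter_upwards [hst, hsd j] with x hx hx'
        by_cases hxa : x ∈ annulus a b
        · exact (((hψ'.tendsto _).comp (hx hxa)).mul (hx' hxa)).mul_const _
        · simp [h0 x hxa]
    refine tendsto_nhds_unique t1 ?_
    simp_rw [e]
    exact t2.neg

/-- A smooth bounded replacement of the identity. -/
noncomputable def sinTrunc (K : ℕ) (s : ℝ) : ℝ := (K + 1) * Real.sin (s / (K + 1))

theorem contDiff_sinTrunc (K : ℕ) : ContDiff ℝ ∞ (sinTrunc K) := by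
  unfold sinTrunc
  fun_prop

theorem abs_sinTrunc_le (K : ℕ) (s : ℝ) : |sinTrunc K s| ≤ K + 1 := by
  rw [sinTrunc, abs_mul, abs_of_nonneg (by positivity)]
  exact mul_le_of_le_one_right (by positivity) (Real.abs_sin_le_one _)

theorem abs_sinTrunc_le_abs (K : ℕ) (s : ℝ) : |sinTrunc K s| ≤ |s| := by
  have hK : (0 : ℝ) < K + 1 := by positivity
  rw [sinTrunc, abs_mul, abs_of_pos hK]
  have := mul_le_mul_of_nonneg_left (Real.abs_sin_le_abs (x := s / (K + 1))) hK.le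
  rwa [abs_div, abs_of_pos hK, mul_div_cancel₀ _ hK.ne'] at this

/-- The derivative is cos(s/(K + 1)). A bound by 1 keeps the weighted gradient bound c of the
truncated pressure independent of K. -/
theorem abs_deriv_sinTrunc_le (K : ℕ) (s : ℝ) : |deriv (sinTrunc K) s| ≤ 1 := by
  have hK : (0 : ℝ) < K + 1 := by positivity
  have h := (((hasDerivAt_id s).div_const ((K : ℝ) + 1)).sin).const_mul ((K : ℝ) + 1)
  have h' : deriv (sinTrunc K) s = _ := h.deriv
  rw [h']
  simp only [id]
  rw [mul_left_comm, mul_one_div_cancel hK.ne', mul_one]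
  exact Real.abs_cos_le_one _

/-- The truncation is s times sinc(s/(K + 1)), and sinc is continuous with value 1 at 0. -/
theorem tendsto_sinTrunc (s : ℝ) : Tendsto (fun K => sinTrunc K s) atTop (𝓝 s) := by
  have h1 : Tendsto (fun K : ℕ => s / ((K : ℝ) + 1)) atTop (𝓝 0) := by
    have := (tendsto_one_div_add_atTop_nhds_zero_nat (𝕜 := ℝ)).const_mul s
    rw [mul_zero] at this
    exact this.congr fun n => by ring
  have h2 := ((Real.continuous_sinc.tendsto 0).comp h1).const_mul s
  rw [Real.sinc_zero, mul_one] at h2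
  refine h2.congr fun K => ?_
  have hK : (0 : ℝ) < K + 1 := by positivity
  by_cases hs : s = 0
  · simp [hs, sinTrunc]
  · rw [Function.comp_apply, Real.sinc_of_ne_zero (div_ne_zero hs hK.ne'), sinTrunc]
    field_simp

end HFU

/-! ### Logarithmic cutoffs: a point has zero capacity -/

namespace HFU

theorem exists_deriv_smoothTransition_bound :
    ∃ A, 0 ≤ A ∧ ∀ s, |deriv Real.smoothTransition s| ≤ A ∧
      (s < 0 ∨ 1 < s → deriv Real.smoothTransition s = 0) := by
  have hc : Continuous (deriv Real.smoothTransition) :=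
    (Real.smoothTransition.contDiff (n := 1)).continuous_deriv le_rfl
  have h0 : ∀ s, s < 0 ∨ 1 < s → deriv Real.smoothTransition s = 0 := by
    rintro s (hs | hs)
    · have : Real.smoothTransition =ᶠ[𝓝 s] fun _ => 0 := by
        filter_upwards [Iio_mem_nhds hs] with t ht
        exact Real.smoothTransition.zero_of_nonpos (le_of_lt ht)
      rw [this.deriv_eq, deriv_const]
    · have : Real.smoothTransition =ᶠ[𝓝 s] fun _ => 1 := by
        filter_upwards [Ioi_mem_nhds hs] with t ht
        exact Real.smoothTransition.one_of_one_le (le_of_lt ht)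
      rw [this.deriv_eq, deriv_const]
  obtain ⟨A, hA⟩ := (isCompact_Icc (a := (0 : ℝ)) (b := 1)).exists_bound_of_continuousOn
    hc.continuousOn
  refine ⟨max A 0, le_max_right _ _, fun s => ⟨?_, h0 s⟩⟩
  by_cases hs : s ∈ Icc (0 : ℝ) 1
  · exact (hA s hs).trans (le_max_left _ _)
  · rw [h0 s (by rw [mem_Icc, not_and_or, not_le, not_le] at hs; exact hs), abs_zero]
    exact le_max_right _ _

/-- A smooth function vanishing near the origin, equal to one outside a dyadic ball. -/
noncomputable def dyadicCutoff (k : ℕ) (x : Plane) : ℝ :=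
  Real.smoothTransition (4 ^ k * ‖x‖ ^ 2 - 1)

theorem contDiff_dyadicCutoff (k : ℕ) : ContDiff ℝ ∞ (dyadicCutoff k) :=
  Real.smoothTransition.contDiff.comp ((contDiff_const.mul (contDiff_norm_sq ℝ)).sub contDiff_const)

theorem partialDeriv_dyadicCutoff (k : ℕ) (j : Fin 2) (x : Plane) :
    partialDeriv j (dyadicCutoff k) x =
      deriv Real.smoothTransition (4 ^ k * ‖x‖ ^ 2 - 1) * (4 ^ k * (2 * x j)) := by
  have h1 : HasFDerivAt (fun x : Plane => (4 : ℝ) ^ k * ‖x‖ ^ 2 - 1)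
      ((4 : ℝ) ^ k • (2 • innerSL ℝ x)) x :=
    (((hasStrictFDerivAt_norm_sq x).hasFDerivAt).const_mul _).sub_const _
  have h2 := ((Real.smoothTransition.contDiff (n := 1)).differentiable (by simp)
    (4 ^ k * ‖x‖ ^ 2 - 1)).hasDerivAt.comp_hasFDerivAt x h1
  rw [partialDeriv]
  change fderiv ℝ (Real.smoothTransition ∘ fun x : Plane => (4 : ℝ) ^ k * ‖x‖ ^ 2 - 1) x _ = _
  rw [h2.fderiv]
  simp [EuclideanSpace.inner_single_right]

/-- The Dirichlet integral is scale invariant in the plane: the gradient is of order 2^k and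
vanishes outside a ball of area of order 4^(-k). -/
theorem exists_partialDeriv_dyadicCutoff_bound :
    ∃ C, 0 ≤ C ∧ ∀ k j, ∫ x, partialDeriv j (dyadicCutoff k) x ^ 2 ∂discMeasure ≤ C := by
  obtain ⟨A, hA0, hA⟩ := exists_deriv_smoothTransition_bound
  set V := (volume (Metric.ball (0 : Plane) 1)).toReal
  refine ⟨(16 * A ^ 2) * (4 * V), by positivity, fun k j => ?_⟩
  have h4 : (0 : ℝ) < 4 ^ k := by positivity
  -- The gradient vanishes once 4^k |x|² > 2, and that region of possible support lies in the ball
  -- of radius r.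
  set r : ℝ := 2 / 2 ^ k with hr
  have hr2 : r ^ 2 * 4 ^ k = 4 := by
    rw [hr, div_pow, ← pow_mul, mul_comm k 2, pow_mul]; norm_num
  have hr0 : 0 < r := by positivity
  have hle : ∀ x, partialDeriv j (dyadicCutoff k) x ^ 2 ≤
      (Metric.ball (0 : Plane) r).indicator (fun _ => 16 * A ^ 2 * 4 ^ k) x := by
    intro x
    by_cases hx : 4 ^ k * ‖x‖ ^ 2 ≤ 2
    · have hxr : x ∈ Metric.ball (0 : Plane) r := by
        rw [mem_ball_zero_iff]
        refine lt_of_pow_lt_pow_left₀ 2 hr0.le ?_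
        nlinarith
      rw [indicator_of_mem hxr, partialDeriv_dyadicCutoff, mul_pow]
      have h1 : deriv Real.smoothTransition (4 ^ k * ‖x‖ ^ 2 - 1) ^ 2 ≤ A ^ 2 := by
        rw [← sq_abs]
        exact pow_le_pow_left₀ (abs_nonneg _) (hA _).1 2
      have h2 : (4 ^ k * (2 * x j)) ^ 2 ≤ 16 * 4 ^ k := by
        have : x j ^ 2 ≤ ‖x‖ ^ 2 := by
          rw [← sq_abs (x j)]
          exact pow_le_pow_left₀ (abs_nonneg _) (abs_coord_le x j) 2
        calc (4 ^ k * (2 * x j)) ^ 2 = 4 * 4 ^ k * (4 ^ k * x j ^ 2) := by ring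
          _ ≤ 4 * 4 ^ k * 2 := by gcongr; nlinarith
          _ ≤ _ := by nlinarith
      calc _ ≤ A ^ 2 * (16 * 4 ^ k) := by gcongr
        _ = _ := by ring
    · rw [partialDeriv_dyadicCutoff, (hA _).2 (Or.inr (by linarith))]
      simp only [zero_mul, ne_eq, OfNat.ofNat_ne_zero, not_false_eq_true, zero_pow]
      exact indicator_nonneg (fun _ _ => by positivity) x
  calc _ ≤ ∫ x, (Metric.ball (0 : Plane) r).indicator (fun _ => 16 * A ^ 2 * 4 ^ k) x
        ∂discMeasure := by
        refine integral_mono ?_ ?_ hle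
        · exact memLp_one_iff_integrable.1 (memLp_of_continuous
            ((contDiff_partialDeriv (contDiff_dyadicCutoff k) j).continuous.pow 2) 1)
        · exact (integrable_const _).indicator measurableSet_ball
    _ = (discMeasure (Metric.ball (0 : Plane) r)).toReal * (16 * A ^ 2 * 4 ^ k) := by
        rw [integral_indicator_const _ measurableSet_ball]; rfl
    _ ≤ (volume (Metric.ball (0 : Plane) r)).toReal * (16 * A ^ 2 * 4 ^ k) := by
        refine mul_le_mul_of_nonneg_right (ENNReal.toReal_mono measure_ball_lt_top.ne ?_)
          (by positivity)
        exact Measure.restrict_apply_le _ _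
    _ = _ := by
        rw [Measure.addHaar_ball _ _ hr0.le, ENNReal.toReal_mul,
          ENNReal.toReal_ofReal (by positivity)]
        simp only [finrank_euclideanSpace, Fintype.card_fin]
        calc r ^ 2 * V * (16 * A ^ 2 * 4 ^ k) = (r ^ 2 * 4 ^ k) * (16 * A ^ 2 * V) := by ring
          _ = _ := by rw [hr2]; ring

/-- Logarithmic cutoff functions, as averages of dyadic ones. -/
noncomputable def logCutoff (n : ℕ) (x : Plane) : ℝ :=
  (n : ℝ)⁻¹ * ∑ k ∈ Finset.range n, dyadicCutoff k x

theorem contDiff_logCutoff (n : ℕ) : ContDiff ℝ ∞ (logCutoff n) :=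
  contDiff_const.mul (ContDiff.sum fun k _ => contDiff_dyadicCutoff k)

theorem partialDeriv_logCutoff (n : ℕ) (j : Fin 2) (x : Plane) : partialDeriv j (logCutoff n) x =
    (n : ℝ)⁻¹ * ∑ k ∈ Finset.range n, partialDeriv j (dyadicCutoff k) x := by
  have h := (HasFDerivAt.fun_sum (u := Finset.range n) fun k _ =>
    ((contDiff_dyadicCutoff k).differentiable (by simp) x).hasFDerivAt).const_mul (n : ℝ)⁻¹
  have h' : fderiv ℝ (logCutoff n) x = _ := h.fderiv
  rw [partialDeriv, h']
  simp [partialDeriv]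

/-- The gradient of the k-th cutoff lives where 1 ≤ 4^k |x|² ≤ 2; the factor 4 between consecutive
scales makes these shells disjoint. -/
theorem partialDeriv_dyadicCutoff_mul {k l : ℕ} (hkl : k ≠ l) (j : Fin 2) (x : Plane) :
    partialDeriv j (dyadicCutoff k) x * partialDeriv j (dyadicCutoff l) x = 0 := by
  obtain ⟨A, -, hA⟩ := exists_deriv_smoothTransition_bound
  wlog hlt : k < l generalizing k l
  · rw [mul_comm]
    exact this hkl.symm (lt_of_le_of_ne (not_lt.1 hlt) hkl.symm)
  rw [partialDeriv_dyadicCutoff, partialDeriv_dyadicCutoff]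
  by_cases hx : 4 ^ k * ‖x‖ ^ 2 < 1
  · rw [(hA _).2 (Or.inl (by linarith))]; ring
  · have h4 : (4 : ℝ) ^ (k + 1) ≤ 4 ^ l := pow_le_pow_right₀ (by norm_num) hlt
    have : 4 ^ (k + 1) * ‖x‖ ^ 2 ≤ 4 ^ l * ‖x‖ ^ 2 := by gcongr
    rw [pow_succ] at this
    rw [(hA (4 ^ l * ‖x‖ ^ 2 - 1)).2 (Or.inr (by linarith))]; ring

theorem sq_sum_of_mul_eq_zero (n : ℕ) (d : ℕ → ℝ) (h : ∀ k l, k ≠ l → d k * d l = 0) :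
    (∑ k ∈ Finset.range n, d k) ^ 2 = ∑ k ∈ Finset.range n, d k ^ 2 := by
  rw [sq, Finset.sum_mul_sum]
  refine Finset.sum_congr rfl fun k hk => ?_
  rw [Finset.sum_eq_single_of_mem k hk fun l _ hl => h k l hl.symm, sq]

/-- Disjoint supports make the n energies add without cross terms, so the average has energy at most
n·C/n² = C/n. -/
theorem tendsto_nrm_partialDeriv_logCutoff (j : Fin 2) :
    Tendsto (fun n => nrm (partialDeriv j (logCutoff n))) atTop (𝓝 0) := by
  obtain ⟨C, hC0, hC⟩ := exists_partialDeriv_dyadicCutoff_bound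
  have hle : ∀ n : ℕ, nrm (partialDeriv j (logCutoff n)) ≤ √(C * (n : ℝ)⁻¹) := by
    intro n
    refine Real.le_sqrt_of_sq_le ?_
    rw [sq_nrm (memLp_of_continuous (contDiff_partialDeriv (contDiff_logCutoff n) j).continuous 2)]
    have e : ∀ x, partialDeriv j (logCutoff n) x ^ 2 =
        ((n : ℝ)⁻¹) ^ 2 * ∑ k ∈ Finset.range n, partialDeriv j (dyadicCutoff k) x ^ 2 := fun x => by
      rw [partialDeriv_logCutoff, mul_pow, sq_sum_of_mul_eq_zero n
        (fun k => partialDeriv j (dyadicCutoff k) x)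
        fun k l hkl => partialDeriv_dyadicCutoff_mul hkl j x]
    simp_rw [e]
    have hi : ∀ k ∈ Finset.range n,
        Integrable (fun x => partialDeriv j (dyadicCutoff k) x ^ 2) discMeasure := fun k _ =>
      memLp_one_iff_integrable.1 (memLp_of_continuous
        ((contDiff_partialDeriv (contDiff_dyadicCutoff k) j).continuous.pow 2) 1)
    rw [integral_const_mul, integral_finsetSum _ hi]
    calc _ ≤ ((n : ℝ)⁻¹) ^ 2 * ∑ k ∈ Finset.range n, C := by
          gcongr with k _
          exact hC k j
      _ = _ := by
          rw [Finset.sum_const, Finset.card_range, nsmul_eq_mul]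
          rcases eq_or_ne n 0 with rfl | hn
          · simp
          · have : (n : ℝ) ≠ 0 := by exact_mod_cast hn
            field_simp
  refine squeeze_zero (fun n => nrm_nonneg _) hle ?_
  have h1 : Tendsto (fun n : ℕ => C * (n : ℝ)⁻¹) atTop (𝓝 (C * 0)) :=
    (tendsto_inv_atTop_nhds_zero_nat (𝕜 := ℝ)).const_mul C
  have := (Real.continuous_sqrt.tendsto _).comp h1
  rw [mul_zero, Real.sqrt_zero] at this
  exact this

theorem dyadicCutoff_mem (k : ℕ) (x : Plane) : 0 ≤ dyadicCutoff k x ∧ dyadicCutoff k x ≤ 1 :=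
  ⟨Real.smoothTransition.nonneg _, Real.smoothTransition.le_one _⟩

theorem logCutoff_mem (n : ℕ) (x : Plane) : 0 ≤ logCutoff n x ∧ logCutoff n x ≤ 1 := by
  constructor
  · exact mul_nonneg (by positivity) (Finset.sum_nonneg fun k _ => (dyadicCutoff_mem k x).1)
  · have h : ∑ k ∈ Finset.range n, dyadicCutoff k x ≤ ∑ k ∈ Finset.range n, (1 : ℝ) :=
      Finset.sum_le_sum fun k _ => (dyadicCutoff_mem k x).2
    rw [Finset.sum_const, Finset.card_range, nsmul_eq_mul, mul_one] at h
    rw [logCutoff, inv_mul_eq_div]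
    exact div_le_one_of_le₀ h (by positivity)

theorem tendsto_logCutoff {x : Plane} (hx : x ≠ 0) :
    Tendsto (fun n => logCutoff n x) atTop (𝓝 1) := by
  have hx' : 0 < ‖x‖ := norm_pos_iff.2 hx
  refine Filter.Tendsto.cesaro ?_
  have h1 : Tendsto (fun k : ℕ => (4 : ℝ) ^ k * ‖x‖ ^ 2 - 1) atTop atTop :=
    tendsto_atTop_add_const_right _ _
      ((tendsto_pow_atTop_atTop_of_one_lt (by norm_num)).atTop_mul_const (by positivity))
  refine tendsto_const_nhds.congr' ?_
  filter_upwards [h1.eventually_ge_atTop 1] with k hk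
  exact (Real.smoothTransition.one_of_one_le hk).symm

theorem tendsto_nrm_logCutoff_sub_one_mul {f : Plane → ℝ} (hf : MemLp f 2 discMeasure) :
    Tendsto (fun n => nrm (fun x => (logCutoff n x - 1) * f x)) atTop (𝓝 0) := by
  have hm : ∀ n, MemLp (fun x => (logCutoff n x - 1) * f x) 2 discMeasure := fun n => by
    refine hf.of_le (((contDiff_logCutoff n).continuous.sub
      continuous_const).aestronglyMeasurable.mul hf.1) (Eventually.of_forall fun x => ?_)
    rw [norm_mul]
    refine mul_le_of_le_one_left (norm_nonneg _) ?_
    rw [Real.norm_eq_abs, abs_le]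
    have := logCutoff_mem n x
    constructor <;> linarith
  have h : Tendsto (fun n => ∫ x, ((logCutoff n x - 1) * f x) ^ 2 ∂discMeasure) atTop
      (𝓝 (∫ x, (0 : ℝ) ∂discMeasure)) := by
    refine tendsto_integral_of_dominated_convergence (fun x => f x ^ 2)
      (fun n => (hm n).1.pow 2) hf.integrable_sq (fun n => Eventually.of_forall fun x => ?_) ?_
    · rw [Real.norm_eq_abs, abs_of_nonneg (sq_nonneg _), mul_pow]
      refine mul_le_of_le_one_left (sq_nonneg _) ?_
      have := logCutoff_mem n x
      nlinarith
    · filter_upwards [ae_ne_zero] with x hx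
      have := (((tendsto_logCutoff hx).sub_const 1).mul_const (f x)).pow 2
      simpa using this
  rw [integral_zero] at h
  have h2 := (Real.continuous_sqrt.tendsto _).comp h
  rw [Real.sqrt_zero] at h2
  refine h2.congr fun n => ?_
  rw [Function.comp_apply, ← sq_nrm (hm n), Real.sqrt_sq (nrm_nonneg _)]

theorem IsTest.exists_norm_bound {f : Plane → ℝ} (hf : IsTest f) :
    ∃ b, b < 1 ∧ ∀ x, b < ‖x‖ → f x = 0 := by
  rcases (tsupport f).eq_empty_or_nonempty with h | h
  · exact ⟨0, one_pos, fun x _ => image_eq_zero_of_notMem_tsupport (by simp [h])⟩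
  · obtain ⟨y, hy, hmax⟩ := (show IsCompact (tsupport f) from hf.2.1).exists_isMaxOn h
      continuous_norm.continuousOn
    refine ⟨‖y‖, by simpa [disc] using hf.2.2 hy, fun x hx => ?_⟩
    exact image_eq_zero_of_notMem_tsupport fun hn => absurd (hmax hn) (not_le.2 hx)

theorem IsTest.isPuncturedTest_logCutoff_mul {f : Plane → ℝ} (hf : IsTest f) (n : ℕ) :
    IsPuncturedTest (fun x => logCutoff n x * f x) := by
  obtain ⟨b, hb, hfb⟩ := hf.exists_norm_bound
  -- Inside radius 2^(-n) all the averaged cutoffs, with k < n, vanish.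
  refine ⟨(contDiff_logCutoff n).mul hf.1, (1 / 2) ^ n, b, by positivity, hb, fun x hx => ?_⟩
  rw [annulus, mem_ofPred_eq, not_and_or, not_le, not_le] at hx
  rcases hx with hx | hx
  · have : logCutoff n x = 0 := by
      rw [logCutoff, Finset.sum_eq_zero, mul_zero]
      intro k hk
      refine Real.smoothTransition.zero_of_nonpos ?_
      have h1 : (4 : ℝ) ^ k ≤ 4 ^ n :=
        pow_le_pow_right₀ (by norm_num) (Finset.mem_range.1 hk).le
      have h2 : ‖x‖ ^ 2 ≤ ((1 / 2) ^ n) ^ 2 := pow_le_pow_left₀ (norm_nonneg _) hx.le 2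
      have h3 : (4 : ℝ) ^ n * ((1 / 2) ^ n) ^ 2 = 1 := by
        rw [← pow_mul, mul_comm n 2, pow_mul, ← mul_pow]; norm_num
      have : (4 : ℝ) ^ k * ‖x‖ ^ 2 ≤ 4 ^ n * ((1 / 2) ^ n) ^ 2 := by gcongr
      linarith
    simp only [this, zero_mul]
  · simp only [hfb x hx, mul_zero]

/-- Points have zero capacity: test functions are `W^{1,2}` limits of punctured ones. -/
theorem IsTest.exists_puncturedTest_near {f : Plane → ℝ} (hf : IsTest f) {ε : ℝ} (hε : 0 < ε) :
    ∃ φ, IsPuncturedTest φ ∧ nrm (fun x => φ x - f x) ≤ ε ∧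
      ∀ j, nrm (fun x => partialDeriv j φ x - partialDeriv j f x) ≤ ε := by
  obtain ⟨F, hF⟩ := hf.2.1.exists_bound_of_continuous hf.1.continuous
  have hF0 : 0 ≤ F := (norm_nonneg _).trans (hF 0)
  have hfm := memLp_of_continuous hf.1.continuous 2
  have hfj : ∀ j, MemLp (partialDeriv j f) 2 discMeasure := fun j =>
    memLp_of_continuous (contDiff_partialDeriv hf.1 j).continuous 2
  have t0 := tendsto_nrm_logCutoff_sub_one_mul hfm
  have t1 : ∀ j, Tendsto (fun n => nrm (fun x => (logCutoff n x - 1) * partialDeriv j f x) +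
      F * nrm (partialDeriv j (logCutoff n))) atTop (𝓝 0) := fun j => by
    have := (tendsto_nrm_logCutoff_sub_one_mul (hfj j)).add
      ((tendsto_nrm_partialDeriv_logCutoff j).const_mul F)
    simpa using this
  -- The gradient of logCutoff n · f differs from ∇f by (logCutoff n - 1)∇f, small by dominated
  -- convergence, and f ∇logCutoff n, small by boundedness of f and zero capacity.
  obtain ⟨n, hn, hn0, hn1⟩ := ((t0.eventually_le_const hε).and
    (((t1 0).eventually_le_const hε).and ((t1 1).eventually_le_const hε))).exists
  have hn' : ∀ j, nrm (fun x => (logCutoff n x - 1) * partialDeriv j f x) +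
      F * nrm (partialDeriv j (logCutoff n)) ≤ ε := fun j => by
    fin_cases j
    · exact hn0
    · exact hn1
  refine ⟨_, hf.isPuncturedTest_logCutoff_mul n, ?_, fun j => ?_⟩
  · refine le_of_eq_of_le ?_ hn
    congr 1
    funext x
    ring
  · refine le_trans ?_ (hn' j)
    have e : (fun x => partialDeriv j (fun x => logCutoff n x * f x) x - partialDeriv j f x) =
        fun x => (logCutoff n x - 1) * partialDeriv j f x + f x * partialDeriv j (logCutoff n) x := by
      funext x
      rw [partialDeriv_mul (contDiff_logCutoff n) hf.1]
      ring
    have c1 : Continuous fun x => (logCutoff n x - 1) * partialDeriv j f x :=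
      ((contDiff_logCutoff n).continuous.sub continuous_const).mul
        (contDiff_partialDeriv hf.1 j).continuous
    have c2 : Continuous (partialDeriv j (logCutoff n)) :=
      (contDiff_partialDeriv (contDiff_logCutoff n) j).continuous
    have m2 : MemLp (fun x => F * partialDeriv j (logCutoff n) x) 2 discMeasure :=
      memLp_of_continuous (continuous_const.mul c2) 2
    rw [e]
    refine (nrm_add_le (memLp_of_continuous c1 2)
      (memLp_of_continuous (hf.1.continuous.mul c2) 2)).trans (add_le_add_right ?_ _)
    refine (nrm_mono (g := fun x => F * partialDeriv j (logCutoff n) x) m2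
      (Eventually.of_forall fun x => ?_)).trans (le_of_eq ?_)
    · rw [Pi.mul_apply, abs_mul, abs_mul, abs_of_nonneg hF0]
      exact mul_le_mul_of_nonneg_right (hF x) (abs_nonneg _)
    · rw [nrm, nrm]
      have := eLpNorm_const_smul F (partialDeriv j (logCutoff n)) 2 discMeasure
      change eLpNorm (fun x => F * partialDeriv j (logCutoff n) x) 2 discMeasure = _ at this
      rw [this, ENNReal.toReal_mul]
      simp [abs_of_nonneg hF0]

/-- Limits of test functions are limits of punctured test functions. -/
theorem IsH1Limit.exists_punctured {w : ℕ → Plane → ℝ} {f : Plane → ℝ} {g : Fin 2 → Plane → ℝ}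
    (h : IsH1Limit w f g) (hw : ∀ k, IsTest (w k)) :
    ∃ φ : ℕ → Plane → ℝ, (∀ k, IsPuncturedTest (φ k)) ∧ IsH1Limit φ f g := by
  choose φ hφ h0 h1 using fun k : ℕ => (hw k).exists_puncturedTest_near
    (ε := 1 / ((k : ℝ) + 1)) (by positivity)
  have t := tendsto_one_div_add_atTop_nhds_zero_nat (𝕜 := ℝ)
  have cont : ∀ {f : Plane → ℝ}, Continuous f → MemLp f 2 discMeasure :=
    fun hf => memLp_of_continuous hf 2
  refine ⟨φ, hφ, fun k => (hφ k).1, h.memLp, h.memLp_grad, ?_, fun j => ?_⟩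
  · have h2 := t.add h.tendsto.nrm_sub
    rw [add_zero] at h2
    refine tendstoL2_of_nrm (fun k => cont (hφ k).1.continuous) h.memLp
      (squeeze_zero (fun _ => nrm_nonneg _) (fun k => ?_) h2)
    have := nrm_add_le ((cont (hφ k).1.continuous).sub (cont (h.smooth k).continuous))
      ((cont (h.smooth k).continuous).sub h.memLp)
    simp only [Pi.sub_apply, sub_add_sub_cancel] at this
    exact this.trans (add_le_add_left (h0 k) _)
  · have h2 := t.add (h.tendsto_grad j).nrm_sub
    rw [add_zero] at h2
    have c1 := fun k => cont (contDiff_partialDeriv (hφ k).1 j).continuous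
    have c2 := fun k => cont (contDiff_partialDeriv (h.smooth k) j).continuous
    refine tendstoL2_of_nrm c1 (h.memLp_grad j)
      (squeeze_zero (fun _ => nrm_nonneg _) (fun k => ?_) h2)
    have := nrm_add_le ((c1 k).sub (c2 k)) ((c2 k).sub (h.memLp_grad j))
    simp only [Pi.sub_apply, sub_add_sub_cancel] at this
    exact this.trans (add_le_add_left (h1 k j) _)

end HFU

/-! ### Fourier modes of vector fields and vanishing circle coefficients -/

namespace HFU

theorem integral_cos_mul_cos {l j : ℕ} (h : l ≠ j) :
    ∫ t, Real.cos (l * t) * Real.cos (j * t) ∂angleMeasure = 0 := by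
  have e : ∀ t : ℝ, Real.cos (l * t) * Real.cos (j * t) =
      (1 / 2) * (Real.cos (((l : ℤ) - j : ℤ) * t) + Real.cos (((l : ℤ) + j : ℤ) * t)) := by
    intro t
    push_cast
    rw [sub_mul, add_mul, Real.cos_sub, Real.cos_add]; ring
  rw [integral_angleMeasure]
  simp_rw [e]
  rw [intervalIntegral.integral_const_mul, intervalIntegral.integral_add
    (Continuous.intervalIntegrable (by fun_prop) _ _)
    (Continuous.intervalIntegrable (by fun_prop) _ _),
    integral_cos_int_mul (by omega), integral_cos_int_mul (by omega)]
  simp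

theorem integral_sin_mul_sin {l j : ℕ} (h : l ≠ j) :
    ∫ t, Real.sin (l * t) * Real.sin (j * t) ∂angleMeasure = 0 := by
  have e : ∀ t : ℝ, Real.sin (l * t) * Real.sin (j * t) =
      (1 / 2) * (Real.cos (((l : ℤ) - j : ℤ) * t) - Real.cos (((l : ℤ) + j : ℤ) * t)) := by
    intro t
    push_cast
    rw [sub_mul, add_mul, Real.cos_sub, Real.cos_add]; ring
  rw [integral_angleMeasure]
  simp_rw [e]
  rw [intervalIntegral.integral_const_mul, intervalIntegral.integral_sub
    (Continuous.intervalIntegrable (by fun_prop) _ _)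
    (Continuous.intervalIntegrable (by fun_prop) _ _),
    integral_cos_int_mul (by omega), integral_cos_int_mul (by omega)]
  simp

theorem integral_cos_mul_sin (l j : ℕ) :
    ∫ t, Real.cos (l * t) * Real.sin (j * t) ∂angleMeasure = 0 := by
  have e : ∀ t : ℝ, Real.cos (l * t) * Real.sin (j * t) =
      (1 / 2) * (Real.sin (((l : ℤ) + j : ℤ) * t) - Real.sin (((l : ℤ) - j : ℤ) * t)) := by
    intro t
    push_cast
    rw [sub_mul, add_mul, Real.sin_sub, Real.sin_add]; ring
  rw [integral_angleMeasure]
  simp_rw [e]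
  rw [intervalIntegral.integral_const_mul, intervalIntegral.integral_sub
    (Continuous.intervalIntegrable (by fun_prop) _ _)
    (Continuous.intervalIntegrable (by fun_prop) _ _),
    integral_sin_int_mul, integral_sin_int_mul]
  simp

/-- The `j`-th Fourier mode of a scalar function. -/
noncomputable def scalarMode (f : Plane → ℝ) (j : ℕ) (x : Plane) : ℝ :=
  (if j = 0 then (2 * Real.pi)⁻¹ else Real.pi⁻¹) *
    (Real.cos (j * polarAngle x) * sliceCoeff (fun t => Real.cos (j * t)) f ‖x‖ +
      Real.sin (j * polarAngle x) * sliceCoeff (fun t => Real.sin (j * t)) f ‖x‖)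

theorem memLp_sliceCoeff_norm {k : ℝ → ℝ} (hkm : Measurable k) (hk : ∀ t, |k t| ≤ 1)
    {f : Plane → ℝ} (hf : MemLp f 2 discMeasure) :
    MemLp (fun x => sliceCoeff k f ‖x‖) 2 discMeasure := by
  obtain ⟨⟨f', hf', hff'⟩, hfin⟩ := hf
  have hm := measurable_sliceCoeff hkm hf'.measurable
  have hae : (fun x : Plane => sliceCoeff k f ‖x‖) =ᵐ[discMeasure] fun x => sliceCoeff k f' ‖x‖ := by
    filter_upwards [ae_radial (sliceCoeff_congr hff')] with x hx using hx k
  refine MemLp.ae_eq hae.symm ⟨(hm.comp measurable_norm).aestronglyMeasurable, ?_⟩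
  suffices hsq : eLpNorm (fun x => sliceCoeff k f' ‖x‖) 2 discMeasure ^ 2 < ⊤ from
    (ENNReal.pow_lt_top_iff.1 hsq).resolve_right two_ne_zero
  rw [sq_eLpNorm,
    lintegral_disc_radial (g := fun R => ‖sliceCoeff k f' R‖ₑ ^ 2) (hm.enorm.pow_const 2)]
  refine ENNReal.mul_lt_top ENNReal.ofReal_lt_top
    ((lintegral_sliceCoeff_le hk hf'.aestronglyMeasurable).trans_lt
      (ENNReal.mul_lt_top ENNReal.ofReal_lt_top (ENNReal.pow_lt_top ?_)))
  rwa [← eLpNorm_congr_ae hff']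

theorem measurable_polarAngle : Measurable polarAngle := by
  refine Complex.measurable_arg.comp (f := fun x : Plane => (⟨x 0, x 1⟩ : ℂ)) ?_
  have : (fun x : Plane => (⟨x 0, x 1⟩ : ℂ)) = fun x => (x 0 : ℂ) + (x 1 : ℂ) * Complex.I := by
    funext x
    apply Complex.ext <;> simp
  rw [this]
  exact (by fun_prop : Continuous fun x : Plane => (x 0 : ℂ) + (x 1 : ℂ) * Complex.I).measurable

theorem memLp_scalarMode {f : Plane → ℝ} (hf : MemLp f 2 discMeasure) (j : ℕ) :
    MemLp (scalarMode f j) 2 discMeasure := by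
  have hc : Measurable fun t : ℝ => Real.cos (j * t) := by fun_prop
  have hs : Measurable fun t : ℝ => Real.sin (j * t) := by fun_prop
  have m1 := memLp_sliceCoeff_norm hc (fun t => Real.abs_cos_le_one _) hf
  have m2 := memLp_sliceCoeff_norm hs (fun t => Real.abs_sin_le_one _) hf
  have h1 : MemLp (fun x => Real.cos (j * polarAngle x) *
      sliceCoeff (fun t => Real.cos (j * t)) f ‖x‖) 2 discMeasure := by
    refine m1.of_le ((hc.comp measurable_polarAngle).aestronglyMeasurable.mul m1.1)
      (Eventually.of_forall fun x => ?_)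
    rw [norm_mul]
    exact mul_le_of_le_one_left (norm_nonneg _) (Real.abs_cos_le_one _)
  have h2 : MemLp (fun x => Real.sin (j * polarAngle x) *
      sliceCoeff (fun t => Real.sin (j * t)) f ‖x‖) 2 discMeasure := by
    refine m2.of_le ((hs.comp measurable_polarAngle).aestronglyMeasurable.mul m2.1)
      (Eventually.of_forall fun x => ?_)
    rw [norm_mul]
    exact mul_le_of_le_one_left (norm_nonneg _) (Real.abs_sin_le_one _)
  exact (h1.add h2).const_mul (if j = 0 then (2 * Real.pi)⁻¹ else Real.pi⁻¹)

/-- On a single circle the modes are trigonometric polynomials, so orthogonality of the kernel to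
each frequency in s suffices. -/
theorem sliceCoeff_sum_scalarMode {k : ℝ → ℝ} (hk : Continuous k) (f : Plane → ℝ) (s : Finset ℕ)
    (hkc : ∀ j ∈ s, ∫ t, k t * Real.cos (j * t) ∂angleMeasure = 0)
    (hks : ∀ j ∈ s, ∫ t, k t * Real.sin (j * t) ∂angleMeasure = 0) {R : ℝ} (hR : 0 < R) :
    sliceCoeff k (fun x => ∑ j ∈ s, scalarMode f j x) R = 0 := by
  have hcont : ∀ {φ : ℝ → ℝ}, Continuous φ → Integrable φ angleMeasure := fun hφ =>
    (hφ.integrableOn_Icc (a := -Real.pi) (b := Real.pi)).mono_set Ioc_subset_Icc_self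
  set A := fun j : ℕ => (if j = 0 then (2 * Real.pi)⁻¹ else Real.pi⁻¹) *
    sliceCoeff (fun t => Real.cos (j * t)) f R
  set B := fun j : ℕ => (if j = 0 then (2 * Real.pi)⁻¹ else Real.pi⁻¹) *
    sliceCoeff (fun t => Real.sin (j * t)) f R
  have e : sliceCoeff k (fun x => ∑ j ∈ s, scalarMode f j x) R =
      ∫ t, ∑ j ∈ s, (A j * (k t * Real.cos (j * t)) + B j * (k t * Real.sin (j * t)))
        ∂angleMeasure := by
    refine setIntegral_congr_fun measurableSet_Ioc fun t ht => ?_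
    simp only [Finset.mul_sum]
    refine Finset.sum_congr rfl fun j _ => ?_
    rw [scalarMode, norm_polarPoint hR.le, polarAngle_polarPoint hR ht]
    ring
  rw [e, integral_finsetSum _ fun j _ => hcont (by fun_prop)]
  refine Finset.sum_eq_zero fun j hj => ?_
  rw [integral_add (hcont (by fun_prop)) (hcont (by fun_prop)), integral_const_mul,
    integral_const_mul, hkc j hj, hks j hj]
  ring

/-- Taking a coordinate commutes with the vector-valued integral only when the slice is integrable,
hence almost everywhere. Periodicity moves the interval from (0, 2π] to (-π, π]. -/
theorem fourierMode_ae_eq {η : Plane → Plane} (hη : ∀ i, MemLp (fun x => η x i) 2 discMeasure)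
    (j : ℕ) (i : Fin 2) :
    (fun x => fourierMode η j x i) =ᵐ[discMeasure] scalarMode (fun x => η x i) j := by
  have hsl : ∀ᵐ R ∂radiusMeasure, ∀ i, MemLp (fun t => η (polarPoint R t) i) 2 angleMeasure :=
    ae_all_iff.2 fun i => ae_memLp_slice (hη i)
  have key : ∀ k : ℝ → ℝ, Continuous k → (∀ t, |k t| ≤ 1) → Function.Periodic k (2 * Real.pi) →
      ∀ R, (∀ i, MemLp (fun t => η (polarPoint R t) i) 2 angleMeasure) →
      (∫ t in (0 : ℝ)..(2 * Real.pi), k t • η (polarPoint R t)) i =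
        sliceCoeff k (fun x => η x i) R := by
    intro k hk hk1 hkp R hR
    have hp : Function.Periodic (fun t => k t • η (polarPoint R t)) (2 * Real.pi) := fun t => by
      simp only [hkp t, polarPoint_periodic R t]
    have h1 := hp.intervalIntegral_add_eq 0 (-Real.pi)
    rw [zero_add, show -Real.pi + 2 * Real.pi = Real.pi by ring] at h1
    rw [h1, intervalIntegral.integral_of_le neg_pi_lt_pi.le, sliceCoeff]
    have hint : Integrable (fun t => k t • η (polarPoint R t)) angleMeasure := by
      refine Integrable.of_eval_piLp fun i => ?_
      exact integrable_trig_mul hk hk1 (hR i)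
    exact eval_integral_piLp (fun i => Integrable.eval_piLp hint i) i
  filter_upwards [ae_radial hsl] with x hx
  have hpc : Function.Periodic (fun t => Real.cos (j * t)) (2 * Real.pi) := fun t => by
    simp only [mul_add]
    exact Real.cos_add_nat_mul_two_pi _ _
  have hps : Function.Periodic (fun t => Real.sin (j * t)) (2 * Real.pi) := fun t => by
    simp only [mul_add]
    exact Real.sin_add_nat_mul_two_pi _ _
  have kc := key _ (by fun_prop) (fun t => Real.abs_cos_le_one _) hpc ‖x‖ hx
  have ks := key _ (by fun_prop) (fun t => Real.abs_sin_le_one _) hps ‖x‖ hx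
  rw [fourierMode, scalarMode]
  by_cases hj : j = 0
  · subst hj
    simp only [if_true]
    rw [cosCoeff]
    simp only [PiLp.smul_apply, smul_eq_mul]
    rw [kc]
    simp
    ring
  · simp only [hj, if_false]
    rw [cosCoeff, sinCoeff]
    simp only [PiLp.add_apply, PiLp.smul_apply, smul_eq_mul]
    rw [kc, ks]
    ring

/-- Circle coefficients outside the index set of a sum of Fourier modes vanish. -/
theorem EqSumOfModes.sliceCoeff_eq_zero {η : Plane → Plane} {S : Set ℕ} (h : EqSumOfModes η S)
    (hη : ∀ i, MemLp (fun x => η x i) 2 discMeasure) {l : ℕ} (hl : l ∉ S) (i : Fin 2) :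
    ∀ᵐ R ∂radiusMeasure, sliceCoeff (fun t => Real.cos (l * t)) (fun x => η x i) R = 0 ∧
      sliceCoeff (fun t => Real.sin (l * t)) (fun x => η x i) R = 0 := by
  classical
  set s : ℕ → Finset ℕ := fun N => (Finset.range N).filter (· ∈ S)
  set Fs : ℕ → Plane → ℝ := fun N x => ∑ j ∈ s N, scalarMode (fun x => η x i) j x with hFs
  have hFm : ∀ N, MemLp (Fs N) 2 discMeasure := fun N =>
    memLp_finsetSum _ fun j _ => memLp_scalarMode (hη i) j
  have hFt : Tendsto (fun N => eLpNorm (fun x => η x i - Fs N x) 2 discMeasure) atTop (𝓝 0) := by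
    refine tendsto_of_tendsto_of_tendsto_of_le_of_le tendsto_const_nhds h (fun _ => zero_le)
      fun N => ?_
    refine eLpNorm_mono_ae ?_
    have hall : ∀ᵐ x ∂discMeasure, ∀ j, fourierMode η j x i = scalarMode (fun x => η x i) j x :=
      ae_all_iff.2 fun j => fourierMode_ae_eq hη j i
    filter_upwards [hall] with x hx
    have e : η x i - Fs N x =
        (η x - ∑ j ∈ (Finset.range N).filter (· ∈ S), fourierMode η j x) i := by
      simp [hFs, s, hx]
    rw [e]
    rw [Real.norm_eq_abs]
    exact abs_coord_le _ i
  have hls : ∀ N, ∀ j ∈ s N, l ≠ j := fun N j hj hlj => hl (by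
    rw [hlj]; exact (Finset.mem_filter.1 hj).2)
  -- The relation is used with constant 0: the coefficient of every partial sum vanishes, and so
  -- does that of the limit.
  have z1 := sliceCoeff_relation_of_tendsto (k := fun t => Real.cos (l * t)) (l := 1) (by fun_prop)
    (fun t => Real.abs_cos_le_one _) measurable_one (by simp) 0 (hη i) (hη i) hFm
    (fun _ => hη i) hFt (by simp) (fun N => by
      filter_upwards [ae_restrict_mem measurableSet_Ioo] with R hR
      rw [sliceCoeff_sum_scalarMode (by fun_prop) _ _
        (fun j hj => integral_cos_mul_cos (hls N j hj)) (fun j _ => integral_cos_mul_sin l j) hR.1,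
        zero_mul])
  have z2 := sliceCoeff_relation_of_tendsto (k := fun t => Real.sin (l * t)) (l := 1) (by fun_prop)
    (fun t => Real.abs_sin_le_one _) measurable_one (by simp) 0 (hη i) (hη i) hFm
    (fun _ => hη i) hFt (by simp) (fun N => by
      filter_upwards [ae_restrict_mem measurableSet_Ioo] with R hR
      rw [sliceCoeff_sum_scalarMode (by fun_prop) _ _
        (fun j _ => by simpa only [mul_comm] using integral_cos_mul_sin j l)
        (fun j hj => integral_sin_mul_sin (hls N j hj)) hR.1, zero_mul])
  filter_upwards [z1, z2] with R h1 h2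
  exact ⟨by rw [h1, zero_mul], by rw [h2, zero_mul]⟩

/-- Coefficients are indexed by integers for Parseval but modes by naturals; negative indices follow
by parity of cosine and sine. -/
theorem EqSumOfModes.lowModesVanish {η : Plane → Plane} {S : Set ℕ} (h : EqSumOfModes η S)
    (hη : ∀ i, MemLp (fun x => η x i) 2 discMeasure) {m : ℕ} (hS : ∀ j, 0 < j → j < m → j ∉ S)
    (i : Fin 2) : LowModesVanish (fun x => η x i) m := by
  rw [LowModesVanish, ae_all_iff]
  intro n
  by_cases hn : n ≠ 0 ∧ |n| < m
  · have hl : n.natAbs ∉ S := hS _ (Int.natAbs_pos.2 hn.1) (by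
      have := hn.2
      rw [Int.abs_eq_natAbs] at this
      exact_mod_cast this)
    filter_upwards [h.sliceCoeff_eq_zero hη hl i] with R hR _ _
    have hcast : (n : ℝ) = (n.natAbs : ℝ) ∨ (n : ℝ) = -(n.natAbs : ℝ) := by
      rcases Int.natAbs_eq n with e | e
      · exact Or.inl (by rw [← Int.cast_natCast, ← e])
      · exact Or.inr (by rw [← Int.cast_natCast, ← Int.cast_neg, ← e])
    rcases hcast with e | e
    · rw [e]; exact hR
    · rw [e]
      simp only [neg_mul, Real.cos_neg, Real.sin_neg]
      refine ⟨hR.1, ?_⟩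
      rw [sliceCoeff] at hR ⊢
      simp only [neg_mul, integral_neg]
      rw [neg_eq_zero]
      exact hR.2
  · exact Eventually.of_forall fun R h1 h2 => absurd ⟨h1, h2⟩ hn

theorem EqSumOfModes.circleMean_eq_zero {η : Plane → Plane} {S : Set ℕ} (h : EqSumOfModes η S)
    (hη : ∀ i, MemLp (fun x => η x i) 2 discMeasure) (hS : 0 ∉ S) (i : Fin 2) :
    ∀ᵐ x ∂discMeasure, circleMean (fun x => η x i) x = 0 := by
  filter_upwards [ae_radial (h.sliceCoeff_eq_zero hη hS i)] with x hx
  rw [circleMean_eq_sliceCoeff]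
  have : (fun t : ℝ => Real.cos ((0 : ℕ) * t)) = 1 := by
    funext t; simp
  rw [this] at hx
  rw [hx.1, mul_zero]

end HFU

/-! ### Extending the pressure pairing to W^{1,2} variations -/

namespace HFU

variable {u v η : Plane → Plane}

theorem MemW12.isWeakPartial (h : MemW12 u) (i j : Fin 2) :
    IsWeakPartial j (fun x => u x i) (fun x => weakGrad u x i j) := by
  obtain ⟨g, -, hg⟩ := (h i).2 j
  exact isWeakPartial_weakPartial ⟨g, hg⟩

theorem MemW12.memLp_weakGrad (h : MemW12 u) (i j : Fin 2) :
    MemLp (fun x => weakGrad u x i j) 2 discMeasure := by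
  obtain ⟨g, hg, hw⟩ := (h i).2 j
  exact hg.ae_eq (hw.ae_eq (h.isWeakPartial i j))

theorem contDiff_coord {w : Plane → Plane} (h : ContDiff ℝ ∞ w) (i : Fin 2) :
    ContDiff ℝ ∞ fun x => w x i :=
  (EuclideanSpace.proj (𝕜 := ℝ) i).contDiff.comp h

theorem IsTest.coord {w : Plane → Plane} (h : IsTest w) (i : Fin 2) : IsTest fun x => w x i := by
  have hs : tsupport (fun x => w x i) ⊆ tsupport w :=
    closure_mono fun x hx hn => hx (by simp [hn])
  exact ⟨contDiff_coord h.1 i, h.2.1.of_isClosed_subset (isClosed_tsupport _) hs, hs.trans h.2.2⟩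

theorem TendstoW12.isH1Limit {w : ℕ → Plane → Plane} (h : TendstoW12 w u) (hu : MemW12 u)
    (hw : ∀ k, ContDiff ℝ ∞ (w k)) (i : Fin 2) :
    IsH1Limit (fun k x => w k x i) (fun x => u x i) (fun j x => weakGrad u x i j) where
  smooth k := contDiff_coord (hw k) i
  memLp := (hu i).1
  memLp_grad j := hu.memLp_weakGrad i j
  tendsto := tendsto_of_tendsto_of_tendsto_of_le_of_le tendsto_const_nhds h.1 (fun _ => zero_le)
    fun k => eLpNorm_mono fun x => by
      rw [Real.norm_eq_abs]
      exact abs_coord_le (w k x - u x) i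
  tendsto_grad j := h.2 i j

theorem HasTrace.exists_isH1Limit {h : ℝ → Plane} (ht : HasTrace u h) (hu : MemW12 u) :
    ∃ w : Fin 2 → ℕ → Plane → ℝ, ∀ i,
      IsH1Limit (w i) (fun x => u x i) (fun j x => weakGrad u x i j) := by
  obtain ⟨w, hw, hwu, -⟩ := ht
  exact ⟨fun i k x => w k x i, fun i => hwu.isH1Limit hu hw i⟩

theorem MemW012.exists_punctured (h : MemW012 η) :
    ∃ φ : Fin 2 → ℕ → Plane → ℝ, ∀ i, (∀ k, IsPuncturedTest (φ i k)) ∧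
      IsH1Limit (φ i) (fun x => η x i) (fun j x => weakGrad η x i j) := by
  obtain ⟨hη, w, hw, hwη⟩ := h
  choose φ hφ using fun i : Fin 2 =>
    (hwη.isH1Limit hη (fun k => (hw k).1) i).exists_punctured fun k => (hw k).coord i
  exact ⟨φ, hφ⟩

/-- Weak gradients are chosen representatives, so linearity holds only up to null sets. -/
theorem weakGrad_sub_ae (hv : MemW12 v) (hu : MemW12 u) (hd : MemW12 fun x => v x - u x) :
    ∀ᵐ x ∂discMeasure, ∀ i j,
      weakGrad (fun x => v x - u x) x i j = weakGrad v x i j - weakGrad u x i j := by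
  refine ae_all_iff.2 fun i => ae_all_iff.2 fun j => ?_
  have h1 := hv.isWeakPartial i j
  have h2 := hu.isWeakPartial i j
  refine (hd.isWeakPartial i j).ae_eq ⟨(hd.isWeakPartial i j).1, h1.2.1.sub h2.2.1, fun φ hφ => ?_⟩
  have hφm := memLp_of_continuous hφ.1.continuous 2
  have hφj := memLp_of_continuous (contDiff_partialDeriv hφ.1 j).continuous 2
  change ∫ x, (v x - u x) i * partialDeriv j φ x ∂discMeasure =
    -∫ x, (weakGrad v x i j - weakGrad u x i j) * φ x ∂discMeasure
  have e1 : ∫ x, v x i * partialDeriv j φ x ∂discMeasure =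
    -∫ x, weakGrad v x i j * φ x ∂discMeasure := h1.2.2 φ hφ
  have e2 : ∫ x, u x i * partialDeriv j φ x ∂discMeasure =
    -∫ x, weakGrad u x i j * φ x ∂discMeasure := h2.2.2 φ hφ
  simp only [PiLp.sub_apply, sub_mul]
  rw [integral_sub (integrable_mul_of_memLp (hv i).1 hφj) (integrable_mul_of_memLp (hu i).1 hφj),
    integral_sub (integrable_mul_of_memLp (hv.memLp_weakGrad i j) hφm)
      (integrable_mul_of_memLp (hu.memLp_weakGrad i j) hφm), e1, e2]
  ring

variable {h : Plane → ℝ} {p : Fin 2 → Plane → ℝ} {c : ℝ}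

theorem gradSize_nonneg (g : Fin 2 → Plane → ℝ) : 0 ≤ gradSize g :=
  add_nonneg (nrm_nonneg _) (nrm_nonneg _)

theorem gradSize_sub_le {f g : Fin 2 → Plane → ℝ} (hf : ∀ j, MemLp (f j) 2 discMeasure)
    (hg : ∀ j, MemLp (g j) 2 discMeasure) :
    gradSize (fun j x => f j x - g j x) ≤ gradSize f + gradSize g := by
  have h0 := nrm_sub_le (hf 0) (hg 0)
  have h1 := nrm_sub_le (hf 1) (hg 1)
  simp only [gradSize]
  linarith

theorem IsH1Limit.tendsto_gradSize_sub {w : ℕ → Plane → ℝ} {f : Plane → ℝ} {g : Fin 2 → Plane → ℝ}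
    (hw : IsH1Limit w f g) :
    Tendsto (fun k => gradSize fun j x => HFU.partialDeriv j (w k) x - g j x) atTop (𝓝 0) := by
  have := (hw.tendsto_grad 0).nrm_sub.add (hw.tendsto_grad 1).nrm_sub
  rwa [add_zero] at this

theorem IsH1Limit.memLp_partialDeriv {w : ℕ → Plane → ℝ} {f : Plane → ℝ} {g : Fin 2 → Plane → ℝ}
    (hw : IsH1Limit w f g) (k : ℕ) (j : Fin 2) : MemLp (HFU.partialDeriv j (w k)) 2 discMeasure :=
  memLp_of_continuous (contDiff_partialDeriv (hw.smooth k) j).continuous 2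

theorem LocBdd.jacForm_sub_right (hh : LocBdd h) {g : Fin 2 → Plane → ℝ}
    (hg : ∀ j, MemLp (g j) 2 discMeasure) {φ ψ : Plane → ℝ} (hφ : IsPuncturedTest φ)
    (hψ : IsPuncturedTest ψ) :
    jacForm h g (fun x => φ x - ψ x) = jacForm h g φ - jacForm h g ψ := by
  have hi : ∀ {φ : Plane → ℝ}, IsPuncturedTest φ → Integrable (fun x => h x *
      (g 0 x * partialDeriv 1 φ x - g 1 x * partialDeriv 0 φ x)) discMeasure := fun hφ =>
    ((integrable_mul_of_memLp (hh.memLp_mul_partialDeriv hφ 1) (hg 0)).sub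
      (integrable_mul_of_memLp (hh.memLp_mul_partialDeriv hφ 0) (hg 1))).congr
      (Eventually.of_forall fun x => by simp only [Pi.sub_apply]; ring)
  rw [jacForm, jacForm, jacForm, ← integral_sub (hi hφ) (hi hψ)]
  refine integral_congr_ae (Eventually.of_forall fun x => ?_)
  simp only [partialDeriv_sub hφ.1 hψ.1]
  ring

theorem LocBdd.jacForm_add_left (hh : LocBdd h) {g g' : Fin 2 → Plane → ℝ}
    (hg : ∀ j, MemLp (g j) 2 discMeasure) (hg' : ∀ j, MemLp (g' j) 2 discMeasure)
    {φ : Plane → ℝ} (hφ : IsPuncturedTest φ) (a b : ℝ) :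
    jacForm h (fun j x => a * g j x + b * g' j x) φ = a * jacForm h g φ + b * jacForm h g' φ := by
  have hi : ∀ {g : Fin 2 → Plane → ℝ}, (∀ j, MemLp (g j) 2 discMeasure) →
      Integrable (fun x => h x *
      (g 0 x * partialDeriv 1 φ x - g 1 x * partialDeriv 0 φ x)) discMeasure := fun hg =>
    ((integrable_mul_of_memLp (hh.memLp_mul_partialDeriv hφ 1) (hg 0)).sub
      (integrable_mul_of_memLp (hh.memLp_mul_partialDeriv hφ 0) (hg 1))).congr
      (Eventually.of_forall fun x => by simp only [Pi.sub_apply]; ring)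
  rw [jacForm, jacForm, jacForm, ← integral_const_mul, ← integral_const_mul,
    ← integral_add ((hi hg).const_mul a) ((hi hg').const_mul b)]
  refine integral_congr_ae (Eventually.of_forall fun x => ?_)
  simp only
  ring

/-- For bounded `h` the form extends continuously to gradients of `H¹` limits. -/
theorem PuncturedWeakGrad.abs_jacForm_sub_le (hp : PuncturedWeakGrad h p c) {B : ℝ}
    (hB : ∀ x, |h x| ≤ B) {w : ℕ → Plane → ℝ} {f : Plane → ℝ} {g : Fin 2 → Plane → ℝ}
    (hw : IsH1Limit w f g) {φ : ℕ → Plane → ℝ} {η : Plane → ℝ} {e : Fin 2 → Plane → ℝ}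
    (hφη : IsH1Limit φ η e) (hφ : ∀ k, IsPuncturedTest (φ k)) (k : ℕ) :
    |jacForm h g (φ k) - ∫ x, h x * (g 0 x * e 1 x - g 1 x * e 0 x) ∂discMeasure| ≤
      3 * c * (gradSize g * gradSize fun j x => partialDeriv j (φ k) x - e j x) := by
  have hc := hp.nonneg
  have hg : ∀ j, MemLp (fun x => h x * g j x) 2 discMeasure := fun j =>
    (hw.memLp_grad j).of_le_mul (c := B) (hp.locBdd.meas.mul (hw.memLp_grad j).1)
      (Eventually.of_forall fun x => by
        rw [norm_mul]; exact mul_le_mul_of_nonneg_right (hB x) (norm_nonneg _))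
  have hlim : Tendsto (fun l => jacForm h g (φ l)) atTop
      (𝓝 (∫ x, h x * (g 0 x * e 1 x - g 1 x * e 0 x) ∂discMeasure)) := by
    have t := ((hφη.tendsto_grad 1).integral_mul (fun l => hφη.memLp_partialDeriv l 1)
      (hφη.memLp_grad 1) (hg 0)).sub ((hφη.tendsto_grad 0).integral_mul
      (fun l => hφη.memLp_partialDeriv l 0) (hφη.memLp_grad 0) (hg 1))
    rw [← integral_sub (integrable_mul_of_memLp (hg 0) (hφη.memLp_grad 1))
      (integrable_mul_of_memLp (hg 1) (hφη.memLp_grad 0))] at t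
    refine (t.congr fun l => ?_).trans (le_of_eq ?_)
    · rw [← integral_sub (integrable_mul_of_memLp (hg 0) (hφη.memLp_partialDeriv l 1))
        (integrable_mul_of_memLp (hg 1) (hφη.memLp_partialDeriv l 0)), jacForm]
      exact integral_congr_ae (Eventually.of_forall fun x => by simp only; ring)
    · congr 1
      exact integral_congr_ae (Eventually.of_forall fun x => by simp only; ring)
  have hr : Tendsto (fun l => 3 * c * (gradSize g *
      ((gradSize fun j x => partialDeriv j (φ k) x - e j x) +
        gradSize fun j x => partialDeriv j (φ l) x - e j x))) atTop
      (𝓝 (3 * c * (gradSize g * ((gradSize fun j x => partialDeriv j (φ k) x - e j x) + 0)))) :=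
    ((hφη.tendsto_gradSize_sub.const_add _).const_mul _).const_mul _
  rw [add_zero] at hr
  -- The bilinear estimate is applied to φ k - φ l and l tends to infinity. The bound B on h serves
  -- only to identify the limit and is absent from the estimate.
  refine le_of_tendsto_of_tendsto' ((hlim.const_sub _).abs) hr fun l => ?_
  rw [← hp.locBdd.jacForm_sub_right hw.memLp_grad (hφ k) (hφ l)]
  refine (hp.abs_jacForm_le hw ((hφ k).sub (hφ l))).trans ?_
  refine mul_le_mul_of_nonneg_left (mul_le_mul_of_nonneg_left ?_ (gradSize_nonneg _)) (by positivity)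
  have hm : ∀ (l : ℕ) (j : Fin 2), MemLp (fun x => partialDeriv j (φ l) x - e j x) 2 discMeasure :=
    fun l j => (hφη.memLp_partialDeriv l j).sub (hφη.memLp_grad j)
  refine le_trans (le_of_eq ?_) (gradSize_sub_le (hm k) (hm l))
  congr 1
  funext j x
  rw [partialDeriv_sub (hφ k).1 (hφ l).1]
  ring

/-- Dominated convergence, the truncation never exceeding h in absolute value. -/
theorem tendsto_jacForm_sinTrunc (hh : LocBdd h) {g : Fin 2 → Plane → ℝ}
    (hg : ∀ j, MemLp (g j) 2 discMeasure) {φ : Plane → ℝ} (hφ : IsPuncturedTest φ) :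
    Tendsto (fun K => jacForm (fun x => sinTrunc K (h x)) g φ) atTop (𝓝 (jacForm h g φ)) := by
  have h1 := integrable_mul_of_memLp (hh.memLp_mul_partialDeriv hφ 1) (hg 0)
  have h0 := integrable_mul_of_memLp (hh.memLp_mul_partialDeriv hφ 0) (hg 1)
  have hm : AEStronglyMeasurable (fun x => g 0 x * partialDeriv 1 φ x -
      g 1 x * partialDeriv 0 φ x) discMeasure :=
    ((hg 0).1.mul (contDiff_partialDeriv hφ.1 1).continuous.aestronglyMeasurable).sub
      ((hg 1).1.mul (contDiff_partialDeriv hφ.1 0).continuous.aestronglyMeasurable)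
  refine tendsto_integral_of_dominated_convergence
    (fun x => |h x * partialDeriv 1 φ x * g 0 x - h x * partialDeriv 0 φ x * g 1 x|)
    (fun K => ((contDiff_sinTrunc K).continuous.comp_aestronglyMeasurable hh.meas).mul hm)
    (h1.sub h0).abs (fun K => Eventually.of_forall fun x => ?_)
    (Eventually.of_forall fun x => (tendsto_sinTrunc (h x)).mul_const _)
  rw [Real.norm_eq_abs, abs_mul]
  refine (mul_le_mul_of_nonneg_right (abs_sinTrunc_le_abs K (h x)) (abs_nonneg _)).trans
    (le_of_eq ?_)
  rw [← abs_mul]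
  congr 1
  ring

/-- If `cof G · e = 0`, the pressure pairing of `G` with approximations of `e` is small. -/
theorem PuncturedWeakGrad.abs_pairing_le (hp : PuncturedWeakGrad h p c)
    (hloc : LocallyIntegrableOn h disc) {w : Fin 2 → ℕ → Plane → ℝ} {f : Fin 2 → Plane → ℝ}
    {g : Fin 2 → Fin 2 → Plane → ℝ} (hw : ∀ i, IsH1Limit (w i) (f i) (g i))
    {φ : Fin 2 → ℕ → Plane → ℝ} {η : Fin 2 → Plane → ℝ} {e : Fin 2 → Fin 2 → Plane → ℝ}
    (hφη : ∀ i, IsH1Limit (φ i) (η i) (e i)) (hφ : ∀ i k, IsPuncturedTest (φ i k))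
    (hdet : ∀ᵐ x ∂discMeasure, g 0 0 x * e 1 1 x - g 0 1 x * e 1 0 x =
      g 1 0 x * e 0 1 x - g 1 1 x * e 0 0 x) (k : ℕ) :
    |jacForm h (g 0) (φ 1 k) - jacForm h (g 1) (φ 0 k)| ≤
      3 * c * (gradSize (g 0) * gradSize fun j x => partialDeriv j (φ 1 k) x - e 1 j x) +
      3 * c * (gradSize (g 1) * gradSize fun j x => partialDeriv j (φ 0 k) x - e 0 j x) := by
  refine le_of_tendsto ((tendsto_jacForm_sinTrunc hp.locBdd (hw 0).memLp_grad (hφ 1 k)).sub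
    (tendsto_jacForm_sinTrunc hp.locBdd (hw 1).memLp_grad (hφ 0 k))).abs
    (Eventually.of_forall fun K => ?_)
  -- The truncated pressure is bounded and has the same constant c, so the resulting estimate does
  -- not depend on K.
  have hK := hp.comp hloc (contDiff_sinTrunc K) (abs_sinTrunc_le K) (abs_deriv_sinTrunc_le K)
  have b1 := hK.abs_jacForm_sub_le (fun x => abs_sinTrunc_le K (h x)) (hw 0) (hφη 1) (hφ 1) k
  have b0 := hK.abs_jacForm_sub_le (fun x => abs_sinTrunc_le K (h x)) (hw 1) (hφη 0) (hφ 0) k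
  -- By `hdet` the two limiting integrals coincide and cancel in the difference; only the
  -- approximation errors remain.
  have heq : ∫ x, sinTrunc K (h x) * (g 0 0 x * e 1 1 x - g 0 1 x * e 1 0 x) ∂discMeasure =
      ∫ x, sinTrunc K (h x) * (g 1 0 x * e 0 1 x - g 1 1 x * e 0 0 x) ∂discMeasure :=
    integral_congr_ae (by filter_upwards [hdet] with x hx; rw [hx])
  rw [heq] at b1
  rw [abs_le] at b0 b1 ⊢
  constructor <;> linarith [b0.1, b0.2, b1.1, b1.2]

/-- The pressure term of the second order expansion of the constraint `det = 1`. -/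
theorem PuncturedWeakGrad.tendsto_pairing (hp : PuncturedWeakGrad h p c)
    (hloc : LocallyIntegrableOn h disc) {w : Fin 2 → ℕ → Plane → ℝ} {f : Fin 2 → Plane → ℝ}
    {g : Fin 2 → Fin 2 → Plane → ℝ} (hw : ∀ i, IsH1Limit (w i) (f i) (g i))
    {φ : Fin 2 → ℕ → Plane → ℝ} {η : Fin 2 → Plane → ℝ} {e : Fin 2 → Fin 2 → Plane → ℝ}
    (hφη : ∀ i, IsH1Limit (φ i) (η i) (e i)) (hφ : ∀ i k, IsPuncturedTest (φ i k))
    (hdet : ∀ᵐ x ∂discMeasure, (2 * g 0 0 x + e 0 0 x) * e 1 1 x - (2 * g 0 1 x + e 0 1 x) * e 1 0 x =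
      (2 * g 1 0 x + e 1 0 x) * e 0 1 x - (2 * g 1 1 x + e 1 1 x) * e 0 0 x) :
    Tendsto (fun k => 2 * (jacForm h (g 0) (φ 1 k) - jacForm h (g 1) (φ 0 k)) +
      2 * ∫ x, h x * jac (φ 0 k) (φ 1 k) x ∂discMeasure) atTop (𝓝 0) := by
  have hc := hp.nonneg
  have hW : ∀ i, IsH1Limit (fun k x => 2 * w i k x + 1 * φ i k x) (fun x => 2 * f i x + 1 * η i x)
      (fun j x => 2 * g i j x + 1 * e i j x) := fun i =>
    ((hw i).const_mul 2).add ((hφη i).const_mul 1)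
  -- The combination 2g + e is the one whose cofactor annihilates e exactly, by `hdet`; its pairing
  -- with φ k is therefore small although g and e separately need not give small pairings.
  have hA := hp.abs_pairing_le hloc hW hφη hφ (by simpa only [one_mul] using hdet)
  have t : ∀ i, Tendsto (fun k => gradSize fun j x => partialDeriv j (φ i k) x - e i j x) atTop
      (𝓝 0) := fun i => (hφη i).tendsto_gradSize_sub
  have hφk : ∀ i k, IsH1Limit (fun _ => φ i k) (φ i k) (fun j => partialDeriv j (φ i k)) :=
    fun i k => IsH1Limit.const (hφ i k).1
  have hdiff : ∀ i k, IsH1Limit (fun l x => φ i k x - φ i l x) (fun x => φ i k x - η i x)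
      (fun j x => partialDeriv j (φ i k) x - e i j x) := fun i k => (hφk i k).sub (hφη i)
  -- In the pairing of e with φ k, e is replaced by the gradient of φ k; the error is quadratic in
  -- gradient sizes with one factor tending to 0.
  have hB : ∀ i i' k, |jacForm h (fun j x => partialDeriv j (φ i k) x - e i j x) (φ i' k)| ≤
      3 * c * ((gradSize fun j x => partialDeriv j (φ i k) x - e i j x) *
        ((gradSize fun j x => partialDeriv j (φ i' k) x - e i' j x) + gradSize (e i'))) := by
    intro i i' k
    refine (hp.abs_jacForm_le (hdiff i k) (hφ i' k)).trans ?_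
    refine mul_le_mul_of_nonneg_left (mul_le_mul_of_nonneg_left ?_ (gradSize_nonneg _))
      (by positivity)
    have h0 := nrm_add_le ((hdiff i' k).memLp_grad 0) ((hφη i').memLp_grad 0)
    have h1 := nrm_add_le ((hdiff i' k).memLp_grad 1) ((hφη i').memLp_grad 1)
    simp only [sub_add_cancel] at h0 h1
    simp only [gradSize]
    change nrm (fun x => partialDeriv 0 (φ i' k) x) + nrm (fun x => partialDeriv 1 (φ i' k) x) ≤ _
    linarith
  have tB : ∀ i i', Tendsto (fun k =>
      3 * c * ((gradSize fun j x => partialDeriv j (φ i k) x - e i j x) *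
        ((gradSize fun j x => partialDeriv j (φ i' k) x - e i' j x) + gradSize (e i')))) atTop
      (𝓝 0) := fun i i' => by
    have := ((t i).mul ((t i').add_const (gradSize (e i')))).const_mul (3 * c)
    simpa using this
  have tA : Tendsto (fun k =>
      3 * c * (gradSize (fun j x => 2 * g 0 j x + 1 * e 0 j x) *
        gradSize fun j x => partialDeriv j (φ 1 k) x - e 1 j x) +
      3 * c * (gradSize (fun j x => 2 * g 1 j x + 1 * e 1 j x) *
        gradSize fun j x => partialDeriv j (φ 0 k) x - e 0 j x)) atTop (𝓝 0) := by
    have := (((t 1).const_mul (gradSize (fun j x => 2 * g 0 j x + 1 * e 0 j x))).const_mul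
      (3 * c)).add (((t 0).const_mul (gradSize (fun j x => 2 * g 1 j x + 1 * e 1 j x))).const_mul
      (3 * c))
    simpa using this
  have tt := (tA.add (tB 0 1)).add (tB 1 0)
  rw [add_zero, add_zero] at tt
  refine squeeze_zero_norm (fun k => ?_) tt
  have hA' := hA k
  rw [hp.locBdd.jacForm_add_left (hw 0).memLp_grad (hφη 0).memLp_grad (hφ 1 k),
    hp.locBdd.jacForm_add_left (hw 1).memLp_grad (hφη 1).memLp_grad (hφ 0 k)] at hA'
  have hsub : ∀ i i', jacForm h (fun j x => partialDeriv j (φ i k) x - e i j x) (φ i' k) =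
      jacForm h (fun j => partialDeriv j (φ i k)) (φ i' k) - jacForm h (e i) (φ i' k) := by
    intro i i'
    have := hp.locBdd.jacForm_add_left (hφk i k).memLp_grad (hφη i).memLp_grad (hφ i' k) 1 (-1)
    simp only [one_mul, neg_one_mul, ← sub_eq_add_neg] at this
    exact this
  have b01 := hB 0 1 k
  have b10 := hB 1 0 k
  rw [hsub] at b01 b10
  have e01 : jacForm h (fun j => partialDeriv j (φ 0 k)) (φ 1 k) =
      ∫ x, h x * jac (φ 0 k) (φ 1 k) x ∂discMeasure := rfl
  -- By antisymmetry the two pairings of e contribute the same Jacobian integral, which accounts for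
  -- the factor 2 in front of it.
  have e10 : jacForm h (fun j => partialDeriv j (φ 1 k)) (φ 0 k) =
      -∫ x, h x * jac (φ 0 k) (φ 1 k) x ∂discMeasure := by
    rw [jacForm, ← integral_neg]
    exact integral_congr_ae (Eventually.of_forall fun x => by simp only [jac]; ring)
  rw [e01] at b01
  rw [e10] at b10
  rw [Real.norm_eq_abs]
  rw [abs_le] at b01 b10 hA' ⊢
  constructor <;> linarith [b01.1, b01.2, b10.1, b10.2, hA'.1, hA'.2]

end HFU

/-! ### Expansion of the energy, the mixed term, Poincaré along rays -/

namespace HFU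

theorem tens_apply (T : Tensor4) (A : Mat2) (i j : Fin 2) :
    tens T A i j = ∑ k, ∑ l, T i j k l * A k l := rfl

/-- Symmetry of the tensor is what merges the two cross terms. -/
theorem frob_tens_add_self {T : Tensor4} (hT : ∀ i j k l, T i j k l = T k l i j) {A B C : Mat2}
    (hC : ∀ i j, C i j = A i j + B i j) :
    frob (tens T C) C = frob (tens T A) A + frob (tens T B) B + 2 * frob (tens T A) B := by
  simp only [frob, tens_apply, Fin.sum_univ_two, hC]
  rw [hT 0 1 0 0, hT 1 0 0 0, hT 1 1 0 0, hT 1 0 0 1, hT 1 1 0 1, hT 1 1 1 0]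
  ring

theorem frob_cof (A B : Mat2) : frob (cof A) B =
    (A 0 0 * B 1 1 - A 0 1 * B 1 0) - (A 1 0 * B 0 1 - A 1 1 * B 0 0) := by
  simp only [frob, cof, Matrix.adjugate_fin_two, Fin.sum_univ_two, Matrix.transpose_apply,
    Matrix.of_apply, Matrix.cons_val', Matrix.cons_val_zero, Matrix.cons_val_one,
    Matrix.cons_val_fin_one]
  ring

section Energy

variable {ν : ℝ} {M : Plane → Tensor4} {G H : Plane → Mat2}

theorem IsCoefficient.memLp_tens (hM : IsCoefficient ν M)
    (hG : ∀ i j, MemLp (fun x => G x i j) 2 discMeasure) (i j : Fin 2) :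
    MemLp (fun x => tens (M x) (G x) i j) 2 discMeasure := by
  simp only [tens_apply]
  refine memLp_finsetSum _ fun k _ => memLp_finsetSum _ fun l _ => ?_
  exact (hG k l).mul (hM.bounded i j k l)

theorem integrable_frob (hG : ∀ i j, MemLp (fun x => G x i j) 2 discMeasure)
    (hH : ∀ i j, MemLp (fun x => H x i j) 2 discMeasure) :
    Integrable (fun x => frob (G x) (H x)) discMeasure :=
  integrable_finsetSum _ fun i _ => integrable_finsetSum _ fun j _ =>
    integrable_mul_of_memLp (hG i j) (hH i j)

theorem integral_frob (hG : ∀ i j, MemLp (fun x => G x i j) 2 discMeasure)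
    (hH : ∀ i j, MemLp (fun x => H x i j) 2 discMeasure) :
    ∫ x, frob (G x) (H x) ∂discMeasure = ∑ i, ∑ j, ∫ x, G x i j * H x i j ∂discMeasure := by
  simp only [frob]
  rw [integral_finsetSum _ fun i _ => integrable_finsetSum _ fun j _ =>
    integrable_mul_of_memLp (hG i j) (hH i j)]
  refine Finset.sum_congr rfl fun i _ => ?_
  rw [integral_finsetSum _ fun j _ => integrable_mul_of_memLp (hG i j) (hH i j)]

theorem norm_sq_mul_sum_sq (g : Fin 2 → Plane → ℝ) (x : Plane) :
    ‖x‖ ^ 2 * (g 0 x ^ 2 + g 1 x ^ 2) = ang g x ^ 2 + radl g x ^ 2 := by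
  rw [norm_sq_eq, radl, ang]
  ring

/-- The squared `L²` norm of a gradient, split into angular and radial parts. -/
theorem integral_sum_sq_eq {g : Fin 2 → Plane → ℝ} (hg : ∀ j, MemLp (g j) 2 discMeasure) :
    ∑ j, ∫ x, g j x * g j x ∂discMeasure =
      nrm (fun x => ang g x / ‖x‖) ^ 2 + nrm (fun x => radl g x / ‖x‖) ^ 2 := by
  rw [sq_nrm (memLp_ang_div hg), sq_nrm (memLp_radl_div hg), Fin.sum_univ_two,
    ← integral_add (integrable_mul_of_memLp (hg 0) (hg 0)) (integrable_mul_of_memLp (hg 1) (hg 1)),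
    ← integral_add (memLp_ang_div hg).integrable_sq (memLp_radl_div hg).integrable_sq]
  refine integral_congr_ae ?_
  filter_upwards [ae_ne_zero] with x hx
  have hx' := norm_ne_zero_iff.2 hx
  rw [div_pow, div_pow, ← add_div, ← norm_sq_mul_sum_sq, mul_div_cancel_left₀ _ (pow_ne_zero 2 hx')]
  ring

/-- The square of the `L²` norm of the angular part of a gradient matrix. -/
noncomputable def angSq (G : Plane → Mat2) : ℝ :=
  ∑ i, nrm (fun x => ang (fun j y => G y i j) x / ‖x‖) ^ 2

/-- The square of the `L²` norm of the radial part of a gradient matrix. -/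
noncomputable def radSq (G : Plane → Mat2) : ℝ :=
  ∑ i, nrm (fun x => radl (fun j y => G y i j) x / ‖x‖) ^ 2

theorem IsCoefficient.le_integral_frob (hM : IsCoefficient ν M)
    (hG : ∀ i j, MemLp (fun x => G x i j) 2 discMeasure) :
    ν * (angSq G + radSq G) ≤ ∫ x, frob (tens (M x) (G x)) (G x) ∂discMeasure := by
  have e : angSq G + radSq G = ∫ x, frob (G x) (G x) ∂discMeasure := by
    rw [integral_frob hG hG, angSq, radSq, ← Finset.sum_add_distrib]
    exact Finset.sum_congr rfl fun i _ => (integral_sum_sq_eq (hG i)).symm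
  rw [e, ← integral_const_mul]
  refine integral_mono_ae ((integrable_frob hG hG).const_mul ν)
    (integrable_frob (hM.memLp_tens hG) hG) ?_
  filter_upwards [hM.elliptic] with x hx using hx (G x)

/-- The mixed term of the energy. -/
noncomputable def mixedEnergy (M : Plane → Tensor4) (u η : Plane → Plane) : ℝ :=
  ∫ x, frob (tens (M x) (weakGrad u x)) (weakGrad η x) ∂discMeasure

variable {u v : Plane → Plane}

/-- Quadratic expansion around u; ellipticity is applied to the quadratic term and the mixed term is
kept exactly. -/
theorem IsCoefficient.energy_ge (hM : IsCoefficient ν M) (hu : MemW12 u) (hv : MemW12 v)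
    (hd : MemW12 fun x => v x - u x) :
    energy M u + ν * (angSq (weakGrad fun x => v x - u x) + radSq (weakGrad fun x => v x - u x)) +
      2 * mixedEnergy M u (fun x => v x - u x) ≤ energy M v := by
  have hU := hu.memLp_weakGrad
  have hD := hd.memLp_weakGrad
  have e : energy M v = energy M u +
      ∫ x, frob (tens (M x) (weakGrad (fun x => v x - u x) x)) (weakGrad (fun x => v x - u x) x)
        ∂discMeasure + 2 * mixedEnergy M u (fun x => v x - u x) := by
    have hUi := integrable_frob (hM.memLp_tens hU) hU
    have hDi := integrable_frob (hM.memLp_tens hD) hD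
    have hUD := integrable_frob (hM.memLp_tens hU) hD
    rw [mixedEnergy, ← integral_const_mul]
    change ∫ x, _ ∂discMeasure = ∫ x, _ ∂discMeasure + _ + _
    rw [← integral_add hUi hDi, ← integral_add (show Integrable (fun x =>
      frob (tens (M x) (weakGrad u x)) (weakGrad u x) + frob (tens (M x)
        (weakGrad (fun x => v x - u x) x)) (weakGrad (fun x => v x - u x) x)) discMeasure from
      hUi.add hDi) (hUD.const_mul 2)]
    refine integral_congr_ae ?_
    filter_upwards [hM.symmetric, weakGrad_sub_ae hv hu hd] with x hx hg
    refine frob_tens_add_self hx fun i j => ?_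
    rw [hg i j]
    ring
  rw [e]
  have := hM.le_integral_frob hD
  linarith

end Energy

/-- The plane map with given coordinates. -/
def planeMap (φ : Fin 2 → Plane → ℝ) (x : Plane) : Plane := !₂[φ 0 x, φ 1 x]

theorem planeMap_apply (φ : Fin 2 → Plane → ℝ) (x : Plane) (i : Fin 2) :
    planeMap φ x i = φ i x := by
  fin_cases i <;> rfl

theorem isTest_planeMap {φ : Fin 2 → Plane → ℝ} (h : ∀ i, IsTest (φ i)) : IsTest (planeMap φ) := by
  have hs : tsupport (planeMap φ) ⊆ tsupport (φ 0) ∪ tsupport (φ 1) := by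
    refine closure_minimal (fun x hx => ?_) ((isClosed_tsupport _).union (isClosed_tsupport _))
    by_contra hn
    rw [mem_union, not_or] at hn
    refine hx (plane_ext ?_ ?_)
    · rw [planeMap_apply, image_eq_zero_of_notMem_tsupport hn.1]; rfl
    · rw [planeMap_apply, image_eq_zero_of_notMem_tsupport hn.2]; rfl
  refine ⟨?_, (IsCompact.union (h 0).2.1 (h 1).2.1).of_isClosed_subset (isClosed_tsupport _) hs,
    hs.trans (union_subset (h 0).2.2 (h 1).2.2)⟩
  rw [contDiff_euclidean]
  intro i
  simp only [planeMap_apply]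
  exact (h i).1

theorem classicalGrad_planeMap (φ : Fin 2 → Plane → ℝ) (x : Plane) (i j : Fin 2) :
    classicalGrad (planeMap φ) x i j = partialDeriv j (φ i) x := by
  simp only [classicalGrad, Matrix.of_apply, planeMap_apply]

/-- The Euler-Lagrange equation and the determinant constraint express the mixed energy through
Jacobians of punctured test functions. -/
theorem IsStationaryWithPressure.tendsto_jac {ν : ℝ} {M : Plane → Tensor4}
    (hM : IsCoefficient ν M) {u v : Plane → Plane} {lam : Plane → ℝ} {q : Fin 2 → Plane → ℝ} {c : ℝ}
    (hst : IsStationaryWithPressure M u lam) (hp : PuncturedWeakGrad lam q c)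
    (hu : MemW12 u) {t : ℝ → Plane} (hut : HasTrace u t) (hv : MemW12 v)
    (hdu : ∀ᵐ x ∂discMeasure, (weakGrad u x).det = 1)
    (hdv : ∀ᵐ x ∂discMeasure, (weakGrad v x).det = 1) (hd : MemW12 fun x => v x - u x)
    {φ : Fin 2 → ℕ → Plane → ℝ} (hφ : ∀ i k, IsPuncturedTest (φ i k))
    (hφη : ∀ i, IsH1Limit (φ i) (fun x => v x i - u x i)
      (fun j x => weakGrad (fun x => v x - u x) x i j)) :
    Tendsto (fun k => 2 * ∫ x, lam x * jac (φ 0 k) (φ 1 k) x ∂discMeasure) atTop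
      (𝓝 (2 * mixedEnergy M u (fun x => v x - u x))) := by
  obtain ⟨w, hw⟩ := hut.exists_isH1Limit hu
  have hloc : LocallyIntegrableOn lam disc := by
    obtain ⟨g, hg⟩ := hst.1 0
    exact hg.1
  -- With G = ∇u and e = ∇v - ∇u, the required identity is 2(det(G + e) - det G) = 0.
  have key := hp.tendsto_pairing hloc hw hφη hφ (by
    filter_upwards [hdu, hdv, weakGrad_sub_ae hv hu hd] with x h1 h2 h3
    rw [Matrix.det_fin_two] at h1 h2
    simp only [h3]
    linear_combination 2 * h2 - 2 * h1)
  have hA := hM.memLp_tens hu.memLp_weakGrad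
  have hT : Tendsto (fun k => ∫ x, frob (tens (M x) (weakGrad u x))
      (classicalGrad (planeMap fun i => φ i k) x) ∂discMeasure) atTop
      (𝓝 (mixedEnergy M u (fun x => v x - u x))) := by
    rw [mixedEnergy, integral_frob hA hd.memLp_weakGrad]
    have e : ∀ k, ∫ x, frob (tens (M x) (weakGrad u x))
        (classicalGrad (planeMap fun i => φ i k) x) ∂discMeasure =
        ∑ i, ∑ j, ∫ x, tens (M x) (weakGrad u x) i j * partialDeriv j (φ i k) x ∂discMeasure := by
      intro k
      rw [integral_frob hA fun i j => by
        simp only [classicalGrad_planeMap]; exact (hφη i).memLp_partialDeriv k j]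
      simp only [classicalGrad_planeMap]
    simp only [e]
    exact tendsto_finsetSum _ fun i _ => tendsto_finsetSum _ fun j _ =>
      ((hφη i).tendsto_grad j).integral_mul (fun k => (hφη i).memLp_partialDeriv k j)
        ((hφη i).memLp_grad j) (hA i j)
  -- The Euler-Lagrange equation is applied to the smooth approximants, for which it is available,
  -- rather than to v - u.
  have hE : ∀ k, ∫ x, frob (tens (M x) (weakGrad u x))
      (classicalGrad (planeMap fun i => φ i k) x) ∂discMeasure =
      -(jacForm lam (fun j x => weakGrad u x 0 j) (φ 1 k) -
        jacForm lam (fun j x => weakGrad u x 1 j) (φ 0 k)) := by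
    intro k
    refine (hst.2 _ (isTest_planeMap fun i => (hφ i k).isTest)).trans ?_
    have hU := hu.memLp_weakGrad
    have hi : ∀ i i', Integrable (fun x => lam x * (weakGrad u x i 0 * partialDeriv 1 (φ i' k) x -
        weakGrad u x i 1 * partialDeriv 0 (φ i' k) x)) discMeasure := fun i i' =>
      ((integrable_mul_of_memLp (hp.locBdd.memLp_mul_partialDeriv (hφ i' k) 1) (hU i 0)).sub
      (integrable_mul_of_memLp (hp.locBdd.memLp_mul_partialDeriv (hφ i' k) 0) (hU i 1))).congr
      (Eventually.of_forall fun x => by simp only [Pi.sub_apply]; ring)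
    rw [jacForm, jacForm, ← integral_sub (hi 0 1) (hi 1 0)]
    congr 1
    refine integral_congr_ae (Eventually.of_forall fun x => ?_)
    simp only [frob_cof, classicalGrad_planeMap]
    ring
  have hfin := key.add (hT.const_mul 2)
  rw [zero_add] at hfin
  refine hfin.congr fun k => ?_
  rw [hE]
  ring

theorem weakGrad_zero_ae : ∀ᵐ x ∂discMeasure, ∀ i j, weakGrad (fun _ => 0) x i j = 0 := by
  refine ae_all_iff.2 fun i => ae_all_iff.2 fun j => ?_
  have h0 : IsWeakPartial j (fun x : Plane => (0 : Plane) i) 0 :=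
    ⟨by simpa using locallyIntegrableOn_zero, locallyIntegrableOn_zero, fun φ _ => by simp⟩
  exact (isWeakPartial_weakPartial ⟨_, h0⟩).ae_eq h0

theorem memW012_zero : MemW012 fun _ => 0 := by
  refine ⟨fun i => ⟨by simp, fun j => ⟨0, MemLp.zero, ?_, locallyIntegrableOn_zero, fun φ _ => by simp⟩⟩,
    fun _ _ => 0, fun k => ⟨contDiff_const, HasCompactSupport.zero, by simp⟩, by simp, fun i j => ?_⟩
  · simpa using locallyIntegrableOn_zero
  · have : eLpNorm (fun x => classicalGrad (fun _ => 0) x i j - weakGrad (fun _ => 0) x i j) 2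
        discMeasure = 0 := by
      rw [eLpNorm_congr_ae (g := 0), eLpNorm_zero]
      filter_upwards [weakGrad_zero_ae] with x hx
      simp [hx, classicalGrad, partialDeriv]
    simp only [this]
    exact tendsto_const_nhds

theorem eqSumOfModes_zero (S : Set ℕ) : EqSumOfModes (fun _ => 0) S := by
  have : ∀ j x, fourierMode (fun _ => 0) j x = 0 := fun j x => by
    simp [fourierMode, cosCoeff, sinCoeff]
  simp [EqSumOfModes, this]

theorem mem_competitors_self {g : ℝ → Plane} {b : Plane} {u : Plane → Plane}
    (hu : u ∈ admissible g b) (S : Set ℕ) : u ∈ competitors g b u S := by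
  refine ⟨hu, ?_, ?_⟩
  · simpa only [sub_self] using memW012_zero
  · simpa only [sub_self] using eqSumOfModes_zero S

/-- The Poincaré inequality with only the radial derivative. -/
theorem nrm_le_nrm_radl {φ : ℕ → Plane → ℝ} {f : Plane → ℝ} {e : Fin 2 → Plane → ℝ}
    (h : IsH1Limit φ f e) (hφ : ∀ k, IsTest (φ k)) : nrm f ^ 2 ≤ nrm f * nrm (radl e) := by
  have hm : ∀ k, MemLp (φ k) 2 discMeasure := fun k =>
    memLp_of_continuous (h.smooth k).continuous 2
  have hr : ∀ k, MemLp (radl fun j => partialDeriv j (φ k)) 2 discMeasure := fun k =>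
    memLp_radl fun j => h.memLp_partialDeriv k j
  refine le_of_tendsto_of_tendsto' ((h.tendsto.nrm hm h.memLp).pow 2)
    ((h.tendsto.nrm hm h.memLp).mul ((tendstoL2_radl h).nrm hr (memLp_radl h.memLp_grad)))
    fun k => ?_
  have hc : ∀ j : Fin 2, ContDiff ℝ ∞ fun x : Plane => x j := fun j =>
    contDiff_coord contDiff_id j
  have hd : ∀ j : Fin 2, ∀ x : Plane, partialDeriv j (fun y : Plane => y j) x = 1 := by
    intro j x
    have : fderiv ℝ (fun y : Plane => y j) x = EuclideanSpace.proj (𝕜 := ℝ) j :=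
      (EuclideanSpace.proj (𝕜 := ℝ) j).fderiv
    rw [partialDeriv, this]
    simp
  -- The integral of ∂_j(x_j φ²) vanishes. Summing over the two coordinates yields ∫ φ² = -∫ φ
  -- (x·∇φ), so only the radial derivative is needed.
  have ibp : ∀ j : Fin 2, 2 * ∫ x, x j * partialDeriv j (φ k) x * φ k x ∂discMeasure =
      -∫ x, φ k x * φ k x ∂discMeasure := by
    intro j
    have e := integral_mul_partialDeriv ((hc j).mul (h.smooth k)) (hφ k) j
    have i1 : Integrable (fun x => x j * partialDeriv j (φ k) x * φ k x) discMeasure :=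
      integrable_mul_of_memLp (memLp_coord_mul (h.memLp_partialDeriv k j) j) (hm k)
    have e2 : ∫ x, partialDeriv j (fun y => y j * φ k y) x * φ k x ∂discMeasure =
        ∫ x, x j * partialDeriv j (φ k) x * φ k x ∂discMeasure +
          ∫ x, φ k x * φ k x ∂discMeasure := by
      rw [← integral_add i1 (integrable_mul_of_memLp (hm k) (hm k))]
      refine integral_congr_ae (Eventually.of_forall fun x => ?_)
      simp only [partialDeriv_mul (hc j) (h.smooth k), hd]
      ring
    have e1 : ∫ x, x j * φ k x * partialDeriv j (φ k) x ∂discMeasure =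
        ∫ x, x j * partialDeriv j (φ k) x * φ k x ∂discMeasure :=
      integral_congr_ae (Eventually.of_forall fun x => by simp only; ring)
    change ∫ x, x j * φ k x * partialDeriv j (φ k) x ∂discMeasure =
      -∫ x, partialDeriv j (fun y => y j * φ k y) x * φ k x ∂discMeasure at e
    rw [e1, e2] at e
    linarith
  have hs : ∫ x, φ k x ^ 2 ∂discMeasure =
      -∫ x, φ k x * radl (fun j => partialDeriv j (φ k)) x ∂discMeasure := by
    have i0 : ∀ j : Fin 2, Integrable (fun x => x j * partialDeriv j (φ k) x * φ k x) discMeasure :=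
      fun j => integrable_mul_of_memLp (memLp_coord_mul (h.memLp_partialDeriv k j) j) (hm k)
    have e : ∫ x, φ k x * radl (fun j => partialDeriv j (φ k)) x ∂discMeasure =
        ∫ x, x 0 * partialDeriv 0 (φ k) x * φ k x ∂discMeasure +
          ∫ x, x 1 * partialDeriv 1 (φ k) x * φ k x ∂discMeasure := by
      rw [← integral_add (i0 0) (i0 1)]
      refine integral_congr_ae (Eventually.of_forall fun x => ?_)
      simp only [radl]
      ring
    rw [e]
    have h0 := ibp 0
    have h1 := ibp 1
    simp only [sq]
    linarith
  rw [sq_nrm (hm k), hs]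
  refine (neg_le_abs _).trans ?_
  have := abs_integral_le_of_abs_le
    (F := fun x => φ k x * radl (fun j => partialDeriv j (φ k)) x) zero_le_one (hm k) (hr k)
    (Eventually.of_forall fun x => by rw [abs_mul, one_mul])
  rwa [one_mul] at this

end HFU

/-! ### Sharp polar bounds for the pressure term -/

namespace HFU

/-- The pointwise Euclidean length of a pair of functions. -/
noncomputable def pairNorm (f g : Plane → ℝ) (x : Plane) : ℝ := √(f x ^ 2 + g x ^ 2)

section PairNorm

variable {f g : Plane → ℝ}

theorem sq_pairNorm (f g : Plane → ℝ) (x : Plane) : pairNorm f g x ^ 2 = f x ^ 2 + g x ^ 2 :=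
  Real.sq_sqrt (by positivity)

theorem pairNorm_nonneg (f g : Plane → ℝ) (x : Plane) : 0 ≤ pairNorm f g x := Real.sqrt_nonneg _

theorem memLp_pairNorm (hf : MemLp f 2 discMeasure) (hg : MemLp g 2 discMeasure) :
    MemLp (pairNorm f g) 2 discMeasure := by
  refine MemLp.mono' (g := fun x => |f x| + |g x|) (hf.abs.add hg.abs)
    (Real.continuous_sqrt.comp_aestronglyMeasurable ((hf.1.pow 2).add (hg.1.pow 2)))
    (Eventually.of_forall fun x => ?_)
  rw [Real.norm_eq_abs, abs_of_nonneg (pairNorm_nonneg f g x)]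
  refine Real.sqrt_le_iff.2 ⟨by positivity, ?_⟩
  nlinarith [sq_abs (f x), sq_abs (g x), mul_nonneg (abs_nonneg (f x)) (abs_nonneg (g x))]

theorem nrm_pairNorm (hf : MemLp f 2 discMeasure) (hg : MemLp g 2 discMeasure) :
    nrm (pairNorm f g) = √(nrm f ^ 2 + nrm g ^ 2) := by
  rw [← Real.sqrt_sq (nrm_nonneg (pairNorm f g)), sq_nrm (memLp_pairNorm hf hg), sq_nrm hf,
    sq_nrm hg, ← integral_add hf.integrable_sq hg.integrable_sq]
  simp only [sq_pairNorm]

end PairNorm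

/-- Pairing the two components of the variation as plane vectors, instead of estimating them one by
one, is what keeps the constants sharp. -/
theorem abs_cross_le (o₀ o₁ a₀ a₁ : ℝ) :
    |o₁ * a₀ - o₀ * a₁| ≤ √(o₀ ^ 2 + o₁ ^ 2) * √(a₀ ^ 2 + a₁ ^ 2) := by
  rw [← Real.sqrt_mul (by positivity)]
  exact Real.abs_le_sqrt (by nlinarith [sq_nonneg (o₀ * a₀ + o₁ * a₁)])

/-- The radial derivative of `f` plus that of its circle mean. -/
noncomputable def radlMean (f : Plane → ℝ) (x : Plane) : ℝ :=
  (radl (fun j => partialDeriv j f) x + circleMean (radl fun j => partialDeriv j f) x) / ‖x‖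

section Bounds

variable {h : Plane → ℝ} {p : Fin 2 → Plane → ℝ} {c : ℝ} {f φ : Plane → ℝ}

theorem PuncturedWeakGrad.integrable_mul_crossGrad (hp : PuncturedWeakGrad h p c)
    (hφ : IsPuncturedTest φ) (hf : ContDiff ℝ ∞ f) :
    Integrable (fun x => φ x * crossGrad p f x) discMeasure := by
  refine (((hp.locBdd_grad 0).integrable_mul_test
    (hφ.smooth_mul (contDiff_partialDeriv hf 1))).sub
    ((hp.locBdd_grad 1).integrable_mul_test
    (hφ.smooth_mul (contDiff_partialDeriv hf 0)))).congr (Eventually.of_forall fun x => ?_)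
  simp only [crossGrad, Pi.sub_apply]
  ring

/-- The cross product is written in polar components, where the circle mean has no angular part. Of
the resulting factor |x|⁻², one power goes to the oscillation and one to the derivatives. -/
theorem mul_crossGrad_add_eq (hf : ContDiff ℝ ∞ f) {x : Plane} (hx : x ≠ 0) :
    (φ x - circleMean φ x) * (crossGrad p f x + crossGrad p (circleMean f) x) =
      osc φ x * (radl p x * (ang (fun j => partialDeriv j f) x / ‖x‖) - ang p x * radlMean f x) := by
  have hx' := norm_ne_zero_iff.2 hx
  have h1 := norm_sq_mul_cross p (fun j => partialDeriv j f) x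
  have h2 := norm_sq_mul_cross p (fun j => partialDeriv j (circleMean f)) x
  rw [ang_circleMean hf, radl_circleMean hf, mul_zero, zero_sub] at h2
  have e : crossGrad p f x + crossGrad p (circleMean f) x =
      (radl p x * ang (fun j => partialDeriv j f) x - ang p x * (radl (fun j => partialDeriv j f) x +
        circleMean (radl fun j => partialDeriv j f) x)) / ‖x‖ ^ 2 := by
    rw [eq_div_iff (pow_ne_zero 2 hx'), crossGrad, crossGrad]
    linear_combination h1 + h2
  rw [e, osc, radlMean]
  field_simp

/-- Polar form of the quadratic pressure term. -/
theorem PuncturedWeakGrad.two_mul_integral_jac (hp : PuncturedWeakGrad h p c)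
    (hf : IsPuncturedTest f) (hφ : IsPuncturedTest φ) :
    2 * ∫ x, h x * jac f φ x ∂discMeasure =
      ∫ x, (radl p x * (osc φ x * (ang (fun j => partialDeriv j f) x / ‖x‖) -
          osc f x * (ang (fun j => partialDeriv j φ) x / ‖x‖)) -
        ang p x * (osc φ x * radlMean f x - osc f x * radlMean φ x)) ∂discMeasure := by
  -- The Jacobian is antisymmetric, so twice the integral is the formula for (f, φ) minus that for
  -- (φ, f). This treats both components alike and pairs each derivative with that of its mean.
  have hs : ∫ x, h x * jac f φ x ∂discMeasure = -∫ x, h x * jac φ f x ∂discMeasure := by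
    rw [← integral_neg]
    exact integral_congr_ae (Eventually.of_forall fun x => by simp only [jac]; ring)
  have h1 := hp.integral_jac hf.1 hφ
  have h2 := hp.integral_jac hφ.1 hf
  have cf := contDiff_circleMean hf.1
  have cφ := contDiff_circleMean hφ.1
  have tf := hf.sub hf.circleMean
  have tφ := hφ.sub hφ.circleMean
  have i1 := hp.integrable_mul_crossGrad tf hφ.1
  have i2 := hp.integrable_mul_crossGrad tφ cf
  have i3 := hp.integrable_mul_crossGrad tφ hf.1
  have i4 := hp.integrable_mul_crossGrad tf cφ
  have e : ∫ x, (radl p x * (osc φ x * (ang (fun j => partialDeriv j f) x / ‖x‖) -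
          osc f x * (ang (fun j => partialDeriv j φ) x / ‖x‖)) -
        ang p x * (osc φ x * radlMean f x - osc f x * radlMean φ x)) ∂discMeasure =
      ∫ x, (((φ x - circleMean φ x) * crossGrad p f x +
        (φ x - circleMean φ x) * crossGrad p (circleMean f) x) -
        ((f x - circleMean f x) * crossGrad p φ x +
        (f x - circleMean f x) * crossGrad p (circleMean φ) x)) ∂discMeasure := by
    refine integral_congr_ae ?_
    filter_upwards [ae_ne_zero] with x hx
    rw [← mul_add, ← mul_add, mul_crossGrad_add_eq hf.1 hx, mul_crossGrad_add_eq hφ.1 hx]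
    ring
  have i32 : Integrable (fun x => (φ x - circleMean φ x) * crossGrad p f x +
    (φ x - circleMean φ x) * crossGrad p (circleMean f) x) discMeasure := i3.add i2
  have i14 : Integrable (fun x => (f x - circleMean f x) * crossGrad p φ x +
    (f x - circleMean f x) * crossGrad p (circleMean φ) x) discMeasure := i1.add i4
  rw [e, integral_sub i32 i14, integral_add i3 i2, integral_add i1 i4]
  linarith

theorem memLp_ang_partialDeriv_div (hf : ContDiff ℝ ∞ f) :
    MemLp (fun x => ang (fun j => partialDeriv j f) x / ‖x‖) 2 discMeasure :=
  memLp_ang_div fun j => memLp_of_continuous (contDiff_partialDeriv hf j).continuous 2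

theorem memLp_radl_partialDeriv_div (hf : ContDiff ℝ ∞ f) :
    MemLp (fun x => radl (fun j => partialDeriv j f) x / ‖x‖) 2 discMeasure :=
  memLp_radl_div fun j => memLp_of_continuous (contDiff_partialDeriv hf j).continuous 2

theorem radlMean_eq (f : Plane → ℝ) : radlMean f = fun x =>
    radl (fun j => partialDeriv j f) x / ‖x‖ +
      circleMean (fun y => radl (fun j => partialDeriv j f) y / ‖y‖) x := by
  funext x
  rw [circleMean_div_norm, radlMean, add_div]

theorem memLp_radlMean (hf : ContDiff ℝ ∞ f) : MemLp (radlMean f) 2 discMeasure := by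
  rw [radlMean_eq]
  exact (memLp_radl_partialDeriv_div hf).add (memLp_circleMean (memLp_radl_partialDeriv_div hf))

theorem nrm_radlMean_le (hf : ContDiff ℝ ∞ f) : nrm (radlMean f) ≤
    nrm (fun x => radl (fun j => partialDeriv j f) x / ‖x‖) +
      nrm (circleMean fun x => radl (fun j => partialDeriv j f) x / ‖x‖) := by
  rw [radlMean_eq]
  exact nrm_add_le (memLp_radl_partialDeriv_div hf)
    (memLp_circleMean (memLp_radl_partialDeriv_div hf))

/-- Bound of the quadratic pressure term by the two polar components of the pressure gradient. -/
theorem PuncturedWeakGrad.abs_two_mul_integral_jac_le_of_components (hp : PuncturedWeakGrad h p c)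
    (hf : IsPuncturedTest f) (hφ : IsPuncturedTest φ) {C : ℝ} (hC : 0 ≤ C)
    (hb : ∀ᵐ x ∂discMeasure, |radl p x| ≤ C ∧ |ang p x| ≤ C) :
    |2 * ∫ x, h x * jac f φ x ∂discMeasure| ≤ C * (√(nrm (osc f) ^ 2 + nrm (osc φ) ^ 2) *
      (√(nrm (fun x => ang (fun j => partialDeriv j f) x / ‖x‖) ^ 2 +
          nrm (fun x => ang (fun j => partialDeriv j φ) x / ‖x‖) ^ 2) +
        √(nrm (radlMean f) ^ 2 + nrm (radlMean φ) ^ 2))) := by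
  have of := (IsH1Limit.const hf.1).memLp_osc
  have oφ := (IsH1Limit.const hφ.1).memLp_osc
  have af := memLp_ang_partialDeriv_div hf.1
  have aφ := memLp_ang_partialDeriv_div hφ.1
  have rf := memLp_radlMean hf.1
  have rφ := memLp_radlMean hφ.1
  rw [hp.two_mul_integral_jac hf hφ, ← nrm_pairNorm of oφ, ← nrm_pairNorm af aφ,
    ← nrm_pairNorm rf rφ]
  refine (abs_integral_le_of_abs_le hC (memLp_pairNorm of oφ)
    ((memLp_pairNorm af aφ).add (memLp_pairNorm rf rφ)) ?_).trans
    (mul_le_mul_of_nonneg_left (mul_le_mul_of_nonneg_left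
      (nrm_add_le (memLp_pairNorm af aφ) (memLp_pairNorm rf rφ)) (nrm_nonneg _)) hC)
  filter_upwards [hb] with x hx
  rw [Pi.add_apply, abs_of_nonneg (pairNorm_nonneg _ _ x),
    abs_of_nonneg (add_nonneg (pairNorm_nonneg _ _ x) (pairNorm_nonneg _ _ x)), mul_add, mul_add]
  refine (abs_sub _ _).trans ?_
  rw [abs_mul, abs_mul]
  exact add_le_add (mul_le_mul hx.1 (abs_cross_le _ _ _ _) (abs_nonneg _) hC)
    (mul_le_mul hx.2 (abs_cross_le _ _ _ _) (abs_nonneg _) hC)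

/-- Bound of the quadratic pressure term by the length of the pressure gradient. -/
theorem PuncturedWeakGrad.abs_two_mul_integral_jac_le_of_length (hp : PuncturedWeakGrad h p c)
    (hf : IsPuncturedTest f) (hφ : IsPuncturedTest φ) {C : ℝ} (hC : 0 ≤ C)
    (hb : ∀ᵐ x ∂discMeasure, ang p x ^ 2 + radl p x ^ 2 ≤ C ^ 2) :
    |2 * ∫ x, h x * jac f φ x ∂discMeasure| ≤ C * (√(nrm (osc f) ^ 2 + nrm (osc φ) ^ 2) *
      √((nrm (fun x => ang (fun j => partialDeriv j f) x / ‖x‖) ^ 2 +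
          nrm (fun x => ang (fun j => partialDeriv j φ) x / ‖x‖) ^ 2) +
        (nrm (radlMean f) ^ 2 + nrm (radlMean φ) ^ 2))) := by
  have of := (IsH1Limit.const hf.1).memLp_osc
  have oφ := (IsH1Limit.const hφ.1).memLp_osc
  have af := memLp_ang_partialDeriv_div hf.1
  have aφ := memLp_ang_partialDeriv_div hφ.1
  have rf := memLp_radlMean hf.1
  have rφ := memLp_radlMean hφ.1
  have hsq : ∀ s t : ℝ, s ^ 2 + t ^ 2 = √(s ^ 2 + t ^ 2) ^ 2 := fun s t =>
    (Real.sq_sqrt (by positivity)).symm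
  rw [hp.two_mul_integral_jac hf hφ, ← nrm_pairNorm of oφ]
  rw [hsq (nrm fun x => ang (fun j => partialDeriv j f) x / ‖x‖), hsq (nrm (radlMean f)),
    ← nrm_pairNorm af aφ, ← nrm_pairNorm rf rφ,
    ← nrm_pairNorm (memLp_pairNorm af aφ) (memLp_pairNorm rf rφ)]
  refine abs_integral_le_of_abs_le hC (memLp_pairNorm of oφ)
    (memLp_pairNorm (memLp_pairNorm af aφ) (memLp_pairNorm rf rφ)) ?_
  filter_upwards [hb] with x hx
  rw [abs_of_nonneg (pairNorm_nonneg _ _ x), abs_of_nonneg (pairNorm_nonneg _ _ x)]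
  refine abs_le_of_sq_le_sq ?_ (mul_nonneg hC (mul_nonneg (pairNorm_nonneg _ _ x)
    (pairNorm_nonneg _ _ x)))
  rw [mul_pow, mul_pow, sq_pairNorm, sq_pairNorm, sq_pairNorm, sq_pairNorm]
  -- Cauchy-Schwarz is used twice: between the polar components of the pressure gradient and those
  -- of the variation, and then between the two components of the map.
  have hcs : ∀ s t u v : ℝ, (s * u - t * v) ^ 2 ≤ (t ^ 2 + s ^ 2) * (u ^ 2 + v ^ 2) :=
    fun s t u v => by nlinarith [sq_nonneg (s * v + t * u)]
  refine (hcs _ _ _ _).trans (mul_le_mul hx ?_ (by positivity) (by positivity))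
  rw [mul_add]
  refine add_le_add ?_ ?_ <;>
  · refine (hcs _ _ _ _).trans (le_of_eq ?_)
    ring

end Bounds

section Limits

variable {w : ℕ → Plane → ℝ} {f : Plane → ℝ} {g : Fin 2 → Plane → ℝ}

theorem TendstoL2.of_nrm_le {w : ℕ → Plane → ℝ} {f : Plane → ℝ}
    (hw : ∀ k, MemLp (w k) 2 discMeasure) (hf : MemLp f 2 discMeasure) {b : ℕ → ℝ}
    (hb : Tendsto b atTop (𝓝 0)) (h : ∀ k, HFU.nrm (fun x => w k x - f x) ≤ b k) : TendstoL2 w f :=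
  tendstoL2_of_nrm hw hf (squeeze_zero (fun _ => nrm_nonneg _) h hb)

theorem circleMean_sub_ae {f g : Plane → ℝ} (hf : MemLp f 2 discMeasure)
    (hg : MemLp g 2 discMeasure) : ∀ᵐ x ∂discMeasure,
      circleMean (fun y => f y - g y) x = circleMean f x - circleMean g x := by
  filter_upwards [ae_radial (sliceCoeff_sub (k := 1) measurable_one (by simp) hf hg)] with x hx
  rw [circleMean_eq_sliceCoeff, circleMean_eq_sliceCoeff, circleMean_eq_sliceCoeff, hx, mul_sub]

theorem TendstoL2.circleMean (h : TendstoL2 w f) (hw : ∀ k, MemLp (w k) 2 discMeasure)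
    (hf : MemLp f 2 discMeasure) :
    TendstoL2 (fun k => HFU.circleMean (w k)) (HFU.circleMean f) := by
  refine TendstoL2.of_nrm_le (fun k => memLp_circleMean (hw k)) (memLp_circleMean hf) h.nrm_sub
    fun k => ?_
  refine le_trans (le_of_eq (nrm_congr ?_)) (nrm_circleMean_le ((hw k).sub hf))
  filter_upwards [circleMean_sub_ae (hw k) hf] with x hx
  exact hx.symm

theorem nrm_ang_div_le {g : Fin 2 → Plane → ℝ} (hg : ∀ j, MemLp (g j) 2 discMeasure) :
    nrm (fun x => ang g x / ‖x‖) ≤ gradSize g := by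
  have a0 : MemLp (fun x => |g 0 x|) 2 discMeasure := (hg 0).abs
  have a1 : MemLp (fun x => |g 1 x|) 2 discMeasure := (hg 1).abs
  have h2 : nrm (fun x => ang g x / ‖x‖) ≤ nrm (fun x => |g 0 x| + |g 1 x|) :=
    nrm_mono (a0.add a1) (Eventually.of_forall fun x => by
      rw [abs_of_nonneg (a := |g 0 x| + |g 1 x|) (by positivity)]; exact abs_ang_div_le g x)
  refine h2.trans ((nrm_add_le a0 a1).trans (le_of_eq ?_))
  rw [nrm_abs, nrm_abs, gradSize]

theorem IsH1Limit.tendsto_ang_div (h : IsH1Limit w f g) :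
    TendstoL2 (fun k x => ang (fun j => HFU.partialDeriv j (w k)) x / ‖x‖)
      (fun x => ang g x / ‖x‖) := by
  refine TendstoL2.of_nrm_le (fun k => memLp_ang_partialDeriv_div (h.smooth k))
    (memLp_ang_div h.memLp_grad) h.tendsto_gradSize_sub fun k => ?_
  refine le_trans (le_of_eq ?_) (nrm_ang_div_le
    (g := fun j x => HFU.partialDeriv j (w k) x - g j x) fun j =>
    (h.memLp_partialDeriv k j).sub (h.memLp_grad j))
  congr 1
  funext x
  simp only [ang]
  ring

theorem IsH1Limit.tendsto_radl_div (h : IsH1Limit w f g) :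
    TendstoL2 (fun k x => radl (fun j => HFU.partialDeriv j (w k)) x / ‖x‖)
      (fun x => radl g x / ‖x‖) := by
  refine TendstoL2.of_nrm_le (fun k => memLp_radl_partialDeriv_div (h.smooth k))
    (memLp_radl_div h.memLp_grad) h.tendsto_gradSize_sub fun k => ?_
  refine le_trans (le_of_eq ?_) (nrm_radl_div_le
    (g := fun j x => HFU.partialDeriv j (w k) x - g j x) fun j =>
    (h.memLp_partialDeriv k j).sub (h.memLp_grad j))
  congr 1
  funext x
  simp only [radl]
  ring

theorem IsH1Limit.tendsto_osc (h : IsH1Limit w f g) : TendstoL2 (fun k => osc (w k)) (osc f) := by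
  refine TendstoL2.of_nrm_le (fun k => (IsH1Limit.const (h.smooth k)).memLp_osc) h.memLp_osc
    h.tendsto_gradSize_sub fun k => ?_
  refine le_trans (le_of_eq (nrm_congr ?_)) ((IsH1Limit.const (h.smooth k)).sub h).nrm_osc_le
  filter_upwards [circleMean_sub_ae (memLp_of_continuous (h.smooth k).continuous 2) h.memLp]
    with x hx
  rw [osc, osc, osc, hx]
  ring

/-- Maps with vanishing circle means have radial derivatives with vanishing circle means. -/
theorem IsH1Limit.circleMean_radl_eq_zero (h : IsH1Limit w f g)
    (h0 : ∀ᵐ x ∂discMeasure, circleMean f x = 0) :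
    ∀ᵐ x ∂discMeasure, circleMean (radl g) x = 0 := by
  have hr : ∀ k, MemLp (radl fun j => HFU.partialDeriv j (w k)) 2 discMeasure := fun k =>
    memLp_radl fun j => h.memLp_partialDeriv k j
  have hm := memLp_circleMean (memLp_radl h.memLp_grad)
  have hopen : IsOpen disc := Metric.isOpen_ball
  suffices hv : ∀ᵐ x ∂(volume : Measure Plane), x ∈ disc → circleMean (radl g) x = 0 by
    rw [discMeasure, ae_restrict_iff' hopen.measurableSet]
    exact hv
  have hint : IntegrableOn (circleMean (radl g)) disc :=
    hm.integrable (μ := discMeasure) (by norm_num)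
  refine hopen.ae_eq_zero_of_integral_contDiff_smul_eq_zero hint.locallyIntegrableOn ?_
  intro ψ hψ hψc hψs
  have hψt : IsTest ψ := ⟨hψ, hψc, hψs⟩
  have hψm := memLp_of_continuous hψ.continuous 2
  rw [← integral_discMeasure_eq fun x hx => by rw [hψt.eq_zero hx, zero_smul]]
  have hc : ∀ j : Fin 2, ContDiff ℝ ∞ fun x : Plane => x j := fun j =>
    contDiff_coord contDiff_id j
  have tj : ∀ j : Fin 2, IsTest fun x => x j * ψ x := fun j => by
    have hs : tsupport (fun x : Plane => x j * ψ x) ⊆ tsupport ψ :=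
      closure_mono fun x hx hn => hx (by simp [hn])
    exact ⟨(hc j).mul hψ, hψc.of_isClosed_subset (isClosed_tsupport _) hs, hs.trans hψs⟩
  -- Weakly, the mean of the radial derivative is the radial derivative of the mean: tested with ψ
  -- it becomes minus the mean of w k tested with ∂₀(x₀ψ) + ∂₁(x₁ψ), which tends to 0.
  have lim1 := (((h.tendsto.circleMean (fun k => memLp_of_continuous (h.smooth k).continuous 2)
    h.memLp).integral_mul (fun k => memLp_circleMean
      (memLp_of_continuous (h.smooth k).continuous 2)) (memLp_circleMean h.memLp)
    (memLp_of_continuous ((tj 0).pderiv 0).1.continuous 2)).add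
    ((h.tendsto.circleMean (fun k => memLp_of_continuous (h.smooth k).continuous 2)
    h.memLp).integral_mul (fun k => memLp_circleMean
      (memLp_of_continuous (h.smooth k).continuous 2)) (memLp_circleMean h.memLp)
    (memLp_of_continuous ((tj 1).pderiv 1).1.continuous 2))).neg
  have lim2 := ((tendstoL2_radl h).circleMean hr (memLp_radl h.memLp_grad)).integral_mul
    (fun k => memLp_circleMean (hr k)) hm hψm
  have hz : ∀ a : Plane → ℝ, ∫ x, a x * circleMean f x ∂discMeasure = 0 := fun a =>
    integral_eq_zero_of_ae (by filter_upwards [h0] with x hx; simp [hx])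
  rw [hz, hz, add_zero, neg_zero] at lim1
  refine tendsto_nhds_unique lim2 (lim1.congr fun k => ?_)
  have hcm := contDiff_circleMean (h.smooth k)
  have e0 := integral_mul_partialDeriv hcm (tj 0) 0
  have e1 := integral_mul_partialDeriv hcm (tj 1) 1
  have i : ∀ j, Integrable (fun x => HFU.partialDeriv j (HFU.circleMean (w k)) x * (x j * ψ x))
      discMeasure := fun j => integrable_mul_of_memLp
    (memLp_of_continuous (contDiff_partialDeriv hcm j).continuous 2)
    (memLp_of_continuous (tj j).1.continuous 2)
  have e2 : ∫ x, ψ x * HFU.circleMean (radl fun j => HFU.partialDeriv j (w k)) x ∂discMeasure =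
      ∫ x, HFU.partialDeriv 0 (HFU.circleMean (w k)) x * (x 0 * ψ x) ∂discMeasure +
      ∫ x, HFU.partialDeriv 1 (HFU.circleMean (w k)) x * (x 1 * ψ x) ∂discMeasure := by
    rw [← radl_circleMean (h.smooth k), ← integral_add (i 0) (i 1)]
    refine integral_congr_ae (Eventually.of_forall fun x => ?_)
    simp only [radl]
    ring
  rw [e2]
  simp only [mul_comm _ (HFU.circleMean (w k) _)]
  linarith

end Limits

section LimitBounds

variable {h : Plane → ℝ} {p : Fin 2 → Plane → ℝ} {c C L : ℝ} {φ : Fin 2 → ℕ → Plane → ℝ}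
  {η : Fin 2 → Plane → ℝ} {e : Fin 2 → Fin 2 → Plane → ℝ}

theorem IsH1Limit.tendsto_nrm_bounds {w : ℕ → Plane → ℝ} {f : Plane → ℝ} {g : Fin 2 → Plane → ℝ}
    (h : IsH1Limit w f g) :
    Tendsto (fun k => nrm (osc (w k))) atTop (𝓝 (nrm (osc f))) ∧
    Tendsto (fun k => nrm (fun x => ang (fun j => HFU.partialDeriv j (w k)) x / ‖x‖)) atTop
      (𝓝 (nrm fun x => ang g x / ‖x‖)) ∧
    Tendsto (fun k => nrm (fun x => radl (fun j => HFU.partialDeriv j (w k)) x / ‖x‖) +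
      nrm (circleMean fun x => radl (fun j => HFU.partialDeriv j (w k)) x / ‖x‖)) atTop
      (𝓝 (nrm (fun x => radl g x / ‖x‖) + nrm (circleMean fun x => radl g x / ‖x‖))) := by
  have hr := fun k => memLp_radl_partialDeriv_div (h.smooth k)
  have hg := memLp_radl_div h.memLp_grad
  exact ⟨h.tendsto_osc.nrm (fun k => (IsH1Limit.const (h.smooth k)).memLp_osc) h.memLp_osc,
    h.tendsto_ang_div.nrm (fun k => memLp_ang_partialDeriv_div (h.smooth k))
      (memLp_ang_div h.memLp_grad),
    (h.tendsto_radl_div.nrm hr hg).add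
      ((h.tendsto_radl_div.circleMean hr hg).nrm (fun k => memLp_circleMean (hr k))
        (memLp_circleMean hg))⟩

/-- The factor 2 on the radial part comes from the circle mean, whose radial derivative is at most
as large as that of the map. -/
theorem PuncturedWeakGrad.abs_limit_le_of_components (hp : PuncturedWeakGrad h p c)
    (hφη : ∀ i, IsH1Limit (φ i) (η i) (e i)) (hφ : ∀ i k, IsPuncturedTest (φ i k))
    (hL : Tendsto (fun k => 2 * ∫ x, h x * jac (φ 0 k) (φ 1 k) x ∂discMeasure) atTop (𝓝 L))
    (hC : 0 ≤ C) (hb : ∀ᵐ x ∂discMeasure, |radl p x| ≤ C ∧ |ang p x| ≤ C) :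
    |L| ≤ C * (√(nrm (osc (η 0)) ^ 2 + nrm (osc (η 1)) ^ 2) *
      (√(nrm (fun x => ang (e 0) x / ‖x‖) ^ 2 + nrm (fun x => ang (e 1) x / ‖x‖) ^ 2) +
        2 * √(nrm (fun x => radl (e 0) x / ‖x‖) ^ 2 + nrm (fun x => radl (e 1) x / ‖x‖) ^ 2))) := by
  obtain ⟨o0, a0, r0⟩ := (hφη 0).tendsto_nrm_bounds
  obtain ⟨o1, a1, r1⟩ := (hφη 1).tendsto_nrm_bounds
  have lim := ((((o0.pow 2).add (o1.pow 2)).sqrt).mul ((((a0.pow 2).add (a1.pow 2)).sqrt).add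
    (((r0.pow 2).add (r1.pow 2)).sqrt))).const_mul C
  refine (le_of_tendsto_of_tendsto' hL.abs lim fun k => ?_).trans ?_
  · refine (hp.abs_two_mul_integral_jac_le_of_components (hφ 0 k) (hφ 1 k) hC hb).trans ?_
    have h0 := nrm_radlMean_le (hφ 0 k).1
    have h1 := nrm_radlMean_le (hφ 1 k).1
    have n0 := nrm_nonneg (radlMean (φ 0 k))
    have n1 := nrm_nonneg (radlMean (φ 1 k))
    gcongr
  · have h2 : ∀ i, nrm (fun x => radl (e i) x / ‖x‖) + nrm (circleMean fun x => radl (e i) x / ‖x‖)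
        ≤ 2 * nrm (fun x => radl (e i) x / ‖x‖) := fun i => by
      have := nrm_circleMean_le (memLp_radl_div (hφη i).memLp_grad)
      linarith
    have h3 : ∀ i, 0 ≤ nrm (fun x => radl (e i) x / ‖x‖) +
        nrm (circleMean fun x => radl (e i) x / ‖x‖) := fun i =>
      add_nonneg (nrm_nonneg _) (nrm_nonneg _)
    have h4 : 2 * √(nrm (fun x => radl (e 0) x / ‖x‖) ^ 2 + nrm (fun x => radl (e 1) x / ‖x‖) ^ 2) =
        √((2 * nrm (fun x => radl (e 0) x / ‖x‖)) ^ 2 +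
          (2 * nrm (fun x => radl (e 1) x / ‖x‖)) ^ 2) := by
      rw [mul_pow, mul_pow, ← mul_add, Real.sqrt_mul (by positivity), Real.sqrt_sq (by norm_num)]
    rw [h4]
    have h20 := h2 0
    have h21 := h2 1
    have h30 := h3 0
    have h31 := h3 1
    gcongr

/-- The approximants may have nonzero circle means, but the contribution of these tends to 0 because
the limit has none; so no factor 2 appears. -/
theorem PuncturedWeakGrad.abs_limit_le_of_length (hp : PuncturedWeakGrad h p c)
    (hφη : ∀ i, IsH1Limit (φ i) (η i) (e i)) (hφ : ∀ i k, IsPuncturedTest (φ i k))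
    (hL : Tendsto (fun k => 2 * ∫ x, h x * jac (φ 0 k) (φ 1 k) x ∂discMeasure) atTop (𝓝 L))
    (h0 : ∀ i, ∀ᵐ x ∂discMeasure, circleMean (η i) x = 0)
    (hC : 0 ≤ C) (hb : ∀ᵐ x ∂discMeasure, ang p x ^ 2 + radl p x ^ 2 ≤ C ^ 2) :
    |L| ≤ C * (√(nrm (osc (η 0)) ^ 2 + nrm (osc (η 1)) ^ 2) *
      √((nrm (fun x => ang (e 0) x / ‖x‖) ^ 2 + nrm (fun x => ang (e 1) x / ‖x‖) ^ 2) +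
        (nrm (fun x => radl (e 0) x / ‖x‖) ^ 2 + nrm (fun x => radl (e 1) x / ‖x‖) ^ 2))) := by
  obtain ⟨o0, a0, r0⟩ := (hφη 0).tendsto_nrm_bounds
  obtain ⟨o1, a1, r1⟩ := (hφη 1).tendsto_nrm_bounds
  have hz : ∀ i, nrm (circleMean fun x => radl (e i) x / ‖x‖) = 0 := fun i => by
    rw [nrm_congr (g := 0), nrm, eLpNorm_zero, ENNReal.toReal_zero]
    filter_upwards [(hφη i).circleMean_radl_eq_zero (h0 i)] with x hx
    rw [circleMean_div_norm, hx, zero_div, Pi.zero_apply]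
  rw [hz, add_zero] at r0 r1
  have lim := ((((o0.pow 2).add (o1.pow 2)).sqrt).mul ((((a0.pow 2).add (a1.pow 2)).add
    ((r0.pow 2).add (r1.pow 2))).sqrt)).const_mul C
  refine le_of_tendsto_of_tendsto' hL.abs lim fun k => ?_
  refine (hp.abs_two_mul_integral_jac_le_of_length (hφ 0 k) (hφ 1 k) hC hb).trans ?_
  have h0 := nrm_radlMean_le (hφ 0 k).1
  have h1 := nrm_radlMean_le (hφ 1 k).1
  have n0 := nrm_nonneg (radlMean (φ 0 k))
  have n1 := nrm_nonneg (radlMean (φ 1 k))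
  gcongr

end LimitBounds

end HFU

/-! ### Pressure bounds, energy gap and conclusion -/

namespace HFU

/-- The density 1/|x| is positive off the origin, so a dx/R-null set is dx-null. -/
theorem ae_discMeasure_of_radialMeasure {P : Plane → Prop} (h : ∀ᵐ x ∂radialMeasure, P x) :
    ∀ᵐ x ∂discMeasure, P x := by
  refine (withDensity_absolutelyContinuous' (f := fun x : Plane => ENNReal.ofReal (1 / ‖x‖))
    (measurable_norm.const_div 1).ennreal_ofReal.aemeasurable ?_).ae_le h
  filter_upwards [ae_ne_zero] with x hx
  have := norm_pos_iff.2 hx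
  exact (ENNReal.ofReal_pos.2 (by positivity)).ne'

theorem ae_norm_le_of_eLpNorm_top_le {E : Type*} [NormedAddCommGroup E] {f : Plane → E} {c : ℝ}
    (hc : 0 ≤ c) (h : eLpNorm f ⊤ radialMeasure ≤ ENNReal.ofReal c) :
    ∀ᵐ x ∂discMeasure, ‖f x‖ ≤ c := by
  refine ae_discMeasure_of_radialMeasure ?_
  rw [eLpNorm_exponent_top] at h
  filter_upwards [ae_le_eLpNormEssSup (f := f) (μ := radialMeasure)] with x hx
  have := hx.trans h
  rwa [← ofReal_norm, ENNReal.ofReal_le_ofReal_iff hc] at this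

section Pressure

variable {lam : Plane → ℝ}

theorem scaledGradRad_eq {x : Plane} (hx : x ≠ 0) :
    scaledGradRad lam x = radl (fun j => weakPartial j lam) x := by
  have hx' := norm_ne_zero_iff.2 hx
  simp only [scaledGradRad, scaledGrad, eRad, weakGradScalar, inner_smul_left, inner_smul_right,
    PiLp.inner_apply, Fin.sum_univ_two, radl]
  simp
  field_simp

theorem scaledGradAng_eq {x : Plane} (hx : x ≠ 0) :
    scaledGradAng lam x = ang (fun j => weakPartial j lam) x := by
  have hx' := norm_ne_zero_iff.2 hx
  simp only [scaledGradAng, scaledGrad, eAng, weakGradScalar, inner_smul_left, inner_smul_right,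
    PiLp.inner_apply, Fin.sum_univ_two, ang]
  simp
  field_simp
  ring

theorem sq_norm_scaledGrad (x : Plane) : ‖scaledGrad lam x‖ ^ 2 =
    ang (fun j => weakPartial j lam) x ^ 2 + radl (fun j => weakPartial j lam) x ^ 2 := by
  rw [← norm_sq_mul_sum_sq, scaledGrad, norm_smul, mul_pow, norm_norm, norm_sq_eq (weakGradScalar _ _)]
  simp [weakGradScalar]

theorem puncturedWeakGrad_weakPartial (h : ∀ j, ∃ g, IsWeakPartial j lam g) {C : ℝ} (hC : 0 ≤ C)
    (hb : ∀ᵐ x ∂discMeasure,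
      ang (fun j => weakPartial j lam) x ^ 2 + radl (fun j => weakPartial j lam) x ^ 2 ≤ C ^ 2) :
    PuncturedWeakGrad lam (fun j => weakPartial j lam) C := by
  refine puncturedWeakGrad_of_isWeakPartial (fun j => isWeakPartial_weakPartial (h j)) ?_
  filter_upwards [hb] with x hx j
  rw [← norm_sq_mul_sum_sq] at hx
  refine abs_le_of_sq_le_sq' (a := |weakPartial j lam x| * ‖x‖) ?_ hC |>.2
  rw [mul_pow, sq_abs]
  refine le_trans ?_ hx
  rw [mul_comm]
  refine mul_le_mul_of_nonneg_left ?_ (sq_nonneg _)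
  fin_cases j
  · exact le_add_of_nonneg_right (sq_nonneg _)
  · exact le_add_of_nonneg_left (sq_nonneg _)

end Pressure

theorem ae_eq_zero_of_nrm_eq_zero {f : Plane → ℝ} (hf : MemLp f 2 discMeasure) (h : nrm f = 0) :
    f =ᵐ[discMeasure] 0 := by
  rw [nrm, ENNReal.toReal_eq_zero_iff, or_iff_left hf.2.ne,
    eLpNorm_eq_zero_iff hf.1 two_ne_zero] at h
  exact h

theorem radSq_nonneg (G : Plane → Mat2) : 0 ≤ radSq G := Finset.sum_nonneg fun _ _ => sq_nonneg _

theorem angSq_nonneg (G : Plane → Mat2) : 0 ≤ angSq G := Finset.sum_nonneg fun _ _ => sq_nonneg _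

/-- A `W_0^{1,2}` map without radial derivative vanishes. -/
theorem MemW012.ae_eq_zero {η : Plane → Plane} (h : MemW012 η) (h0 : radSq (weakGrad η) = 0) :
    ∀ᵐ x ∂discMeasure, η x = 0 := by
  obtain ⟨φ, hφ⟩ := h.exists_punctured
  have key : ∀ i, (fun x => η x i) =ᵐ[discMeasure] 0 := by
    intro i
    have hg := h.1.memLp_weakGrad i
    have h1 : nrm (fun x => radl (fun j y => weakGrad η y i j) x / ‖x‖) = 0 :=
      pow_eq_zero_iff two_ne_zero |>.1
        ((Finset.sum_eq_zero_iff_of_nonneg fun _ _ => sq_nonneg _).1 h0 i (Finset.mem_univ i))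
    have h2 : nrm (radl fun j y => weakGrad η y i j) = 0 := by
      rw [nrm_congr (g := 0), nrm, eLpNorm_zero, ENNReal.toReal_zero]
      filter_upwards [ae_eq_zero_of_nrm_eq_zero (memLp_radl_div hg) h1, ae_ne_zero] with x hx hx0
      exact (div_eq_zero_iff.1 hx).resolve_right (norm_ne_zero_iff.2 hx0)
    have h3 := nrm_le_nrm_radl (hφ i).2 fun k => ((hφ i).1 k).isTest
    rw [h2, mul_zero] at h3
    exact ae_eq_zero_of_nrm_eq_zero (h.1 i).1
      (pow_eq_zero_iff two_ne_zero |>.1 (le_antisymm h3 (sq_nonneg _)))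
  filter_upwards [key 0, key 1] with x h0 h1
  exact plane_ext h0 h1

/-- The oscillation of a map without low modes is controlled by its angular derivative. -/
theorem MemW012.mul_sqrt_osc_le {η : Plane → Plane} (h : MemW012 η) {m : ℕ}
    (hm : ∀ i, LowModesVanish (fun x => η x i) m) :
    m * √(nrm (osc fun x => η x 0) ^ 2 + nrm (osc fun x => η x 1) ^ 2) ≤
      √(angSq (weakGrad η)) := by
  obtain ⟨φ, hφ⟩ := h.exists_punctured
  have h0 := (hφ 0).2.wirtinger (hm 0)
  have h1 := (hφ 1).2.wirtinger (hm 1)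
  have n0 := nrm_nonneg (osc fun x => η x 0)
  have n1 := nrm_nonneg (osc fun x => η x 1)
  refine Real.le_sqrt_of_sq_le ?_
  rw [mul_pow, Real.sq_sqrt (by positivity), angSq, Fin.sum_univ_two, mul_add, ← mul_pow, ← mul_pow]
  gcongr

/-- With |L| ≤ ν√X√(X + V) the gap is at least ν√(X + V)(√(X + V) - √X). It can vanish only if V =
0. -/
theorem energy_gap_of_length {ν X V O L n : ℝ} (hν : 0 < ν) (hX : 0 ≤ X) (hn : n * √O ≤ √X)
    (hV : 0 ≤ V) (hL : |L| ≤ n * ν * (√O * √(X + V))) :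
    0 ≤ ν * (X + V) + L ∧ (ν * (X + V) + L ≤ 0 → V = 0) := by
  have hS : 0 ≤ √(X + V) := Real.sqrt_nonneg _
  have hX' : 0 ≤ √X := Real.sqrt_nonneg _
  have h1 : n * ν * (√O * √(X + V)) ≤ ν * (√X * √(X + V)) := by
    have := mul_le_mul_of_nonneg_left hn (mul_nonneg hν.le hS)
    linarith
  have hsq : √(X + V) * √(X + V) = X + V := Real.mul_self_sqrt (by positivity)
  have hXS : √X ≤ √(X + V) := Real.sqrt_le_sqrt (by linarith)
  have h2 := (abs_le.1 hL).1
  have h3 : 0 ≤ ν * (√(X + V) * (√(X + V) - √X)) :=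
    mul_nonneg hν.le (mul_nonneg hS (sub_nonneg.2 hXS))
  have h4 : ν * (√(X + V) * (√(X + V) - √X)) ≤ ν * (X + V) + L := by
    rw [mul_sub, hsq]
    linarith
  refine ⟨h3.trans h4, fun h5 => ?_⟩
  have h6 : ν * (√(X + V) * (√(X + V) - √X)) = 0 := le_antisymm (h4.trans h5) h3
  rcases mul_eq_zero.1 h6 with h | h
  · exact absurd h hν.ne'
  rcases mul_eq_zero.1 h with h | h
  · have := (Real.sqrt_eq_zero (by positivity)).1 h
    linarith
  · have := Real.sqrt_inj (by positivity) hX |>.1 (sub_eq_zero.1 h)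
    linarith

/-- With a = √X, b = √V and |L| ≤ kν a(a + 2b), completing the square in b gives a gap of at least
ν((b - ka)² + (1 - k - k²)a²). -/
theorem energy_gap_of_components {ν X V O L m : ℝ} (hν : 0 < ν) (hX : 0 ≤ X)
    (hm : m * √O ≤ √X) (hV : 0 ≤ V)
    (hL : |L| ≤ √3 * m * ν / (2 * √2) * (√O * (√X + 2 * √V))) :
    0 ≤ ν * (X + V) + L ∧ (ν * (X + V) + L ≤ 0 → V = 0) := by
  set k : ℝ := √3 / (2 * √2) with hk
  have hk0 : 0 ≤ k := by positivity
  have hk2 : k ^ 2 = 3 / 8 := by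
    rw [hk, div_pow, mul_pow, Real.sq_sqrt (by norm_num), Real.sq_sqrt (by norm_num)]
    norm_num
  -- Since k² = 3/8 and 0.6125² exceeds 3/8, this gives 1 - k - k² ≥ 0.0125.
  have hk1 : k ≤ 0.6125 := abs_le_of_sq_le_sq' (by rw [hk2]; norm_num) (by norm_num) |>.2
  set a := √X
  set b := √V
  have ha : 0 ≤ a := Real.sqrt_nonneg _
  have hb : 0 ≤ b := Real.sqrt_nonneg _
  have haX : X = a ^ 2 := (Real.sq_sqrt hX).symm
  have hbV : V = b ^ 2 := (Real.sq_sqrt hV).symm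
  have h1 : √3 * m * ν / (2 * √2) * (√O * (a + 2 * b)) ≤ ν * (k * a * (a + 2 * b)) := by
    have e : √3 * m * ν / (2 * √2) * (√O * (a + 2 * b)) =
        (ν * k * (a + 2 * b)) * (m * √O) := by
      rw [hk]; ring
    rw [e]
    have := mul_le_mul_of_nonneg_left hm (show 0 ≤ ν * k * (a + 2 * b) by positivity)
    linarith
  have h2 := (abs_le.1 hL).1
  have h3 : ν * ((b - k * a) ^ 2 + (1 - k - k ^ 2) * a ^ 2) ≤ ν * (X + V) + L := by
    rw [haX, hbV]
    linarith
  have hpos : 0 < 1 - k - k ^ 2 := by rw [hk2]; linarith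
  have h4 : 0 ≤ ν * ((b - k * a) ^ 2 + (1 - k - k ^ 2) * a ^ 2) := by positivity
  refine ⟨h4.trans h3, fun h5 => ?_⟩
  have h6 : ν * ((b - k * a) ^ 2 + (1 - k - k ^ 2) * a ^ 2) = 0 := le_antisymm (h3.trans h5) h4
  have h7 := (mul_eq_zero.1 h6).resolve_left hν.ne'
  have h8 : (1 - k - k ^ 2) * a ^ 2 = 0 := by
    nlinarith [sq_nonneg (b - k * a), mul_nonneg hpos.le (sq_nonneg a)]
  have ha0 : a = 0 := pow_eq_zero_iff two_ne_zero |>.1 ((mul_eq_zero.1 h8).resolve_left hpos.ne')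
  rw [ha0] at h7
  rw [hbV]
  linarith

section Main

variable {ν : ℝ} {M : Plane → Tensor4} {g : ℝ → Plane} {b : Plane} {u : Plane → Plane}
  {lam : Plane → ℝ}

/-- Another minimizer has energy at most that of u, so its gap is nonpositive and V = 0; the
difference lies in W_0^{1,2} and must vanish. -/
theorem isMinimizer_and_unique {S : Set ℕ} (hu : u ∈ admissible g b)
    (hM : IsCoefficient ν M)
    (h : ∀ v ∈ competitors g b u S,
      let A := angSq (weakGrad fun x => v x - u x)
      let V := radSq (weakGrad fun x => v x - u x)
      let L := 2 * mixedEnergy M u fun x => v x - u x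
      0 ≤ ν * (A + V) + L ∧ (ν * (A + V) + L ≤ 0 → V = 0)) :
    IsMinimizer M (competitors g b u S) u ∧ IsUniqueMinimizer M (competitors g b u S) u := by
  have hself := mem_competitors_self hu S
  have hge : ∀ v ∈ competitors g b u S, _ := fun v hv =>
    hM.energy_ge hu.1 hv.1.1 hv.2.1.1
  have hmin : IsMinimizer M (competitors g b u S) u :=
    ⟨hself, fun v hv => by linarith [hge v hv, (h v hv).1]⟩
  refine ⟨hmin, hmin, fun v hv => ?_⟩
  have h0 := (h v hv.1).2 (by linarith [hge v hv.1, hv.2 u hself])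
  filter_upwards [hv.1.2.1.ae_eq_zero h0] with x hx
  exact sub_eq_zero.1 hx

theorem highModes_main (hν : 0 < ν) (hM : IsCoefficient ν M) (hu : u ∈ admissible g b)
    (hlam : IsStationaryWithPressure M u lam) (n : ℕ)
    (hn : supNorm lam ≤ ENNReal.ofReal (n * ν)) :
    IsMinimizer M (highModes g b u n) u ∧ IsUniqueMinimizer M (highModes g b u n) u := by
  have hC : 0 ≤ n * ν := by positivity
  have hb : ∀ᵐ x ∂discMeasure, ang (fun j => weakPartial j lam) x ^ 2 +
      radl (fun j => weakPartial j lam) x ^ 2 ≤ (n * ν) ^ 2 := by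
    filter_upwards [ae_norm_le_of_eLpNorm_top_le hC hn] with x hx
    rw [← sq_norm_scaledGrad]
    exact pow_le_pow_left₀ (norm_nonneg _) hx 2
  have hp := puncturedWeakGrad_weakPartial hlam.1 hC hb
  refine isMinimizer_and_unique hu hM fun v hv => ?_
  obtain ⟨φ, hφ⟩ := hv.2.1.exists_punctured
  have hL := hlam.tendsto_jac hM hp hu.1 hu.2.2 hv.1.1 hu.2.1 hv.1.2.1 hv.2.1.1
    (fun i => (hφ i).1) fun i => (hφ i).2
  have hη : ∀ i, MemLp (fun x => (v x - u x) i) 2 discMeasure := fun i => (hv.2.1.1 i).1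
  have hlow := hv.2.1.mul_sqrt_osc_le (m := n)
    (hv.2.2.lowModesVanish hη fun j _ hj hjS => absurd hj (not_lt.2 hjS))
  refine energy_gap_of_length hν (angSq_nonneg _) hlow (radSq_nonneg _) ?_
  -- For n = 0 the mean mode is allowed, so the bound for vanishing circle means is unavailable; but
  -- then the pressure gradient is zero and the bound with constant 0 gives L = 0.
  rcases Nat.eq_zero_or_pos n with rfl | hpos
  · have hz : ∀ᵐ x ∂discMeasure, |radl (fun j => weakPartial j lam) x| ≤ 0 ∧
        |ang (fun j => weakPartial j lam) x| ≤ 0 := by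
      filter_upwards [hb] with x hx
      rw [Nat.cast_zero, zero_mul, zero_pow two_ne_zero] at hx
      have h1 := sq_nonneg (ang (fun j => weakPartial j lam) x)
      have h2 := sq_nonneg (radl (fun j => weakPartial j lam) x)
      exact ⟨abs_nonpos_iff.2 (pow_eq_zero_iff two_ne_zero |>.1 (by linarith)),
        abs_nonpos_iff.2 (pow_eq_zero_iff two_ne_zero |>.1 (by linarith))⟩
    have := hp.abs_limit_le_of_components (fun i => (hφ i).2) (fun i => (hφ i).1) hL le_rfl hz
    rw [zero_mul] at this
    simpa using this
  · have h0 := hv.2.2.circleMean_eq_zero hη (not_le.2 hpos)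
    have := hp.abs_limit_le_of_length (fun i => (hφ i).2) (fun i => (hφ i).1) hL h0 hC hb
    rw [angSq, radSq, Fin.sum_univ_two, Fin.sum_univ_two]
    exact this

theorem zeroAndHighModes_main (hν : 0 < ν) (hM : IsCoefficient ν M) (hu : u ∈ admissible g b)
    (hlam : IsStationaryWithPressure M u lam) (m : ℕ)
    (hm : polarSupNorm lam ≤ ENNReal.ofReal (√3 * m * ν / (2 * √2))) :
    IsMinimizer M (zeroAndHighModes g b u m) u ∧
      IsUniqueMinimizer M (zeroAndHighModes g b u m) u := by
  set C := √3 * m * ν / (2 * √2)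
  have hC : 0 ≤ C := by positivity
  have hb : ∀ᵐ x ∂discMeasure, |radl (fun j => weakPartial j lam) x| ≤ C ∧
      |ang (fun j => weakPartial j lam) x| ≤ C := by
    filter_upwards [ae_norm_le_of_eLpNorm_top_le hC ((le_max_left _ _).trans hm),
      ae_norm_le_of_eLpNorm_top_le hC ((le_max_right _ _).trans hm), ae_ne_zero] with x h1 h2 hx
    rw [← scaledGradRad_eq hx, ← scaledGradAng_eq hx]
    exact ⟨h1, h2⟩
  -- A crude bound on the length; it only provides some finite weighted gradient bound, the final
  -- estimate using the componentwise one.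
  have hb2 : ∀ᵐ x ∂discMeasure, ang (fun j => weakPartial j lam) x ^ 2 +
      radl (fun j => weakPartial j lam) x ^ 2 ≤ (2 * C) ^ 2 := by
    filter_upwards [hb] with x hx
    have h1 := pow_le_pow_left₀ (abs_nonneg _) hx.1 2
    have h2 := pow_le_pow_left₀ (abs_nonneg _) hx.2 2
    rw [sq_abs] at h1 h2
    nlinarith [sq_nonneg C]
  have hp := puncturedWeakGrad_weakPartial hlam.1 (by positivity) hb2
  refine isMinimizer_and_unique hu hM fun v hv => ?_
  obtain ⟨φ, hφ⟩ := hv.2.1.exists_punctured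
  have hL := hlam.tendsto_jac hM hp hu.1 hu.2.2 hv.1.1 hu.2.1 hv.1.2.1 hv.2.1.1
    (fun i => (hφ i).1) fun i => (hφ i).2
  have hη : ∀ i, MemLp (fun x => (v x - u x) i) 2 discMeasure := fun i => (hv.2.1.1 i).1
  have hlow := hv.2.1.mul_sqrt_osc_le (m := m)
    (hv.2.2.lowModesVanish hη fun j h0 hj hjS => hjS.elim h0.ne' fun h => absurd hj (not_lt.2 h))
  refine energy_gap_of_components hν (angSq_nonneg _) hlow (radSq_nonneg _) ?_
  have := hp.abs_limit_le_of_components (fun i => (hφ i).2) (fun i => (hφ i).1) hL hC hb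
  rw [angSq, radSq, Fin.sum_univ_two, Fin.sum_univ_two]
  exact this

end Main

end HFU

theorem mainTheorem11 (ν : ℝ) (hν : 0 < ν) (M : Plane → HFU.Tensor4) (hM : HFU.IsCoefficient ν M)
    (g : ℝ → Plane) (hg : HFU.MemW12Circle g) (b : Plane)
    (u : Plane → Plane) (hu : u ∈ HFU.admissible g b)
    (lam : Plane → ℝ) (hlam : HFU.IsStationaryWithPressure M u lam) :
    (∀ n : ℕ, HFU.supNorm lam ≤ ENNReal.ofReal (n * ν) →
      HFU.IsMinimizer M (HFU.highModes g b u n) u ∧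
      (HFU.HoldsOnNontrivialSet (fun x => ‖HFU.scaledGrad lam x‖ < n * ν) →
        HFU.IsUniqueMinimizer M (HFU.highModes g b u n) u)) ∧
    (∀ m : ℕ, HFU.polarSupNorm lam ≤ ENNReal.ofReal (√3 * m * ν / (2 * √2)) →
      HFU.IsMinimizer M (HFU.zeroAndHighModes g b u m) u ∧
      (HFU.HoldsOnNontrivialSet (fun x =>
          max |HFU.scaledGradRad lam x| |HFU.scaledGradAng lam x| < √3 * m * ν / (2 * √2)) →
        HFU.IsUniqueMinimizer M (HFU.zeroAndHighModes g b u m) u)) := by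
  refine ⟨fun n hn => ?_, fun m hm => ?_⟩
  · have h := HFU.highModes_main hν hM hu hlam n hn
    exact ⟨h.1, fun _ => h.2⟩
  · have h := HFU.zeroAndHighModes_main hν hM hu hlam m hm
    exact ⟨h.1, fun _ => h.2⟩
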